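/- All multigraphs are finite and loopless (multiple edges are allowed; two parallel edges form a cycle). For a vertex set $A$, $G[A]$ is the induced submultigraph. For real numbers $a>0$ and $b$, a multigraph $G$ is $(a,b)$-sparse if $|E(G[A])|\le a|A|+b$ for every $A\subseteq V(G)$ with $|A|\ge 2$. For an integer $D\ge 1$, an $(E_D,F,F)$-coloring of $G$ is a partition $(M,F)$ of $V(G)$ (parts may be empty) such that $G[M]$ is a forest in which every connected component has at most $D$ edges, and $G[F]$ is a forest. (i) For each odd $D\ge 1$, every $\left(\frac{4D+3}{2D+2},\frac{1}{2(D+1)}\right)$-sparse multigraph has an $(E_D,F,F)$-coloring. (ii) For each even $D\ge 2$, every $\left(\frac{4D+1}{2D+1},\frac{1}{2D+1}\right)$-sparse multigraph has an $(E_D,F,F)$-coloring. Both parts are sharp, in the following sense. Let $(a,b)$ be the pair in (i), respectively (ii). For every $N$ there is a multigraph $G$ with at least $N$ vertices and with no $(E_D,F,F)$-coloring that is $(a,2b)$-sparse, has exactly $a|V(G)|+2b$ edges, and satisfies $|E(G[A])|\le a|A|+b$ for every proper subset $A\subsetneq V(G)$ with $|A|\ge 2$. (Since $\frac{a}{b}$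 and $\frac1b$ are integers, $2b$ is the smallest constant larger than $b$ for which the sparseness condition is weaker.) Moreover, for every $a'>a$ there is an $(a',b)$-sparse multigraph with no $(E_D,F,F)$-coloring. -/

import Mathlib

namespace Graph

/-- `G` is a finite multigraph: finitely many vertices and finitely many edges. -/
def IsFiniteMultigraph {α β : Type*} (G : Graph α β) : Prop :=
  G.vertexSet.Finite ∧ G.edgeSet.Finite

/-- For a finite multigraph `G`: `G` is `(a, b)`-sparse if it is loopless and, for every set `A` of
at least two vertices, the induced subgraph `G[A]` has at most `a|A| + b` edges. -/
def IsSparse {α β : Type*} (G : Graph α β) (a b : ℝ) : Prop :=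
  G.Loopless ∧ ∀ A : Set α, A ⊆ G.vertexSet → 2 ≤ A.ncard →
    ((G.induce A).edgeSet.ncard : ℝ) ≤ a * (A.ncard : ℝ) + b

/-- `G` contains a cycle with `n + 1` distinct vertices `v 0, …, v n` and `n + 1` distinct edges,
the `i`-th edge joining `v i` to `v (i + 1)`, indices modulo `n + 1`. Thus a loop is a cycle of
length `1` and two parallel edges form a cycle of length `2`. -/
def HasCycleOfLengthSucc {α β : Type*} (G : Graph α β) (n : ℕ) : Prop :=
  ∃ (v : Fin (n + 1) → α) (e : Fin (n + 1) → β),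
    Function.Injective v ∧ Function.Injective e ∧ ∀ i, G.IsLink (e i) (v i) (v (i + 1))

/-- A forest is a multigraph without cycles. -/
def IsForestGraph {α β : Type*} (G : Graph α β) : Prop :=
  ∀ n : ℕ, ¬ G.HasCycleOfLengthSucc n

/-- The vertex set of the connected component of the vertex `x`. -/
def componentSet {α β : Type*} (G : Graph α β) (x : α) : Set α :=
  {y | Relation.ReflTransGen G.Adj x y}

/-- `(M, F)` is a partition of the vertex set of the finite multigraph `G` (parts may be empty)
such that `G[M]` is a forest in which every component has at most `D` edges and `G[F]` is a
forest. -/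
def IsEFFColoring {α β : Type*} (G : Graph α β) (D : ℕ) (M F : Set α) : Prop :=
  M ∪ F = G.vertexSet ∧ Disjoint M F ∧
    (G.induce M).IsForestGraph ∧
    (∀ x ∈ M, ((G.induce M).induce ((G.induce M).componentSet x)).edgeSet.ncard ≤ D) ∧
    (G.induce F).IsForestGraph

/-- `G` has a coloring as in `IsEFFColoring`. -/
def HasEFFColoring {α β : Type*} (G : Graph α β) (D : ℕ) : Prop :=
  ∃ M F : Set α, G.IsEFFColoring D M F

/-- Sharpness of the pair `(a, b)`, where `b'` is the next larger additive constant.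
There are arbitrarily large finite multigraphs without a coloring that are `(a, b')`-sparse and
violate `(a, b)`-sparseness only on the whole vertex set, where the number of edges is exactly
`a|V| + b'`; moreover `a` cannot be replaced by any larger number. -/
def IsSharpPair (D : ℕ) (a b b' : ℝ) : Prop :=
  (∀ N : ℕ, ∃ (α β : Type) (G : Graph α β),
    G.IsFiniteMultigraph ∧ N ≤ G.vertexSet.ncard ∧ G.IsSparse a b' ∧
    (G.edgeSet.ncard : ℝ) = a * (G.vertexSet.ncard : ℝ) + b' ∧
    (∀ A : Set α, A ⊂ G.vertexSet → 2 ≤ A.ncard →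
      ((G.induce A).edgeSet.ncard : ℝ) ≤ a * (A.ncard : ℝ) + b) ∧
    ¬ G.HasEFFColoring D) ∧
  (∀ a' : ℝ, a < a' → ∃ (α β : Type) (G : Graph α β),
    G.IsFiniteMultigraph ∧ G.IsSparse a' b ∧ ¬ G.HasEFFColoring D)

end Graph

set_option linter.unusedSectionVars false

/-! Let k be `edgeCost D`, so k = 2D+1 for even D and k = 2D+2 for odd D; then a = (2k-1)/k and b =
1/k. For the positive part the statement is strengthened so that induction works. A vertex of weight
m behaves in the small part as if m further edges hung on it, and weight D+1 excludes it from that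
part. The potential of A is (2k-1)|A| minus the weight costs minus k times the number of edges.
Sparseness says that nonempty sets have potential at least -1, and every sparse weighted multigraph
is shown to be colorable (`colorable_of_sparse`).

In a smallest counterexample the key fact is `Critical.gap`: a proper subset with at least two
vertices has potential at least k. It rests on the contraction lemma `exists_isCol_union`. Color a
set S of small potential, contract its forest part to one vertex that must lie in F, push the
outside neighbours of its small part into F by giving them weight D+1, and color the rest by
minimality. One edge between the two small parts may be permitted by splitting the budget D+1
between its ends. The gap pays for raising weights, so a vertex of degree three can be deleted while
slack is reserved at its neighbours, and the coloring then extends to it.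

For even D the local charges now add up to less than -1, a contradiction. For odd D = 2h+1, vertices
of degree three and weight h ("light") have charge +1. They are pairwise nonadjacent, and each sends
1/3 to its three neighbours. The delicate point is `Critical.not_lightStar`: a vertex of degree four
and weight zero does not have three light neighbours. It is proved by contracting a set that
obstructs raising all outer neighbours of the star. After discharging, one configuration with five
vertices remains, and it is colored by hand.

For sharpness, weighted gadgets of potential -2 without a coloring are enlarged by chains of gadgets
that force a vertex into M. A unit of weight is then realised by two vertices joined by a double
edge and both adjacent to the weighted vertex: one of the two must lie in M. These operations
preserve the potential. -/

/-- A loopless multigraph on `V`, given by its edge multiplicities. -/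
structure MultGraph (V : Type*) where
  mult : V → V → ℕ
  symm : ∀ x y, mult x y = mult y x
  irrefl : ∀ x, mult x x = 0

/-! ### Edge counts and weighted colorings. -/

namespace MultGraph

variable {V : Type*} [DecidableEq V] (G : MultGraph V)

/-- The number of edges from `v` to `A`. -/
def degIn (v : V) (A : Finset V) : ℤ := ∑ y ∈ A, (G.mult v y : ℤ)

/-- The number of edges from `A` to `B`, for disjoint `A` and `B`. -/
def cross (A B : Finset V) : ℤ := ∑ x ∈ A, G.degIn x B

/-- The number of edges inside `A`. -/
def edges (A : Finset V) : ℤ := G.cross A A / 2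

lemma degIn_nonneg (v : V) (A : Finset V) : 0 ≤ G.degIn v A :=
  Finset.sum_nonneg fun _ _ => Int.natCast_nonneg _

@[simp] lemma degIn_empty (v : V) : G.degIn v ∅ = 0 := rfl

@[simp] lemma degIn_singleton (v x : V) : G.degIn v {x} = G.mult v x := by simp [degIn]

lemma degIn_insert (v : V) {x : V} {A : Finset V} (h : x ∉ A) :
    G.degIn v (insert x A) = G.mult v x + G.degIn v A := by
  simp [degIn, Finset.sum_insert h]

lemma degIn_insert_self (v : V) (A : Finset V) : G.degIn v (insert v A) = G.degIn v A := by
  by_cases h : v ∈ A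
  · rw [Finset.insert_eq_of_mem h]
  · rw [degIn_insert _ _ h, G.irrefl]; simp

lemma degIn_union (v : V) {A B : Finset V} (h : Disjoint A B) :
    G.degIn v (A ∪ B) = G.degIn v A + G.degIn v B := by
  simp [degIn, Finset.sum_union h]

lemma degIn_mono (v : V) {A B : Finset V} (h : A ⊆ B) : G.degIn v A ≤ G.degIn v B :=
  Finset.sum_le_sum_of_subset_of_nonneg h fun _ _ _ => Int.natCast_nonneg _

lemma mult_le_degIn (v : V) {x : V} {A : Finset V} (h : x ∈ A) :
    (G.mult v x : ℤ) ≤ G.degIn v A := by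
  rw [← degIn_singleton]
  exact G.degIn_mono v (by simpa using h)

lemma mult_add_mult_le_degIn (v : V) {x y : V} {A : Finset V} (hx : x ∈ A) (hy : y ∈ A)
    (hxy : x ≠ y) : (G.mult v x : ℤ) + G.mult v y ≤ G.degIn v A := by
  have := G.degIn_mono v (A := {x, y}) (B := A) (by grind)
  rwa [degIn_insert _ _ (by simpa using hxy), degIn_singleton] at this

lemma exists_mult_pos_of_degIn_pos {v : V} {A : Finset V} (h : 0 < G.degIn v A) :
    ∃ x ∈ A, 1 ≤ G.mult v x := by
  by_contra! hc
  have : G.degIn v A = 0 := Finset.sum_eq_zero fun x hx => by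
    have := hc x hx; simp; omega
  omega

lemma exists_of_degIn_eq_one {v : V} {A : Finset V} (h : G.degIn v A = 1) :
    ∃ x ∈ A, G.mult v x = 1 ∧ ∀ y ∈ A, y ≠ x → G.mult v y = 0 := by
  obtain ⟨x, hx, h1⟩ := G.exists_mult_pos_of_degIn_pos (v := v) (A := A) (by omega)
  have h2 := G.mult_le_degIn v hx
  refine ⟨x, hx, by omega, fun y hy hyx => ?_⟩
  have := G.mult_add_mult_le_degIn v hx hy hyx.symm
  omega

lemma cross_comm (A B : Finset V) : G.cross A B = G.cross B A := by
  unfold cross degIn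
  rw [Finset.sum_comm]
  simp_rw [fun x y => G.symm x y]

lemma cross_nonneg (A B : Finset V) : 0 ≤ G.cross A B :=
  Finset.sum_nonneg fun _ _ => G.degIn_nonneg _ _

@[simp] lemma cross_singleton_left (v : V) (A : Finset V) : G.cross {v} A = G.degIn v A := by
  simp [cross]

@[simp] lemma cross_singleton_right (v : V) (A : Finset V) : G.cross A {v} = G.degIn v A := by
  rw [cross_comm, cross_singleton_left]

@[simp] lemma cross_empty_left (A : Finset V) : G.cross ∅ A = 0 := by simp [cross]

lemma cross_union_left {A B : Finset V} (h : Disjoint A B) (C : Finset V) :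
    G.cross (A ∪ B) C = G.cross A C + G.cross B C := by
  simp [cross, Finset.sum_union h]

lemma cross_union_right {A B : Finset V} (h : Disjoint A B) (C : Finset V) :
    G.cross C (A ∪ B) = G.cross C A + G.cross C B := by
  rw [cross_comm, cross_union_left _ h, cross_comm _ A, cross_comm _ B]

lemma cross_mono {A A' B B' : Finset V} (hA : A ⊆ A') (hB : B ⊆ B') :
    G.cross A B ≤ G.cross A' B' :=
  (Finset.sum_le_sum fun x _ => G.degIn_mono x hB).trans
    (Finset.sum_le_sum_of_subset_of_nonneg hA fun _ _ _ => G.degIn_nonneg _ _)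

lemma cross_self_insert {v : V} {A : Finset V} (h : v ∉ A) :
    G.cross (insert v A) (insert v A) = G.cross A A + 2 * G.degIn v A := by
  rw [Finset.insert_eq, cross_union_left _ (by simpa using h),
    cross_union_right _ (by simpa using h), cross_union_right _ (by simpa using h)]
  simp [G.irrefl]; ring

lemma two_mul_edges (A : Finset V) : 2 * G.edges A = G.cross A A := by
  have : (2 : ℤ) ∣ G.cross A A := by
    induction A using Finset.induction_on with
    | empty => simp
    | insert v A h ih => rw [cross_self_insert _ h]; omega
  unfold edges; omega

@[simp] lemma edges_empty : G.edges ∅ = 0 := by simp [edges]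

@[simp] lemma edges_singleton (v : V) : G.edges {v} = 0 := by simp [edges, G.irrefl]

lemma edges_insert {v : V} {A : Finset V} (h : v ∉ A) :
    G.edges (insert v A) = G.edges A + G.degIn v A := by
  have h1 := G.two_mul_edges A
  have h2 := G.two_mul_edges (insert v A)
  rw [cross_self_insert _ h] at h2
  omega

lemma edges_union {A B : Finset V} (h : Disjoint A B) :
    G.edges (A ∪ B) = G.edges A + G.edges B + G.cross A B := by
  have h1 := G.two_mul_edges A
  have h2 := G.two_mul_edges B
  have h3 := G.two_mul_edges (A ∪ B)
  rw [cross_union_left _ h, cross_union_right _ h, cross_union_right _ h, G.cross_comm B A] at h3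
  omega

/-- The induced subgraph on `F` is a forest. -/
def IsAcyc (F : Finset V) : Prop := ∀ B ⊆ F, B.Nonempty → G.edges B + 1 ≤ B.card

/-- The induced subgraph on `M` is a forest, and in every subtree the number of edges plus the
total weight of the vertices is at most `D`. -/
def IsSmallForest (w : V → ℕ) (D : ℕ) (M : Finset V) : Prop :=
  ∀ B ⊆ M, B.Nonempty → G.edges B + 1 ≤ B.card ∧
    (G.edges B + 1 = B.card → ∑ x ∈ B, w x + B.card ≤ D + 1)

/-- `(M, F)` is a weighted coloring of the induced subgraph on `Y`. -/
structure IsCol (w : V → ℕ) (D : ℕ) (Y M F : Finset V) : Prop where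
  union : M ∪ F = Y
  disj : Disjoint M F
  small : G.IsSmallForest w D M
  acyc : G.IsAcyc F

/-- The induced subgraph on `Y` has a weighted coloring. -/
def Colorable (w : V → ℕ) (D : ℕ) (Y : Finset V) : Prop := ∃ M F, G.IsCol w D Y M F

variable {G}

lemma isAcyc_insert {F : Finset V} {v : V} (h : G.IsAcyc F) (hv : v ∉ F)
    (hd : ∀ B ⊆ F, B.Nonempty → G.edges B + G.degIn v B ≤ B.card) : G.IsAcyc (insert v F) := by
  intro B hB hne
  by_cases hvB : v ∈ B
  · obtain ⟨C, hvC, rfl⟩ : ∃ C, v ∉ C ∧ B = insert v C :=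
      ⟨B.erase v, by simp, (Finset.insert_erase hvB).symm⟩
    rw [G.edges_insert hvC, Finset.card_insert_of_notMem hvC]
    rcases C.eq_empty_or_nonempty with rfl | hC
    · simp
    · have := hd C (fun x hx => (Finset.mem_insert.1 (hB (Finset.mem_insert_of_mem hx))).resolve_left
        (by rintro rfl; exact hvC hx)) hC
      push_cast; omega
  · exact h B (fun x hx => (Finset.mem_insert.1 (hB hx)).resolve_left
      (by rintro rfl; exact hvB hx)) hne

lemma IsAcyc.insert_leaf {F : Finset V} {v : V} (h : G.IsAcyc F) (hv : v ∉ F)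
    (hd : G.degIn v F ≤ 1) : G.IsAcyc (insert v F) :=
  isAcyc_insert h hv fun B hB hne => by
    have := h B hB hne
    have := G.degIn_mono v hB
    omega

lemma IsSmallForest.mono {w w' : V → ℕ} {D : ℕ} {M : Finset V} (h : G.IsSmallForest w' D M)
    (hw : ∀ x ∈ M, w x ≤ w' x) : G.IsSmallForest w D M := fun B hB hne => by
  refine ⟨(h B hB hne).1, fun he => le_trans ?_ ((h B hB hne).2 he)⟩
  gcongr with x hx
  exact hw x (hB hx)

lemma IsSmallForest.weight_le {w : V → ℕ} {D : ℕ} {M : Finset V}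
    (h : G.IsSmallForest w D M) {x : V} (hx : x ∈ M) : w x ≤ D := by
  have := (h {x} (by simpa using hx) (by simp)).2 (by simp)
  simp at this; omega

/-- The surplus of `w'` over `w` at a neighbour of `v` is a reserve that pays for `v`, its weight
and the new edge. A subtree through `v` meets only one such edge, so the reserve is used once. -/
lemma IsSmallForest.insert {w w' : V → ℕ} {D : ℕ} {M : Finset V} {v : V}
    (h : G.IsSmallForest w' D M) (hv : v ∉ M) (hw : ∀ x ∈ M, w x ≤ w' x) (hvD : w v ≤ D)
    (hd : G.degIn v M ≤ 1) (hs : ∀ x ∈ M, G.mult v x = 1 → w x + (w v + 1) ≤ w' x) :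
    G.IsSmallForest w D (insert v M) := by
  intro B hB hne
  by_cases hvB : v ∈ B
  · obtain ⟨C, hvC, rfl⟩ : ∃ C, v ∉ C ∧ B = Insert.insert v C :=
      ⟨B.erase v, by simp, (Finset.insert_erase hvB).symm⟩
    have hCM : C ⊆ M := fun x hx => (Finset.mem_insert.1 (hB (Finset.mem_insert_of_mem hx))).resolve_left
        (by rintro rfl; exact hvC hx)
    rw [G.edges_insert hvC, Finset.card_insert_of_notMem hvC, Finset.sum_insert hvC]
    rcases C.eq_empty_or_nonempty with rfl | hC
    · simp; omega
    · have h1 := h C hCM hC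
      have h2 := G.degIn_mono v hCM
      refine ⟨by push_cast; omega, fun he => ?_⟩
      push_cast at he
      obtain ⟨x, hx, hx1, -⟩ := G.exists_of_degIn_eq_one (v := v) (A := C) (by omega)
      have h3 := h1.2 (by omega)
      have h4 : ∑ y ∈ C, w y + (w v + 1) ≤ ∑ y ∈ C, w' y := by
        rw [← Finset.add_sum_erase _ _ hx, ← Finset.add_sum_erase _ w' hx]
        have h5 := hs x (hCM hx) hx1
        have h6 : ∑ y ∈ C.erase x, w y ≤ ∑ y ∈ C.erase x, w' y :=
          Finset.sum_le_sum fun y hy => hw y (hCM (Finset.mem_of_mem_erase hy))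
        omega
      omega
  · exact (h.mono hw) B (fun x hx => (Finset.mem_insert.1 (hB hx)).resolve_left
      (by rintro rfl; exact hvB hx)) hne

lemma IsCol.mono {w w' : V → ℕ} {D : ℕ} {Y M F : Finset V} (h : G.IsCol w' D Y M F)
    (hw : ∀ x ∈ M, w x ≤ w' x) : G.IsCol w D Y M F :=
  ⟨h.union, h.disj, h.small.mono hw, h.acyc⟩

lemma IsCol.subset_left {w : V → ℕ} {D : ℕ} {Y M F : Finset V} (h : G.IsCol w D Y M F) : M ⊆ Y :=
  h.union ▸ Finset.subset_union_left

lemma IsCol.subset_right {w : V → ℕ} {D : ℕ} {Y M F : Finset V} (h : G.IsCol w D Y M F) : F ⊆ Y :=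
  h.union ▸ Finset.subset_union_right

lemma IsCol.degIn_add {w : V → ℕ} {D : ℕ} {Y M F : Finset V} (h : G.IsCol w D Y M F) (v : V) :
    G.degIn v M + G.degIn v F = G.degIn v Y := by
  rw [← h.union, G.degIn_union v h.disj]

lemma isCol_empty (G : MultGraph V) (w : V → ℕ) (D : ℕ) : G.IsCol w D ∅ ∅ ∅ :=
  ⟨by simp, by simp, fun B hB hne => by simp_all, fun B hB hne => by simp_all⟩

lemma IsCol.insert_right_of_acyc {w : V → ℕ} {D : ℕ} {Y M F : Finset V} {v : V}
    (h : G.IsCol w D Y M F) (hv : v ∉ Y) (ha : G.IsAcyc (insert v F)) :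
    G.IsCol w D (insert v Y) M (insert v F) :=
  ⟨by rw [Finset.union_insert, h.union],
    Finset.disjoint_insert_right.2 ⟨fun hM => hv (h.subset_left hM), h.disj⟩, h.small, ha⟩

lemma IsCol.insert_right {w : V → ℕ} {D : ℕ} {Y M F : Finset V} {v : V}
    (h : G.IsCol w D Y M F) (hv : v ∉ Y) (hd : G.degIn v F ≤ 1) :
    G.IsCol w D (insert v Y) M (insert v F) :=
  h.insert_right_of_acyc hv (h.acyc.insert_leaf (fun hF => hv (h.subset_right hF)) hd)

lemma IsCol.insert_left {w w' : V → ℕ} {D : ℕ} {Y M F : Finset V} {v : V}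
    (h : G.IsCol w' D Y M F) (hv : v ∉ Y) (hw : ∀ x ∈ Y, w x ≤ w' x) (hvD : w v ≤ D)
    (hd : G.degIn v M ≤ 1) (hs : ∀ x ∈ M, G.mult v x = 1 → w x + (w v + 1) ≤ w' x) :
    G.IsCol w D (insert v Y) (insert v M) F :=
  ⟨by rw [Finset.insert_union, h.union],
    Finset.disjoint_insert_left.2 ⟨fun hF => hv (h.subset_right hF), h.disj⟩,
    h.small.insert (fun hM => hv (h.subset_left hM))
      (fun x hx => hw x (h.subset_left hx)) hvD hd hs, h.acyc⟩

lemma IsCol.insert_left_isolated {w : V → ℕ} {D : ℕ} {Y M F : Finset V} {v : V}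
    (h : G.IsCol w D Y M F) (hv : v ∉ Y) (hvD : w v ≤ D) (hd : G.degIn v M ≤ 0) :
    G.IsCol w D (insert v Y) (insert v M) F :=
  h.insert_left hv (fun _ _ => le_rfl) hvD (by omega) fun x hx h1 => by
    have := G.mult_le_degIn v hx; omega

/-- A vertex of degree at most three can be added to a coloring if its neighbours have some
slack. -/
lemma IsCol.insert_of_degIn_le_three {w w' : V → ℕ} {D : ℕ} {Y M F : Finset V} {v : V}
    (h : G.IsCol w' D Y M F) (hv : v ∉ Y) (hw : ∀ x ∈ Y, w x ≤ w' x) (hvD : w v ≤ D)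
    (hd : G.degIn v Y ≤ 3) (hs : ∀ x ∈ M, G.mult v x = 1 → w x + (w v + 1) ≤ w' x) :
    ∃ M' F', G.IsCol w D (insert v Y) M' F' ∧ M' ⊆ insert v M ∧ F ⊆ F' := by
  by_cases hF : G.degIn v F ≤ 1
  · exact ⟨_, _, (h.mono fun x hx => hw x (h.subset_left hx)).insert_right hv hF, Finset.subset_insert _ _, Finset.subset_insert _ _⟩
  · have := h.degIn_add v
    exact ⟨_, _, h.insert_left hv hw hvD (by omega) hs, subset_rfl, subset_rfl⟩

end MultGraph

/-! ### The potential and its costs. -/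

namespace MultGraph

/-- The cost of an edge in the potential. -/
def edgeCost (D : ℕ) : ℤ := if D % 2 = 0 then 2 * D + 1 else 2 * D + 2

/-- The cost of a vertex weight in the potential. -/
def weightCost (D m : ℕ) : ℤ :=
  if D % 2 = 0 ∧ D < 2 * min m (D + 1) then 2 * (min m (D + 1) : ℕ) - 1
  else 2 * (min m (D + 1) : ℕ)

lemma edgeCost_even {D : ℕ} (h : D % 2 = 0) : edgeCost D = 2 * D + 1 := by simp [edgeCost, h]

lemma edgeCost_odd {D : ℕ} (h : D % 2 = 1) : edgeCost D = 2 * D + 2 := by simp [edgeCost, h]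

lemma weightCost_odd {D : ℕ} (h : D % 2 = 1) (m : ℕ) :
    weightCost D m = 2 * (min m (D + 1) : ℕ) := by simp [weightCost, h]

lemma edgeCost_pos (D : ℕ) : 1 ≤ edgeCost D := by unfold edgeCost; split_ifs <;> omega

lemma weightCost_nonneg (D m : ℕ) : 0 ≤ weightCost D m := by
  unfold weightCost; split_ifs <;> omega

lemma weightCost_zero (D : ℕ) : weightCost D 0 = 0 := by simp [weightCost]

lemma weightCost_le (D m : ℕ) : weightCost D m ≤ edgeCost D := by
  unfold weightCost edgeCost; split_ifs <;> omega

lemma weightCost_of_le {D m : ℕ} (h : D + 1 ≤ m) : weightCost D m = edgeCost D := by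
  unfold weightCost edgeCost; split_ifs <;> omega

lemma weightCost_add_le (D a b : ℕ) : weightCost D (a + b) ≤ weightCost D a + weightCost D b := by
  unfold weightCost; split_ifs <;> omega

lemma weightCost_le_two_mul (D m : ℕ) : weightCost D m ≤ 2 * m := by
  unfold weightCost; split_ifs <;> omega

/-- Splitting the budget D+1 between the ends of an edge costs exactly as much as the edge. For even
D, where k is odd, this is why the cost drops from 2m to 2m-1 once m exceeds D/2. -/
lemma weightCost_add_compl {D a : ℕ} (h : a ≤ D + 1) :
    weightCost D a + weightCost D (D + 1 - a) = edgeCost D := by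
  unfold weightCost edgeCost; split_ifs <;> omega

/-- The weight costs leave no gap larger than two in the range from 0 to k. The resulting error of
one is exactly the tolerance in the bound -1 for the potential. -/
lemma exists_weightCost {D : ℕ} {p : ℤ} (h0 : 0 ≤ p) (hp : p ≤ edgeCost D) :
    ∃ r ≤ D + 1, p ≤ weightCost D r ∧ weightCost D r ≤ p + 1 := by
  obtain ⟨q, rfl⟩ := Int.eq_ofNat_of_zero_le h0
  unfold edgeCost at hp
  by_cases hc : D % 2 = 0 ∧ D < q
  · exact ⟨(q + 2) / 2, by split_ifs at hp <;> omega, by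
      unfold weightCost; split_ifs at hp ⊢ <;> omega, by
      unfold weightCost; split_ifs at hp ⊢ <;> omega⟩
  · exact ⟨(q + 1) / 2, by split_ifs at hp <;> omega, by
      unfold weightCost; split_ifs at hp ⊢ <;> omega, by
      unfold weightCost; split_ifs at hp ⊢ <;> omega⟩

variable {V : Type*} [DecidableEq V]

/-- The potential of a vertex set in a weighted multigraph. -/
def pot (D : ℕ) (G : MultGraph V) (w : V → ℕ) (A : Finset V) : ℤ :=
  ∑ x ∈ A, (2 * edgeCost D - 1 - weightCost D (w x)) - edgeCost D * G.edges A

/-- All nonempty subsets of `Y` have potential at least `-1`. -/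
def Sparse (D : ℕ) (G : MultGraph V) (w : V → ℕ) (Y : Finset V) : Prop :=
  ∀ A ⊆ Y, A.Nonempty → -1 ≤ pot D G w A

lemma Sparse.mono {D : ℕ} {G : MultGraph V} {w : V → ℕ} {Y Y' : Finset V} (h : Sparse D G w Y)
    (hY : Y' ⊆ Y) : Sparse D G w Y' := fun A hA hne => h A (hA.trans hY) hne

lemma pot_singleton (D : ℕ) (G : MultGraph V) (w : V → ℕ) (x : V) :
    pot D G w {x} = 2 * edgeCost D - 1 - weightCost D (w x) := by simp [pot]

lemma pot_singleton_ge (D : ℕ) (G : MultGraph V) (w : V → ℕ) (x : V) :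
    edgeCost D - 1 ≤ pot D G w {x} := by
  have := weightCost_le D (w x); rw [pot_singleton]; omega

lemma pot_union (D : ℕ) (G : MultGraph V) (w : V → ℕ) {A B : Finset V} (h : Disjoint A B) :
    pot D G w (A ∪ B) = pot D G w A + pot D G w B - edgeCost D * G.cross A B := by
  unfold pot
  rw [Finset.sum_union h, G.edges_union h]; ring

lemma pot_insert (D : ℕ) (G : MultGraph V) (w : V → ℕ) {A : Finset V} {v : V} (h : v ∉ A) :
    pot D G w (insert v A) = pot D G w A + (2 * edgeCost D - 1 - weightCost D (w v))
      - edgeCost D * G.degIn v A := by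
  unfold pot
  rw [Finset.sum_insert h, G.edges_insert h]; ring

lemma pot_weight_sub (D : ℕ) (G : MultGraph V) (w w' : V → ℕ) (A : Finset V) :
    pot D G w' A = pot D G w A - ∑ x ∈ A, (weightCost D (w' x) - weightCost D (w x)) := by
  unfold pot
  simp only [Finset.sum_sub_distrib]; ring

lemma pot_raise_ge (D : ℕ) (G : MultGraph V) (w : V → ℕ) (t : V → ℕ) (A : Finset V) :
    pot D G w A - ∑ x ∈ A, weightCost D (t x) ≤ pot D G (fun x => w x + t x) A := by
  rw [pot_weight_sub D G w (fun x => w x + t x)]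
  have : ∑ x ∈ A, (weightCost D (w x + t x) - weightCost D (w x)) ≤ ∑ x ∈ A, weightCost D (t x) :=
    Finset.sum_le_sum fun x _ => by have := weightCost_add_le D (w x) (t x); omega
  omega

/-- A raised weight function is sparse if this holds for sets with at least two elements. -/
lemma sparse_of_two_le {D : ℕ} {G : MultGraph V} {w : V → ℕ} {Y : Finset V}
    (h : ∀ A ⊆ Y, 2 ≤ A.card → -1 ≤ pot D G w A) : Sparse D G w Y := by
  intro A hA hne
  rcases Nat.lt_or_ge A.card 2 with h2 | h2
  · obtain ⟨x, rfl⟩ := Finset.card_eq_one.1 (by have := hne.card_pos; omega : A.card = 1)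
    have := pot_singleton_ge D G w x
    have := edgeCost_pos D
    omega
  · exact h A hA h2

/-! ### Contraction of a colored set. -/

/-- Replace all edges at `f`: the vertex `x` is joined to `f` by `t x` edges. -/
def rewire (G : MultGraph V) (f : V) (t : V → ℕ) : MultGraph V where
  mult x y := if x = f then (if y = f then 0 else t y) else if y = f then t x else G.mult x y
  symm x y := by
    by_cases hx : x = f <;> by_cases hy : y = f <;> simp [hx, hy, G.symm]
  irrefl x := by by_cases hx : x = f <;> simp [hx, G.irrefl]

lemma edges_congr {G G' : MultGraph V} {A : Finset V}
    (h : ∀ x ∈ A, ∀ y ∈ A, G'.mult x y = G.mult x y) : G'.edges A = G.edges A := by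
  unfold edges cross degIn
  congr 1
  exact Finset.sum_congr rfl fun x hx => Finset.sum_congr rfl fun y hy => by rw [h x hx y hy]

lemma edges_rewire (G : MultGraph V) {f : V} (t : V → ℕ) {A : Finset V} (h : f ∉ A) :
    (G.rewire f t).edges A = G.edges A :=
  edges_congr fun x hx y hy => by
    have hx' : x ≠ f := by rintro rfl; exact h hx
    have hy' : y ≠ f := by rintro rfl; exact h hy
    simp [rewire, hx', hy']

lemma degIn_rewire (G : MultGraph V) {f : V} (t : V → ℕ) {A : Finset V} (h : f ∉ A) :
    (G.rewire f t).degIn f A = ∑ x ∈ A, (t x : ℤ) :=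
  Finset.sum_congr rfl fun x hx => by
    have hx' : x ≠ f := by rintro rfl; exact h hx
    simp [rewire, hx']

lemma exists_natCast_degIn (G : MultGraph V) (A : Finset V) :
    ∃ t : V → ℕ, ∀ x, (t x : ℤ) = G.degIn x A :=
  ⟨fun x => ∑ y ∈ A, G.mult x y, fun x => by simp [degIn]⟩

/-- Contraction of a colored set: a coloring of `S` extends to `S ∪ R` if the rest can be colored
after contracting the forest part of `S` to a single vertex and raising the weights of the
neighbours of the small part of `S`. -/
lemma exists_isCol_union {D n : ℕ}
    (ih : ∀ (G' : MultGraph V) (w' : V → ℕ) (Y' : Finset V), Y'.card < n → Sparse D G' w' Y' →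
      G'.Colorable w' D Y')
    {G : MultGraph V} {w wS wR w' : V → ℕ} {S R MS FS : Finset V} (hS : G.IsCol wS D S MS FS)
    (hSR : Disjoint S R) (hne : S.Nonempty) (hn : R.card + 1 < n) (ex : V → ℕ) (g : V → ℤ)
    (hg : ∀ x ∈ R, weightCost D (wR x) - weightCost D (w x) ≤ edgeCost D * G.degIn x MS + g x)
    (h1 : ∀ X ⊆ R, X.Nonempty → -1 ≤ pot D G w (X ∪ S) - pot D G w S
      + edgeCost D * G.cross X FS - ∑ x ∈ X, g x)
    (h2 : ∀ X ⊆ R, X.Nonempty → -1 ≤ pot D G w (X ∪ S) - pot D G w S + edgeCost D - 1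
      - edgeCost D * ∑ x ∈ X, (ex x : ℤ) - ∑ x ∈ X, g x)
    (hwS : ∀ x ∈ S, w' x ≤ wS x) (hwR : ∀ x ∈ R, w' x ≤ wR x) (u v : V) (r : ℕ)
    (hr : r ≤ D + 1)
    (hM : ∀ x ∈ R, 0 < G.degIn x MS → D + 1 ≤ wR x ∨
      x = v ∧ G.degIn x MS = 1 ∧ u ∈ MS ∧ 1 ≤ G.mult x u ∧ w' u + r ≤ wS u ∧
        w' x + (D + 1 - r) ≤ wR x) :
    ∃ M F, M ⊆ R ∧ F ⊆ R ∧ G.IsCol w' D (S ∪ R) (MS ∪ M) (FS ∪ F) ∧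
      ∀ A ⊆ FS, ∀ B ⊆ F, A.Nonempty → B.Nonempty →
        G.edges (A ∪ B) + ∑ x ∈ B, (ex x : ℤ) + 1 ≤ (A ∪ B).card := by
  obtain ⟨f, hf⟩ := hne
  have hfR : f ∉ R := Finset.disjoint_left.1 hSR hf
  obtain ⟨t, ht⟩ := G.exists_natCast_degIn FS
  -- A vertex `f` of `S` is reused as the contracted vertex, so the vertex type stays the same. Its
  -- weight D+1 forces it into the forest part.
  set G' := G.rewire f (fun x => t x + ex x) with hG'
  set w₁ : V → ℕ := fun x => if x = f then D + 1 else wR x with hw₁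
  have hw₁R : ∀ x ∈ R, w₁ x = wR x := fun x hx => by
    have : x ≠ f := by rintro rfl; exact hfR hx
    simp [hw₁, this]
  have hXS : ∀ X ⊆ R, Disjoint X S := fun X hX => (hSR.mono_right hX).symm
  have hpot : ∀ X ⊆ R, pot D G w (X ∪ S) - pot D G w S + edgeCost D * G.cross X FS
      - ∑ x ∈ X, g x ≤ pot D G' w₁ X := by
    intro X hX
    have e1 : pot D G' w₁ X = pot D G wR X := by
      unfold pot
      rw [hG', edges_rewire _ _ (fun h => hfR (hX h))]
      congr 1
      exact Finset.sum_congr rfl fun x hx => by rw [hw₁R x (hX hx)]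
    rw [e1, pot_weight_sub D G w wR, pot_union D G w (hXS X hX), ← hS.union,
      G.cross_union_right hS.disj]
    have : ∑ x ∈ X, (weightCost D (wR x) - weightCost D (w x)) ≤
        edgeCost D * G.cross X MS + ∑ x ∈ X, g x := by
      unfold cross
      rw [Finset.mul_sum, ← Finset.sum_add_distrib]
      exact Finset.sum_le_sum fun x hx => hg x (hX hx)
    linarith
  -- For sets through `f` the edges to `FS` are charged again and cancel the gain in `hpot`, while
  -- `f` itself contributes (2k-1)-k = k-1. This is the form of `h2`.
  have hsp : Sparse D G' w₁ (insert f R) := by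
    intro X hX hne
    by_cases hfX : f ∈ X
    · obtain ⟨Z, hfZ, rfl⟩ : ∃ Z, f ∉ Z ∧ X = insert f Z :=
        ⟨X.erase f, by simp, (Finset.insert_erase hfX).symm⟩
      have hZ : Z ⊆ R := fun x hx => (Finset.mem_insert.1
        (hX (Finset.mem_insert_of_mem hx))).resolve_left (by rintro rfl; exact hfZ hx)
      rw [pot_insert _ _ _ hfZ, hG', degIn_rewire _ _ hfZ, ← hG']
      have e1 : weightCost D (w₁ f) = edgeCost D := weightCost_of_le (by simp [hw₁])
      rw [e1]
      rcases Z.eq_empty_or_nonempty with rfl | hZne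
      · have := edgeCost_pos D
        simp [pot]; omega
      · have a1 := hpot Z hZ
        have a2 := h2 Z hZ hZne
        have a3 : ∑ x ∈ Z, ((t x + ex x : ℕ) : ℤ) = G.cross Z FS + ∑ x ∈ Z, (ex x : ℤ) := by
          unfold cross
          rw [← Finset.sum_add_distrib]
          exact Finset.sum_congr rfl fun x _ => by rw [← ht]; push_cast; ring
        rw [a3]
        linarith
    · have hX' : X ⊆ R := fun x hx => (Finset.mem_insert.1 (hX hx)).resolve_left
        (by rintro rfl; exact hfX hx)
      exact (h1 X hX' hne).trans (hpot X hX')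
  obtain ⟨M, F, hc⟩ := ih G' w₁ (insert f R)
    (by rw [Finset.card_insert_of_notMem hfR]; omega) hsp
  have hfM : f ∉ M := fun h => by
    have := hc.small.weight_le h
    simp [hw₁] at this
  have hfF : f ∈ F := by
    have : f ∈ M ∪ F := by rw [hc.union]; simp
    exact (Finset.mem_union.1 this).resolve_left hfM
  have hMR : M ⊆ R := fun x hx => (Finset.mem_insert.1 (hc.subset_left hx)).resolve_left
    (by rintro rfl; exact hfM hx)
  have hFR : F.erase f ⊆ R := fun x hx => (Finset.mem_insert.1
    (hc.subset_right (Finset.mem_of_mem_erase hx))).resolve_left (Finset.ne_of_mem_erase hx)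
  have hedge : ∀ B ⊆ R, G'.edges B = G.edges B := fun B hB =>
    edges_rewire _ _ fun h => hfR (hB h)
  have hacyc : ∀ A ⊆ FS, ∀ B ⊆ F.erase f, A.Nonempty → B.Nonempty →
      G.edges (A ∪ B) + ∑ x ∈ B, (ex x : ℤ) + 1 ≤ (A ∪ B).card := by
    intro A hA B hB hAne hBne
    have hAB : Disjoint A B := hSR.mono (hA.trans hS.subset_right) (hB.trans hFR)
    have hfB : f ∉ B := fun h => hfR (hFR (hB h))
    have b1 := hS.acyc A hA hAne
    have b2 := hc.acyc (insert f B) (Finset.insert_subset hfF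
      (hB.trans (Finset.erase_subset _ _))) (by simp)
    rw [G'.edges_insert hfB, hG', degIn_rewire _ _ hfB, ← hG', hedge B (hB.trans hFR),
      Finset.card_insert_of_notMem hfB] at b2
    have a3 : ∑ x ∈ B, ((t x + ex x : ℕ) : ℤ) = G.cross B FS + ∑ x ∈ B, (ex x : ℤ) := by
      unfold cross
      rw [← Finset.sum_add_distrib]
      exact Finset.sum_congr rfl fun x _ => by rw [← ht]; push_cast; ring
    rw [a3] at b2
    have b3 := G.cross_mono (subset_refl B) hA
    rw [G.edges_union hAB, G.cross_comm A B, Finset.card_union_of_disjoint hAB]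
    push_cast at b2 ⊢
    omega
  refine ⟨M, F.erase f, hMR, hFR, ⟨?_, ?_, ?_, ?_⟩, hacyc⟩
  · ext x
    have hx1 : x ∈ MS ∪ FS ↔ x ∈ S := by rw [hS.union]
    have hx2 : x ∈ M ∪ F ↔ x ∈ insert f R := by rw [hc.union]
    simp only [Finset.mem_union, Finset.mem_erase, Finset.mem_insert] at hx1 hx2 ⊢
    constructor
    · rintro ((h | h) | (h | h))
      · exact Or.inl (hx1.1 (Or.inl h))
      · exact Or.inr (hMR h)
      · exact Or.inl (hx1.1 (Or.inr h))
      · exact Or.inr ((hx2.1 (Or.inr h.2)).resolve_left h.1)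
    · rintro (h | h)
      · rcases hx1.2 h with h | h <;> simp [h]
      · have hxf : x ≠ f := by rintro rfl; exact hfR h
        rcases hx2.2 (Or.inr h) with h | h <;> simp [h, hxf]
  · rw [Finset.disjoint_union_left, Finset.disjoint_union_right, Finset.disjoint_union_right]
    exact ⟨⟨hS.disj, hSR.mono hS.subset_left hFR⟩, (hSR.mono hS.subset_right hMR).symm,
      hc.disj.mono_right (Finset.erase_subset _ _)⟩
  · intro C hC hCne
    obtain ⟨A, B, hA, hB, rfl⟩ : ∃ A B, A ⊆ MS ∧ B ⊆ M ∧ C = A ∪ B :=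
      ⟨C ∩ MS, C ∩ M, Finset.inter_subset_right, Finset.inter_subset_right, by
        rw [← Finset.inter_union_distrib_left, Finset.inter_eq_left.2 hC]⟩
    have hAB : Disjoint A B := hSR.mono (hA.trans hS.subset_left) (hB.trans hMR)
    have hwA : ∑ x ∈ A, w' x ≤ ∑ x ∈ A, wS x :=
      Finset.sum_le_sum fun x hx => hwS x (hS.subset_left (hA hx))
    have hwB : ∑ x ∈ B, w' x ≤ ∑ x ∈ B, w₁ x :=
      Finset.sum_le_sum fun x hx => by rw [hw₁R x (hMR (hB hx))]; exact hwR x (hMR (hB hx))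
    rcases A.eq_empty_or_nonempty with rfl | hAne
    · rw [Finset.empty_union] at hCne ⊢
      have b := hc.small B hB hCne
      rw [hedge B (hB.trans hMR)] at b
      exact ⟨b.1, fun h => le_trans (by omega) (b.2 h)⟩
    rcases B.eq_empty_or_nonempty with rfl | hBne
    · rw [Finset.union_empty] at hCne ⊢
      have b := hS.small A hA hCne
      exact ⟨b.1, fun h => le_trans (by omega) (b.2 h)⟩
    have b1 := hS.small A hA hAne
    have b2 := hc.small B hB hBne
    rw [hedge B (hB.trans hMR)] at b2
    rw [G.edges_union hAB, Finset.card_union_of_disjoint hAB, Finset.sum_union hAB]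
    -- A vertex of `B` lies in the small part and so has weight at most D. Hence an edge between `A`
    -- and `B` can only be the exceptional edge between `v` and `u`.
    have key : ∀ x ∈ B, 0 < G.degIn x A → x = v ∧ G.degIn x A = 1 ∧ u ∈ A ∧ w' u + r ≤ wS u ∧
        w' x + (D + 1 - r) ≤ wR x := by
      intro x hx hpos
      have c1 := G.degIn_mono x hA
      have hxR := hMR (hB hx)
      rcases hM x hxR (by omega) with c2 | ⟨c2, c3, c4, c5, c6, c7⟩
      · have := hc.small.weight_le (hB hx)
        rw [hw₁R x hxR] at this
        omega
      · refine ⟨c2, by omega, ?_, c6, c7⟩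
        by_contra huA
        obtain ⟨y, hy, hy1⟩ := G.exists_mult_pos_of_degIn_pos hpos
        have := G.mult_add_mult_le_degIn x c4 (hA hy) (by rintro rfl; exact huA hy)
        omega
    by_cases hcr : ∃ x ∈ B, 0 < G.degIn x A
    · obtain ⟨x, hxB, hxpos⟩ := hcr
      obtain ⟨k1, k2, k3, k4, k5⟩ := key x hxB hxpos
      have hcross : G.cross A B = 1 := by
        rw [G.cross_comm]
        unfold cross
        rw [Finset.sum_eq_single x, k2]
        · intro y hy hyx
          by_contra hne
          have := G.degIn_nonneg y A
          exact hyx ((key y hy (by omega)).1.trans k1.symm)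
        · exact fun h => absurd hxB h
      have e1 : ∑ y ∈ A, w' y + r ≤ ∑ y ∈ A, wS y := by
        rw [← Finset.add_sum_erase _ _ k3, ← Finset.add_sum_erase _ wS k3]
        have : ∑ y ∈ A.erase u, w' y ≤ ∑ y ∈ A.erase u, wS y :=
          Finset.sum_le_sum fun y hy => hwS y (hS.subset_left (hA (Finset.mem_of_mem_erase hy)))
        omega
      have e2 : ∑ y ∈ B, w' y + (D + 1 - r) ≤ ∑ y ∈ B, w₁ y := by
        rw [← Finset.add_sum_erase _ _ hxB, ← Finset.add_sum_erase _ w₁ hxB]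
        have : ∑ y ∈ B.erase x, w' y ≤ ∑ y ∈ B.erase x, w₁ y :=
          Finset.sum_le_sum fun y hy => by
            have := hMR (hB (Finset.mem_of_mem_erase hy))
            rw [hw₁R y this]; exact hwR y this
        have := hw₁R x (hMR (hB hxB))
        omega
      rw [hcross]
      refine ⟨by push_cast; omega, fun h => ?_⟩
      push_cast at h
      -- Both subtrees obey the bound D+1 with their reserves `r` and D+1-`r` included. Adding the
      -- bounds and removing the reserves leaves D+1 for the joined tree.
      have f1 := b1.2 (by omega)
      have f2 := b2.2 (by omega)
      omega
    · have hcross : G.cross A B = 0 := by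
        rw [G.cross_comm]
        exact Finset.sum_eq_zero fun x hx => by
          have := G.degIn_nonneg x A
          by_contra hne
          exact hcr ⟨x, hx, by omega⟩
      rw [hcross]
      push_cast
      exact ⟨by omega, fun h => by omega⟩
  · intro C hC hCne
    obtain ⟨A, B, hA, hB, rfl⟩ : ∃ A B, A ⊆ FS ∧ B ⊆ F.erase f ∧ C = A ∪ B :=
      ⟨C ∩ FS, C ∩ F.erase f, Finset.inter_subset_right, Finset.inter_subset_right, by
        rw [← Finset.inter_union_distrib_left, Finset.inter_eq_left.2 hC]⟩
    rcases A.eq_empty_or_nonempty with rfl | hAne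
    · rw [Finset.empty_union] at hCne ⊢
      have b := hc.acyc B (hB.trans (Finset.erase_subset _ _)) hCne
      rwa [hedge B (hB.trans hFR)] at b
    rcases B.eq_empty_or_nonempty with rfl | hBne
    · rw [Finset.union_empty] at hCne ⊢
      exact hS.acyc A hA hCne
    have := hacyc A hA B hB hAne hBne
    have : 0 ≤ ∑ x ∈ B, (ex x : ℤ) := Finset.sum_nonneg fun _ _ => Int.natCast_nonneg _
    omega

end MultGraph

/-! ### Structure of a smallest counterexample. -/

namespace MultGraph

variable {V : Type*} [DecidableEq V]

/-- A smallest sparse weighted multigraph without a coloring. -/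
structure Critical (D : ℕ) (G : MultGraph V) (w : V → ℕ) (Y : Finset V) : Prop where
  sparse : Sparse D G w Y
  not_colorable : ¬ G.Colorable w D Y
  ih : ∀ (G' : MultGraph V) (w' : V → ℕ) (Y' : Finset V), Y'.card < Y.card → Sparse D G' w' Y' →
    G'.Colorable w' D Y'

namespace Critical

variable {D : ℕ} {G : MultGraph V} {w : V → ℕ} {Y : Finset V}

/-- Otherwise colorings of `S` and of its complement could be combined. The combination is an
instance of contraction in which no edge crosses. -/
lemma exists_edge (h : Critical D G w Y) {S : Finset V} (hS : S ⊆ Y) (hSY : S ≠ Y)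
    (h2 : 2 ≤ S.card) : ∃ v ∈ Y \ S, ∃ u ∈ S, 1 ≤ G.mult v u := by
  by_contra! hc
  obtain ⟨s, hs⟩ : S.Nonempty := Finset.card_pos.1 (by omega)
  have hlt : S.card < Y.card := Finset.card_lt_card (hS.ssubset_of_ne hSY)
  have hcard : (Y \ S).card = Y.card - S.card := Finset.card_sdiff_of_subset hS
  obtain ⟨MS, FS, hcol⟩ := h.ih G w S hlt (h.sparse.mono hS)
  have hdeg : ∀ x ∈ Y \ S, ∀ A ⊆ S, G.degIn x A = 0 := fun x hx A hA =>
    Finset.sum_eq_zero fun y hy => by have := hc x hx y (hA hy); simp; omega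
  have hcross : ∀ X ⊆ Y \ S, ∀ A ⊆ S, G.cross X A = 0 := fun X hX A hA =>
    Finset.sum_eq_zero fun x hx => hdeg x (hX hx) A hA
  have hpot : ∀ X ⊆ Y \ S, pot D G w (X ∪ S) = pot D G w X + pot D G w S := fun X hX => by
    rw [pot_union _ _ _ (Finset.sdiff_disjoint.mono_left hX), hcross X hX S subset_rfl]; ring
  obtain ⟨M, F, -, -, hMF, -⟩ := exists_isCol_union (w := w) (wR := w) (w' := w) h.ih hcol
    (R := Y \ S) Finset.disjoint_sdiff ⟨s, hs⟩ (by omega) (fun _ => 0)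
    (fun _ => 0)
    (fun x hx => by rw [hdeg x hx MS hcol.subset_left]; simp)
    (fun X hX hne => by
      have := h.sparse X (hX.trans Finset.sdiff_subset) hne
      rw [hpot X hX, hcross X hX FS hcol.subset_right]; simp; omega)
    (fun X hX hne => by
      have := h.sparse X (hX.trans Finset.sdiff_subset) hne
      have := edgeCost_pos D
      rw [hpot X hX]; simp; omega)
    (fun _ _ => le_rfl) (fun _ _ => le_rfl)
    s s 0 (by omega)
    (fun x hx hpos => by rw [hdeg x hx MS hcol.subset_left] at hpos; omega)
  rw [Finset.union_sdiff_of_subset hS] at hMF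
  exact h.not_colorable ⟨_, _, hMF⟩

lemma sum_weightCost_ite_le (D : ℕ) (u : V) (r : ℕ) (T : Finset V) :
    ∑ x ∈ T, weightCost D (if x = u then r else 0) ≤ weightCost D r := by
  simp only [apply_ite (weightCost D), weightCost_zero, Finset.sum_ite_eq']
  have := weightCost_nonneg D r
  split_ifs <;> omega

/-- Proper subsets with at least two vertices have large potential. -/
theorem gap (h : Critical D G w Y) {S : Finset V} (hS : S ⊆ Y) (hSY : S ≠ Y)
    (h2 : 2 ≤ S.card) : edgeCost D ≤ pot D G w S := by
  by_contra! hlt0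
  -- Minimality is used twice: raising one weight inside `T` keeps it sparse, and adding outside
  -- vertices to `T` does not lower the potential unless all of `Y` is reached.
  obtain ⟨T, hT, hmin⟩ := Finset.exists_min_image
    (Y.powerset.filter fun T => T ≠ Y ∧ 2 ≤ T.card) (pot D G w) ⟨S, by simp [hS, hSY, h2]⟩
  have hlt : pot D G w T ≤ edgeCost D - 1 := by
    have := hmin S (by simp [hS, hSY, h2]); omega
  have hmin' : ∀ A ⊆ Y, A ≠ Y → 2 ≤ A.card → pot D G w T ≤ pot D G w A :=
    fun A h1 h2 h3 => hmin A (by simp [h1, h2, h3])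
  clear hmin hlt0 h2 hSY hS
  clear S
  simp only [Finset.mem_filter, Finset.mem_powerset] at hT
  obtain ⟨hTY, hne, h2⟩ := hT
  obtain ⟨v, hv, u, hu, huv⟩ := h.exists_edge hTY hne h2
  have hkpos := edgeCost_pos D
  have hTge := h.sparse T hTY (Finset.card_pos.1 (by omega))
  -- The weight `r` spends the whole potential of `T` on a reserve at `u`, up to the tolerance of
  -- one. The end `v` of the edge then needs a reserve of only D+1-`r`.
  obtain ⟨r, hr, hr1, hr2⟩ : ∃ r ≤ D + 1, pot D G w T ≤ weightCost D r ∧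
      weightCost D r ≤ pot D G w T + 1 := by
    rcases lt_or_ge (pot D G w T) 0 with hneg | hpos
    · exact ⟨0, by omega, by rw [weightCost_zero]; omega, by rw [weightCost_zero]; omega⟩
    · exact exists_weightCost hpos (by omega)
  have hltc : T.card < Y.card := Finset.card_lt_card (hTY.ssubset_of_ne hne)
  have hcard : (Y \ T).card = Y.card - T.card := Finset.card_sdiff_of_subset hTY
  have hsp : Sparse D G (fun x => w x + if x = u then r else 0) T := by
    refine sparse_of_two_le fun A hA hA2 => ?_
    have a1 := pot_raise_ge D G w (fun x => if x = u then r else 0) A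
    have a2 := sum_weightCost_ite_le D u r A
    have a3 := hmin' A (hA.trans hTY) (fun h => hne (subset_antisymm hTY (h ▸ hA))) hA2
    omega
  obtain ⟨MS, FS, hcol⟩ := h.ih G _ T hltc hsp
  have hduv : u ∈ MS → 1 ≤ G.degIn v MS := fun hum => by
    have := G.mult_le_degIn v hum; omega
  have hcr := weightCost_le D r
  have hcr0 := weightCost_nonneg D r
  have hcompl := weightCost_add_compl hr
  have hg0 : ∀ X : Finset V, ∑ x ∈ X, (if x = v ∧ u ∈ MS then -weightCost D r else 0) ≤ 0 :=
    fun X => Finset.sum_nonpos fun x _ => by split_ifs <;> omega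
  -- Outside neighbours of `MS` are forced into F by weight D+1. Only `v` receives the smaller
  -- raise, when its unique edge to `MS` ends at `u`; this saves the cost of `r`, which is recorded
  -- as a negative entry.
  obtain ⟨M, F, -, -, hMF, -⟩ := exists_isCol_union (w := w)
    (wR := fun x => w x + if 0 < G.degIn x MS then
      (if x = v ∧ u ∈ MS ∧ G.degIn v MS = 1 then D + 1 - r else D + 1) else 0)
    (w' := w) h.ih hcol
    (R := Y \ T) Finset.disjoint_sdiff ⟨u, hu⟩ (by omega) (fun _ => 0)
    (fun x => if x = v ∧ u ∈ MS then -weightCost D r else 0)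
    (fun x hx => by
      have c1 := weightCost_add_le D (w x) (D + 1 - r)
      have c2 := weightCost_add_le D (w x) (D + 1)
      have c3 := weightCost_of_le (le_refl (D + 1))
      have c4 : 0 < G.degIn x MS → edgeCost D ≤ edgeCost D * G.degIn x MS := fun h => by nlinarith
      by_cases hp : 0 < G.degIn x MS
      · have c5 := c4 hp
        by_cases hx1 : x = v ∧ u ∈ MS
        · obtain ⟨rfl, hum⟩ := hx1
          by_cases hd : G.degIn x MS = 1
          · simp only [hd, hum]; simp; omega
          · have : 2 * edgeCost D ≤ edgeCost D * G.degIn x MS := by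
              have : 2 ≤ G.degIn x MS := by omega
              nlinarith
            simp only [hp, hd, hum]; simp; omega
        · have hx2 : ¬ (x = v ∧ u ∈ MS ∧ G.degIn v MS = 1) := fun hh => hx1 ⟨hh.1, hh.2.1⟩
          simp only [hp, hx1, hx2, if_true, if_false]; omega
      · have hx1 : ¬ (x = v ∧ u ∈ MS) := by
          rintro ⟨rfl, hum⟩; have := hduv hum; omega
        have : G.degIn x MS = 0 := by have := G.degIn_nonneg x MS; omega
        simp only [hx1, if_false, this]; simp)
    (fun X hX hXne => by
      have d1 := hg0 X
      have d2 : 0 ≤ edgeCost D * G.cross X FS := mul_nonneg (by omega) (G.cross_nonneg _ _)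
      -- Only here may the potential drop below that of `T`. The deficit is covered by the saving at
      -- `v` if `u` lies in the small part, and by the edge from `v` to the forest part otherwise.
      by_cases hXT : X ∪ T = Y
      · have d3 := h.sparse (X ∪ T) hXT.le ⟨u, by simp [hu]⟩
        have hvX : v ∈ X := by
          have : v ∈ X ∪ T := by rw [hXT]; exact (Finset.mem_sdiff.1 hv).1
          exact (Finset.mem_union.1 this).resolve_right (Finset.mem_sdiff.1 hv).2
        by_cases hum : u ∈ MS
        · have : ∑ x ∈ X, (if x = v ∧ u ∈ MS then -weightCost D r else 0) = -weightCost D r := by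
            simp only [hum, and_true, Finset.sum_ite_eq', hvX, if_true]
          omega
        · have huF : u ∈ FS := by
            have : u ∈ MS ∪ FS := by rw [hcol.union]; exact hu
            exact (Finset.mem_union.1 this).resolve_left hum
          have : 1 ≤ G.cross X FS := by
            have e1 := G.cross_mono (Finset.singleton_subset_iff.2 hvX) (subset_refl FS)
            rw [cross_singleton_left] at e1
            have := G.mult_le_degIn v huF
            omega
          have : edgeCost D ≤ edgeCost D * G.cross X FS := by nlinarith
          omega
      · have d3 := hmin' (X ∪ T) (Finset.union_subset (hX.trans Finset.sdiff_subset) hTY) hXT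
          (h2.trans (Finset.card_le_card Finset.subset_union_right))
        omega)
    (fun X hX hXne => by
      have d1 := hg0 X
      have d3 := h.sparse (X ∪ T) (Finset.union_subset (hX.trans Finset.sdiff_subset) hTY)
        ⟨u, by simp [hu]⟩
      simp only [Nat.cast_zero, Finset.sum_const_zero, mul_zero]
      omega)
    (fun x hx => by simp) (fun x hx => by simp) u v r hr
    (fun x hx hpos => by
      by_cases hx2 : x = v ∧ u ∈ MS ∧ G.degIn v MS = 1
      · obtain ⟨rfl, hum, hd⟩ := hx2
        right
        refine ⟨rfl, hd, hum, huv, by simp, ?_⟩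
        simp only [hum, hd]; simp
      · left
        simp only [hpos, hx2, if_true, if_false]; omega)
  rw [Finset.union_sdiff_of_subset hTY] at hMF
  exact h.not_colorable ⟨_, _, hMF⟩

lemma degIn_erase_self (G : MultGraph V) (v : V) (A : Finset V) :
    G.degIn v (A.erase v) = G.degIn v A := by
  by_cases h : v ∈ A
  · conv_rhs => rw [← Finset.insert_erase h, G.degIn_insert_self]
  · rw [Finset.erase_eq_of_notMem h]

/-- Delete `v` and color the rest. If `v` cannot join F, it has two edges to F; in degree two it
then has none to M and could join M unless its weight forbids this. -/
lemma two_le_degIn (h : Critical D G w Y) {v : V} (hv : v ∈ Y) :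
    2 ≤ G.degIn v Y ∧ (G.degIn v Y = 2 → D + 1 ≤ w v) := by
  obtain ⟨M, F, hc⟩ := h.ih G w (Y.erase v) (Finset.card_erase_lt_of_mem hv)
    (h.sparse.mono (Finset.erase_subset _ _))
  have hadd := hc.degIn_add v
  have hM := G.degIn_nonneg v M
  rw [degIn_erase_self] at hadd
  have hF : 2 ≤ G.degIn v F := by
    by_contra hF
    have := hc.insert_right (Finset.notMem_erase v Y) (by omega)
    rw [Finset.insert_erase hv] at this
    exact h.not_colorable ⟨_, _, this⟩
  refine ⟨by omega, fun h2 => ?_⟩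
  by_contra hw
  have := hc.insert_left_isolated (Finset.notMem_erase v Y) (by omega) (by omega)
  rw [Finset.insert_erase hv] at this
  exact h.not_colorable ⟨_, _, this⟩

/-- A vertex of degree three cannot be removed by raising the weights of its neighbours. -/
lemma not_sparse_erase (h : Critical D G w Y) {v : V} (hv : v ∈ Y) (hd : G.degIn v Y = 3)
    (hw : w v ≤ D) {t : V → ℕ} (ht : ∀ x ∈ Y, G.mult v x = 1 → w v + 1 ≤ t x) :
    ¬ Sparse D G (fun x => w x + t x) (Y.erase v) := by
  intro hsp
  obtain ⟨M, F, hc⟩ := h.ih G _ (Y.erase v) (Finset.card_erase_lt_of_mem hv) hsp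
  obtain ⟨M', F', hc', -, -⟩ := hc.insert_of_degIn_le_three (w := w) (Finset.notMem_erase v Y)
    (fun x _ => by simp) hw (by rw [degIn_erase_self]; omega)
    (fun x hx h1 => by
      have := ht x (Finset.mem_of_mem_erase (hc.subset_left hx)) h1
      omega)
  rw [Finset.insert_erase hv] at hc'
  exact h.not_colorable ⟨_, _, hc'⟩

lemma erase_ne {v : V} (hv : v ∈ Y) {A : Finset V} (hA : A ⊆ Y.erase v) : A ≠ Y := by
  rintro rfl
  exact Finset.notMem_erase v A (hA hv)

/-- With a multiple edge at `v`, at most one neighbour is joined by a single edge and needs a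
reserve. One raise costs at most k, which the gap covers. -/
lemma mult_le_one (h : Critical D G w Y) {v : V} (hv : v ∈ Y) (hd : G.degIn v Y = 3)
    (hw : w v ≤ D) {x : V} (hx : x ∈ Y) : G.mult v x ≤ 1 := by
  by_contra! hx2
  refine h.not_sparse_erase hv hd hw (t := fun y => if G.mult v y = 1 then w v + 1 else 0)
    (fun y _ hy => by simp [hy]) (sparse_of_two_le fun A hA hA2 => ?_)
  have h1 := h.gap (hA.trans (Finset.erase_subset _ _)) (erase_ne hv hA) hA2
  have h2 := pot_raise_ge D G w (fun y => if G.mult v y = 1 then w v + 1 else 0) A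
  suffices ∑ y ∈ A, weightCost D (if G.mult v y = 1 then w v + 1 else 0) ≤ edgeCost D by
    omega
  by_cases hex : ∃ z ∈ Y, G.mult v z = 1
  · obtain ⟨z, hz, hz1⟩ := hex
    refine le_trans (Finset.sum_le_sum (g := fun y => weightCost D (if y = z then w v + 1 else 0))
      fun y hy => ?_) ((sum_weightCost_ite_le D z _ A).trans (weightCost_le _ _))
    by_cases hyz : y = z
    · simp [hyz, hz1]
    · have hy1 : G.mult v y ≠ 1 := fun hy1 => by
        have e := G.degIn_mono v (A := {x, y, z}) (B := Y) (by
          have := Finset.mem_of_mem_erase (hA hy); grind)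
        rw [degIn_insert _ _ (by simp; constructor <;> rintro rfl <;> omega),
          degIn_insert _ _ (by simpa using hyz), degIn_singleton] at e
        omega
      simp [hyz, hy1]
  · push Not at hex
    rw [Finset.sum_eq_zero]
    · have := edgeCost_pos D; omega
    · intro y hy
      simp [hex y (Finset.mem_of_mem_erase (hA hy)), weightCost_zero]

lemma mult_eq (h : Critical D G w Y) {v : V} (hv : v ∈ Y) (hd : G.degIn v Y = 3)
    (hw : w v ≤ D) {x : V} (hx : x ∈ Y) : G.mult v x = 0 ∨ G.mult v x = 1 := by
  have := h.mult_le_one hv hd hw hx; omega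

/-- The cost of raising the neighbours of a vertex of degree three exceeds what is gained by
removing the vertex. -/
lemma lt_sum_weightCost (h : Critical D G w Y) {v : V} (hv : v ∈ Y) (hd : G.degIn v Y = 3)
    (hw : w v ≤ D) (hc : 2 * weightCost D (w v + 1) ≤ edgeCost D + 1) :
    pot D G w Y + edgeCost D + 2 + weightCost D (w v) <
      ∑ x ∈ Y, G.mult v x * (weightCost D (w x + (w v + 1)) - weightCost D (w x)) := by
  by_contra! hlt
  refine h.not_sparse_erase hv hd hw (t := fun y => (w v + 1) * G.mult v y)
    (fun y _ hy => by simp [hy]) (sparse_of_two_le fun A hA hA2 => ?_)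
  have hvA : v ∉ A := fun h => Finset.notMem_erase v Y (hA h)
  have hAY : A ⊆ Y := hA.trans (Finset.erase_subset _ _)
  have h1 := h.gap hAY (erase_ne hv hA) hA2
  have h0 := weightCost_nonneg D (w v)
  rw [pot_weight_sub D G w]
  have e1 : ∑ x ∈ A, (weightCost D (w x + (w v + 1) * G.mult v x) - weightCost D (w x)) =
      ∑ x ∈ A, G.mult v x * (weightCost D (w x + (w v + 1)) - weightCost D (w x)) :=
    Finset.sum_congr rfl fun x hx => by
      rcases h.mult_eq hv hd hw (hAY hx) with e | e <;> simp [e]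
  have e2 : ∑ x ∈ A, (G.mult v x * (weightCost D (w x + (w v + 1)) - weightCost D (w x)) : ℤ) ≤
      weightCost D (w v + 1) * G.degIn v A := by
    unfold degIn
    rw [Finset.mul_sum]
    exact Finset.sum_le_sum fun x _ => by
      have := weightCost_add_le D (w x) (w v + 1)
      have : (0 : ℤ) ≤ G.mult v x := Int.natCast_nonneg _
      nlinarith
  rw [e1]
  have hdA := G.degIn_mono v hAY
  have hdA0 := G.degIn_nonneg v A
  have hc0 := weightCost_nonneg D (w v + 1)
  -- Up to two raises are paid by the gap. If `A` receives all three edges, adding `v` lowers the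
  -- potential by k+1 plus the cost of its weight, so `A` has correspondingly more to spend; only
  -- the case where this gives all of `Y` uses the assumed inequality.
  have hcases : G.degIn v A ≤ 2 ∨ G.degIn v A = 3 := by omega
  rcases hcases with h2 | h3
  · have : weightCost D (w v + 1) * G.degIn v A ≤ weightCost D (w v + 1) * 2 := by gcongr
    omega
  · have e3 := pot_insert D G w hvA
    rw [h3] at e3 e2
    by_cases hY : insert v A = Y
    · have e4 : ∑ x ∈ Y, (G.mult v x * (weightCost D (w x + (w v + 1)) - weightCost D (w x)) : ℤ) =
        ∑ x ∈ A, (G.mult v x * (weightCost D (w x + (w v + 1)) - weightCost D (w x)) : ℤ) := by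
        rw [← hY, Finset.sum_insert hvA, G.irrefl]; simp
      rw [hY] at e3
      omega
    · have := h.gap (Finset.insert_subset hv hAY) hY (by
        rw [Finset.card_insert_of_notMem hvA]; omega)
      omega

lemma lt_three_mul (h : Critical D G w Y) {v : V} (hv : v ∈ Y) (hd : G.degIn v Y = 3)
    (hw : w v ≤ D) (hc : 2 * weightCost D (w v + 1) ≤ edgeCost D + 1) :
    edgeCost D + 1 + weightCost D (w v) < 3 * weightCost D (w v + 1) := by
  have h1 := h.lt_sum_weightCost hv hd hw hc
  have h2 := h.sparse Y subset_rfl ⟨v, hv⟩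
  have e2 : ∑ x ∈ Y, (G.mult v x * (weightCost D (w x + (w v + 1)) - weightCost D (w x)) : ℤ) ≤
      weightCost D (w v + 1) * G.degIn v Y := by
    unfold degIn
    rw [Finset.mul_sum]
    exact Finset.sum_le_sum fun x _ => by
      have := weightCost_add_le D (w x) (w v + 1)
      have : (0 : ℤ) ≤ G.mult v x := Int.natCast_nonneg _
      nlinarith
  rw [hd] at e2
  omega

lemma degIn_lt_card (h : Critical D G w Y) {v : V} (hv : v ∈ Y) (hd : G.degIn v Y = 3)
    (hw : w v ≤ D) : 4 ≤ Y.card := by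
  have h1 : G.degIn v (Y.erase v) ≤ ∑ x ∈ Y.erase v, (1 : ℤ) :=
    Finset.sum_le_sum fun x hx => by
      exact_mod_cast h.mult_le_one hv hd hw (Finset.mem_of_mem_erase hx)
  rw [degIn_erase_self, hd] at h1
  simp [Finset.card_erase_of_mem hv] at h1
  omega

lemma nonempty (h : Critical D G w Y) : Y.Nonempty := by
  by_contra hY
  rw [Finset.not_nonempty_iff_eq_empty] at hY
  subst hY
  exact h.not_colorable ⟨_, _, isCol_empty G w D⟩

lemma two_le_card (h : Critical D G w Y) : 2 ≤ Y.card := by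
  obtain ⟨x, hx⟩ := h.nonempty
  by_contra! hlt
  obtain ⟨y, rfl⟩ := Finset.card_eq_one.1 (by have := h.nonempty.card_pos; omega : Y.card = 1)
  have := (h.two_le_degIn (v := y) (by simp)).1
  simp [G.irrefl] at this

end Critical

/-! ### Even D: counting local charges. -/

lemma two_mul_pot (D : ℕ) (G : MultGraph V) (w : V → ℕ) (A : Finset V) :
    2 * pot D G w A = ∑ x ∈ A, (2 * (2 * edgeCost D - 1 - weightCost D (w x))
      - edgeCost D * G.degIn x A) := by
  rw [Finset.sum_sub_distrib, ← Finset.mul_sum, ← Finset.mul_sum]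
  have := G.two_mul_edges A
  unfold cross at this
  rw [← this]
  unfold pot; ring

/-- Twice the potential is a sum of charges that are at most -1, and at most -2 except possibly at
vertices of degree three with weight at most D. The sum must be at least -2, but such a vertex
brings at least four vertices with it, and otherwise there are at least two vertices. -/
lemma not_critical_of_even {D : ℕ} (hD : D % 2 = 0) {G : MultGraph V} {w : V → ℕ} {Y : Finset V}
    (h : Critical D G w Y) : False := by
  have hk := edgeCost_even hD
  have h2 := two_mul_pot D G w Y
  have hpot := h.sparse Y subset_rfl h.nonempty
  have hterm : ∀ x ∈ Y, 2 * (2 * edgeCost D - 1 - weightCost D (w x)) - edgeCost D * G.degIn x Y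
      ≤ if G.degIn x Y = 3 ∧ w x ≤ D then -1 else -2 := by
    intro x hx
    have hd := h.two_le_degIn hx
    have hc0 := weightCost_nonneg D (w x)
    rcases (by omega : G.degIn x Y = 2 ∨ G.degIn x Y = 3 ∨ 4 ≤ G.degIn x Y) with e | e | e
    · have := weightCost_of_le (hd.2 e)
      simp [e]; omega
    · by_cases hw : w x ≤ D
      · simp only [e, hw, and_self, if_true]
        -- Reducibility excludes weights below D/2. Weight D/2 costs D, which gives a charge of
        -- exactly -1, and larger weights give less.
        by_cases hc : 2 * weightCost D (w x + 1) ≤ edgeCost D + 1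
        · have := h.lt_three_mul hx e hw hc
          rw [hk] at this ⊢
          unfold weightCost at this ⊢
          split_ifs at this ⊢ <;> omega
        · rw [hk] at hc ⊢
          unfold weightCost at hc ⊢
          split_ifs at hc ⊢ <;> omega
      · have := weightCost_of_le (D := D) (m := w x) (by omega)
        simp [e, hw]; omega
    · have hw : ¬ (G.degIn x Y = 3 ∧ w x ≤ D) := fun hh => by omega
      simp only [hw, if_false]
      have : edgeCost D * 4 ≤ edgeCost D * G.degIn x Y := by
        have := edgeCost_pos D
        gcongr
      omega
  have hsum := Finset.sum_le_sum hterm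
  rw [← h2] at hsum
  by_cases hex : ∃ v ∈ Y, G.degIn v Y = 3 ∧ w v ≤ D
  · obtain ⟨v, hv, hd, hw⟩ := hex
    have h4 := h.degIn_lt_card hv hd hw
    have : ∑ x ∈ Y, (if G.degIn x Y = 3 ∧ w x ≤ D then (-1 : ℤ) else -2) ≤ ∑ x ∈ Y, (-1 : ℤ) :=
      Finset.sum_le_sum fun x _ => by split_ifs <;> omega
    simp at this
    omega
  · have h4 := h.two_le_card
    have : ∑ x ∈ Y, (if G.degIn x Y = 3 ∧ w x ≤ D then (-1 : ℤ) else -2) = ∑ x ∈ Y, (-2 : ℤ) :=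
      Finset.sum_congr rfl fun x hx => by
        rw [if_neg fun hh => hex ⟨x, hx, hh⟩]
    simp at this
    omega

end MultGraph

/-! ### Odd D = 2h+1: light vertices and their neighbours. -/

namespace MultGraph

variable {V : Type*} [DecidableEq V]

lemma degIn_erase (G : MultGraph V) (v : V) {x : V} {A : Finset V} (h : x ∈ A) :
    G.degIn v (A.erase x) = G.degIn v A - G.mult v x := by
  conv_rhs => rw [← Finset.insert_erase h, G.degIn_insert v (Finset.notMem_erase x A)]
  ring

/-- A raise by h+1 is the reserve for a neighbour of a light vertex. It costs at most 2h+2 = k/2, so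
the gap pays for two such raises. -/
lemma pot_raise_half_ge {h : ℕ} (G : MultGraph V) (w s : V → ℕ) (A : Finset V) :
    pot (2 * h + 1) G w A - (2 * h + 2) * ∑ x ∈ A, (s x : ℤ) ≤
      pot (2 * h + 1) G (fun x => w x + (h + 1) * s x) A := by
  refine le_trans ?_ (pot_raise_ge _ _ _ _ _)
  rw [Finset.mul_sum]
  gcongr with x _
  refine (weightCost_le_two_mul _ _).trans (le_of_eq ?_)
  push_cast; ring

/-- A vertex of degree three with the largest weight for which its neighbours may not be raised
for free. -/
structure IsLight (h : ℕ) (G : MultGraph V) (w : V → ℕ) (Y : Finset V) (v : V) : Prop where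
  mem : v ∈ Y
  deg : G.degIn v Y = 3
  weight : w v = h

/-- A vertex of weight `h` and degree at most three extends a coloring with raised weights. -/
lemma IsCol.insert_light {h : ℕ} {G : MultGraph V} {w s : V → ℕ} {Y M F : Finset V} {p : V}
    (hc : G.IsCol (fun x => w x + (h + 1) * G.mult p x + s x) (2 * h + 1) Y M F) (hp : p ∉ Y)
    (hw : w p = h) (hs : s p = 0) (hd : G.degIn p Y ≤ 3) :
    ∃ M' F', G.IsCol (fun x => w x + s x) (2 * h + 1) (insert p Y) M' F' := by
  obtain ⟨M', F', hc', -, -⟩ := hc.insert_of_degIn_le_three (w := fun x => w x + s x) hp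
    (fun x _ => by omega) (by omega) hd
    (fun x _ h1 => by rw [h1, hw, hs]; omega)
  exact ⟨M', F', hc'⟩

namespace Critical

variable {h : ℕ} {G : MultGraph V} {w : V → ℕ} {Y : Finset V}

lemma edgeCost_two_mul_add_one (h : ℕ) : edgeCost (2 * h + 1) = 4 * h + 4 := by
  rw [edgeCost_odd (by omega)]; push_cast; ring

lemma weightCost_two_mul_add_one (h m : ℕ) :
    weightCost (2 * h + 1) m = 2 * (min m (2 * h + 2) : ℕ) := by
  rw [weightCost_odd (by omega)]

lemma not_isCol (hY : Critical (2 * h + 1) G w Y) {Y' M F : Finset V}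
    (hc : G.IsCol w (2 * h + 1) Y' M F) (he : Y' = Y) : False :=
  hY.not_colorable ⟨M, F, he ▸ hc⟩

lemma le_weight (hY : Critical (2 * h + 1) G w Y) {v : V} (hv : v ∈ Y) (hd : G.degIn v Y = 3) :
    h ≤ w v := by
  by_contra! hw
  have := hY.lt_three_mul hv hd (by omega) (by
    rw [edgeCost_two_mul_add_one, weightCost_two_mul_add_one]; omega)
  rw [edgeCost_two_mul_add_one, weightCost_two_mul_add_one, weightCost_two_mul_add_one] at this
  omega

lemma light_mult_le_one (hY : Critical (2 * h + 1) G w Y) {v x : V} (hv : IsLight h G w Y v)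
    (hx : x ∈ Y) : G.mult v x ≤ 1 :=
  hY.mult_le_one hv.mem hv.deg (by have := hv.weight; omega) hx

/-- Neighbours of light vertices have small weight. -/
lemma weight_le_of_light (hY : Critical (2 * h + 1) G w Y) {v x : V} (hv : IsLight h G w Y v)
    (hx : x ∈ Y) (h1 : 1 ≤ G.mult v x) : w x ≤ h + 1 := by
  by_contra! hwx
  have hw := hv.weight
  have h2 := hY.lt_sum_weightCost hv.mem hv.deg (by omega) (by
    rw [edgeCost_two_mul_add_one, weightCost_two_mul_add_one]; omega)
  have h3 := hY.sparse Y subset_rfl ⟨v, hv.mem⟩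
  have h4 : ∑ y ∈ Y, (G.mult v y *
      (weightCost (2 * h + 1) (w y + (w v + 1)) - weightCost (2 * h + 1) (w y)) : ℤ) ≤
      ∑ y ∈ Y, ((2 * h + 2) * G.mult v y - if y = x then 2 else 0 : ℤ) := by
    refine Finset.sum_le_sum fun y hy => ?_
    rw [weightCost_two_mul_add_one, weightCost_two_mul_add_one, hw]
    by_cases hyx : y = x
    · subst hyx
      have : G.mult v y = 1 := by have := hY.light_mult_le_one hv hx; omega
      rw [this]
      simp; omega
    · simp only [hyx, if_false]
      have : (0 : ℤ) ≤ G.mult v y := Int.natCast_nonneg _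
      -- Costs are capped at weight D+1 = 2h+2, so raising a vertex of weight at least h+2 is
      -- cheaper by at least 2 than an ordinary raise. The saving contradicts the lower bound on the
      -- total cost.
      have e : (2 * (min (w y + (h + 1)) (2 * h + 2) : ℕ) - 2 * (min (w y) (2 * h + 2) : ℕ) : ℤ)
        ≤ 2 * h + 2 := by omega
      nlinarith
  rw [Finset.sum_sub_distrib, ← Finset.mul_sum, Finset.sum_ite_eq' Y x, if_pos hx] at h4
  have h5 := hv.deg
  unfold degIn at h5
  rw [h5, hw] at h4
  rw [edgeCost_two_mul_add_one, weightCost_two_mul_add_one, hw] at h2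
  omega

/-- Light vertices are pairwise nonadjacent. -/
lemma light_nonadj (hY : Critical (2 * h + 1) G w Y) {p q : V} (hp : IsLight h G w Y p)
    (hq : IsLight h G w Y q) : G.mult p q = 0 := by
  by_contra hpq0
  have hpq : G.mult p q = 1 := by have := hY.light_mult_le_one hp hq.mem; omega
  have hqp : G.mult q p = 1 := by rw [G.symm]; exact hpq
  have hne : p ≠ q := by rintro rfl; rw [G.irrefl] at hpq; omega
  have hwp := hp.weight
  have hwq := hq.weight
  set P := (Y.erase p).erase q with hP
  have hqY : q ∈ Y.erase p := Finset.mem_erase.2 ⟨hne.symm, hq.mem⟩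
  have hpP : p ∉ P := by simp [hP]
  have hqP : q ∉ P := by simp [hP]
  have hPY : P ⊆ Y := (Finset.erase_subset _ _).trans (Finset.erase_subset _ _)
  have hins : insert q (insert p P) = Y := by
    rw [Finset.insert_comm, hP, Finset.insert_erase hqY, Finset.insert_erase hp.mem]
  have hdp : G.degIn p P = 2 := by
    rw [hP, degIn_erase _ _ hqY, degIn_erase_self, hp.deg, hpq]; rfl
  have hdq : G.degIn q P = 2 := by
    rw [hP, degIn_erase_self, degIn_erase _ _ hp.mem, hq.deg, hqp]; rfl
  -- Only the two remaining neighbours of `p` are raised, at cost k; none are raised for `q`.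
  have hsp : Sparse (2 * h + 1) G (fun x => w x + (h + 1) * G.mult p x) P := by
    refine sparse_of_two_le fun A hA hA2 => ?_
    have h1 := hY.gap (hA.trans hPY) (fun e => hpP (hA (e ▸ hp.mem))) hA2
    have h2 := pot_raise_half_ge (h := h) G w (G.mult p) A
    have h3 : ∑ x ∈ A, (G.mult p x : ℤ) ≤ 2 := by
      have := G.degIn_mono p hA; rw [hdp] at this; exact this
    rw [edgeCost_two_mul_add_one] at h1
    nlinarith
  obtain ⟨M, F, hc⟩ := hY.ih G _ P (Finset.card_lt_card
    ⟨hPY, fun hh => hpP (hh hp.mem)⟩) hsp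
  have ap := hc.degIn_add p
  have aq := hc.degIn_add q
  have ap1 := G.degIn_nonneg p M
  have aq1 := G.degIn_nonneg q M
  have ap2 := G.degIn_nonneg p F
  have aq2 := G.degIn_nonneg q F
  rw [hdp] at ap
  rw [hdq] at aq
  have hc0 : G.IsCol w (2 * h + 1) P M F := hc.mono fun x _ => by omega
  have hpM : p ∉ M := fun hh => hpP (hc.subset_left hh)
  have hpF : p ∉ F := fun hh => hpP (hc.subset_right hh)
  have hqF : q ∉ F := fun hh => hqP (hc.subset_right hh)
  have hq' : q ∉ insert p P := by simp [hqP, hne.symm]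
  have hp' : p ∉ insert q P := by simp [hpP, hne]
  by_cases h1 : 1 ≤ G.degIn p F
  · by_cases h2 : G.degIn q F ≤ 1
    · have c1 := hc.insert_left (w := w) hpP (fun x _ => by omega) (by omega) (by omega)
        (fun x _ hx => by rw [hx, hwp]; omega)
      exact hY.not_isCol (c1.insert_right hq' h2) hins
    · by_cases h3 : G.degIn p F ≤ 1
      · exact hY.not_isCol ((hc0.insert_right hpP h3).insert_left_isolated hq' (by omega)
          (by omega)) hins
      -- All outer edges of `p` and `q` go to F. Both vertices enter M and form a component with
      -- weight and edge total h + h + 1 = D.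
      · have c1 := hc.insert_left (w := fun x => w x + if x = p then h + 1 else 0) hpP
          (fun x hx => by
            have : x ≠ p := by rintro rfl; exact hpP hx
            simp [this]) (by simp; omega) (by omega)
          (fun x hx hx1 => by
            have := G.mult_le_degIn p hx; omega)
        have c2 := c1.insert_left (w := w) hq' (fun x _ => by simp) (by omega)
          (by rw [G.degIn_insert _ hpM, hqp]; push_cast; omega)
          (fun x hx hx1 => by
            rcases Finset.mem_insert.1 hx with rfl | hx
            · simp; omega
            · have := G.mult_le_degIn q hx; omega)
        exact hY.not_isCol c2 hins
  · by_cases h2 : G.degIn q F ≤ 1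
    · have c1 := hc0.insert_right hqP h2
      have c2 := c1.insert_right hp' (by rw [G.degIn_insert _ hqF, hpq]; push_cast; omega)
      exact hY.not_isCol c2 (by rw [Finset.insert_comm]; exact hins)
    · exact hY.not_isCol ((hc0.insert_right hpP (by omega)).insert_left_isolated hq' (by omega)
          (by omega)) hins

/-- A vertex of degree three and weight `h + 1` has at most one light neighbour. -/
lemma light_nbrs_of_degree_three (hY : Critical (2 * h + 1) G w Y) {c p q : V} (hc : c ∈ Y)
    (hdc : G.degIn c Y = 3) (hwc : w c = h + 1) (hp : IsLight h G w Y p)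
    (hq : IsLight h G w Y q) (hpq : p ≠ q) (hcp : 1 ≤ G.mult c p) (hcq : 1 ≤ G.mult c q) :
    False := by
  have hcp1 : G.mult c p = 1 := by
    have := hY.light_mult_le_one hp hc; rw [G.symm] at this; omega
  have hcq1 : G.mult c q = 1 := by
    have := hY.light_mult_le_one hq hc; rw [G.symm] at this; omega
  have hpc1 : G.mult p c = 1 := by rw [G.symm]; exact hcp1
  have hqc1 : G.mult q c = 1 := by rw [G.symm]; exact hcq1
  have hpq0 := hY.light_nonadj hp hq
  have hqp0 := hY.light_nonadj hq hp
  have hwp := hp.weight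
  have hwq := hq.weight
  have hpc : p ≠ c := by rintro rfl; omega
  have hqc : q ≠ c := by rintro rfl; omega
  set P := ((Y.erase c).erase p).erase q with hP
  have m1 : p ∈ Y.erase c := Finset.mem_erase.2 ⟨hpc, hp.mem⟩
  have m2 : q ∈ Y.erase c := Finset.mem_erase.2 ⟨hqc, hq.mem⟩
  have m3 : q ∈ (Y.erase c).erase p := Finset.mem_erase.2 ⟨hpq.symm, m2⟩
  have hPY : P ⊆ Y := fun x hx => by simp [hP] at hx; tauto
  have nc : c ∉ P := by simp [hP]
  have np : p ∉ P := by simp [hP]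
  have nq : q ∉ P := by simp [hP]
  have hins : insert q (insert p (insert c P)) = Y := by
    ext x; simp only [hP, Finset.mem_insert, Finset.mem_erase]
    have := hp.mem; have := hq.mem
    grind
  have hdp : G.degIn p P = 2 := by
    rw [hP, degIn_erase _ _ m3, degIn_erase_self, degIn_erase _ _ hc, hp.deg, hpq0, hpc1]; rfl
  have hdq : G.degIn q P = 2 := by
    rw [hP, degIn_erase_self, degIn_erase _ _ m1, degIn_erase _ _ hc, hq.deg, hqp0, hqc1]; rfl
  have hdc1 : G.degIn c P = 1 := by
    rw [hP, degIn_erase _ _ m3, degIn_erase _ _ m1, degIn_erase_self, hdc, hcp1, hcq1]; rfl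
  have gap : ∀ A ⊆ Y, A ≠ Y → 2 ≤ A.card → 4 * (h : ℤ) + 4 ≤ pot (2 * h + 1) G w A :=
    fun A h1 h2 h3 => by have := hY.gap h1 h2 h3; rwa [edgeCost_two_mul_add_one] at this
  -- Adding a light vertex with two edges to `A` changes the potential by (6h+7)-2k = -(2h+1), so
  -- the gap for the enlarged set improves the bound for `A` to 6h+5. This pays for three raises.
  have key : ∀ A ⊆ P, 2 ≤ A.card → ∀ p q, IsLight h G w Y p → IsLight h G w Y q → p ≠ q →
      p ∉ A → q ∉ A → G.degIn p A = 2 → 6 * (h : ℤ) + 5 ≤ pot (2 * h + 1) G w A := by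
    intro A hA hA2 p q hp hq hpq hpA hqA hd
    have e := pot_insert (2 * h + 1) G w hpA
    have := gap (insert p A) (Finset.insert_subset hp.mem (hA.trans hPY))
      (fun e => by
        have : q ∈ insert p A := e ▸ hq.mem
        simp [hpq.symm, hqA] at this)
      (by rw [Finset.card_insert_of_notMem hpA]; omega)
    rw [edgeCost_two_mul_add_one, weightCost_two_mul_add_one, hd, hp.weight] at e
    push_cast at e
    omega
  have hsp : Sparse (2 * h + 1) G (fun x => w x + (h + 1) * (G.mult p x + G.mult q x)) P := by
    refine sparse_of_two_le fun A hA hA2 => ?_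
    have hcA : c ∉ A := fun hh => nc (hA hh)
    have hpA : p ∉ A := fun hh => np (hA hh)
    have hqA : q ∉ A := fun hh => nq (hA hh)
    have h1 := gap A (hA.trans hPY) (fun e => hcA (e ▸ hc)) hA2
    have h2 := pot_raise_half_ge (h := h) G w (fun x => G.mult p x + G.mult q x) A
    have h3 : ∑ x ∈ A, ((G.mult p x + G.mult q x : ℕ) : ℤ) = G.degIn p A + G.degIn q A := by
      unfold degIn; rw [← Finset.sum_add_distrib]; push_cast; rfl
    rw [h3] at h2
    have d1 := G.degIn_mono p hA
    have d2 := G.degIn_mono q hA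
    have d3 := G.degIn_mono c hA
    have d1' := G.degIn_nonneg p A
    have d2' := G.degIn_nonneg q A
    have d3' := G.degIn_nonneg c A
    by_cases t1 : G.degIn p A = 2
    · by_cases t2 : G.degIn q A = 2
      · have hpqA : p ∉ insert q A := by simp [hpq, hpA]
        have hcpqA : c ∉ insert p (insert q A) := by simp [hpc.symm, hqc.symm, hcA]
        have e1 := pot_insert (2 * h + 1) G w hqA
        have e2 := pot_insert (2 * h + 1) G w hpqA
        have e3 := pot_insert (2 * h + 1) G w hcpqA
        rw [G.degIn_insert _ hpqA, G.degIn_insert _ hqA, hcp1, hcq1, hwc,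
          weightCost_two_mul_add_one, edgeCost_two_mul_add_one] at e3
        rw [G.degIn_insert _ hqA, hpq0, hwp,
          weightCost_two_mul_add_one, edgeCost_two_mul_add_one, t1] at e2
        rw [hwq, weightCost_two_mul_add_one, edgeCost_two_mul_add_one, t2] at e1
        rw [t1, t2] at h2
        have hmin1 : min h (2 * h + 2) = h := by omega
        have hmin2 : min (h + 1) (2 * h + 2) = h + 1 := by omega
        rw [hmin1] at e1 e2
        rw [hmin2] at e3
        push_cast at e1 e2 e3
        have hsub : insert c (insert p (insert q A)) ⊆ Y := by
          intro x hx
          simp only [Finset.mem_insert] at hx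
          rcases hx with rfl | rfl | rfl | hx
          · exact hc
          · exact hp.mem
          · exact hq.mem
          · exact hPY (hA hx)
        have h5 := hY.sparse _ hsub (by simp)
        -- Four raises are paid by adding `p`, `q` and `c` to `A`. If `c` has no edge to `A`, the
        -- enlarged set misses the third neighbour of `c`, is proper, and the gap applies; otherwise
        -- the extra edge to `A` makes the bound -1 sufficient.
        rcases (by omega : G.degIn c A = 0 ∨ G.degIn c A = 1) with t3 | t3
        · have h6 := gap _ hsub (fun e => by
            have := degIn_erase_self G c (insert c (insert p (insert q A)))
            have h7 : G.degIn c (insert c (insert p (insert q A))) = 2 := by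
              rw [G.degIn_insert_self, G.degIn_insert _ hpqA, G.degIn_insert _ hqA, hcp1, hcq1, t3]
              rfl
            rw [e, hdc] at h7
            omega) (hA2.trans (Finset.card_le_card (by intro x hx; simp [hx])))
          rw [t3] at e3
          linarith
        · rw [t3] at e3
          linarith
      · have := key A hA hA2 p q hp hq hpq hpA hqA t1
        have : G.degIn q A ≤ 1 := by omega
        nlinarith
    · by_cases t2 : G.degIn q A = 2
      · have := key A hA hA2 q p hq hp hpq.symm hqA hpA t2
        have : G.degIn p A ≤ 1 := by omega
        nlinarith
      · have : G.degIn p A + G.degIn q A ≤ 2 := by omega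
        nlinarith
  obtain ⟨M, F, hcol⟩ := hY.ih G _ P (Finset.card_lt_card
    ⟨hPY, fun hh => nc (hh hc)⟩) hsp
  -- The vertex `c` has only one edge to `P` and goes to F. It therefore needs no reserve when `p`
  -- and `q` are added.
  have c1 := hcol.insert_right (v := c) nc (by
    have := hcol.degIn_add c; have := G.degIn_nonneg c M; omega)
  have c1' : G.IsCol (fun x => w x + (h + 1) * G.mult p x + (h + 1) * G.mult q x) (2 * h + 1)
      (insert c P) M (insert c F) := c1.mono fun x _ => by rw [mul_add]; omega
  obtain ⟨M2, F2, c2⟩ := c1'.insert_light (s := fun x => (h + 1) * G.mult q x)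
    (by simp [np, hpc]) hwp (by simp [hqp0])
    (by rw [G.degIn_insert _ nc, hpc1, hdp]; norm_num)
  have c2' : G.IsCol (fun x => w x + (h + 1) * G.mult q x + 0) (2 * h + 1)
      (insert p (insert c P)) M2 F2 := c2
  obtain ⟨M3, F3, c3⟩ := c2'.insert_light (s := fun _ => 0)
    (by simp [nq, hqc, hpq.symm]) hwq rfl
    (by rw [G.degIn_insert _ (by simp [np, hpc]), G.degIn_insert _ nc, hqp0, hqc1, hdq]; norm_num)
  exact hY.not_isCol c3 hins

end Critical

end MultGraph

/-! ### Stars with three light vertices: potential bounds. -/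

namespace MultGraph

variable {V : Type*} [DecidableEq V]

/-- A vertex `a` of degree four with three light neighbours `p`, `q`, `s`. -/
structure LightStar (h : ℕ) (G : MultGraph V) (w : V → ℕ) (Y : Finset V) (a p q s : V) :
    Prop where
  mem : a ∈ Y
  deg : G.degIn a Y = 4
  weight : w a = 0
  light₁ : IsLight h G w Y p
  light₂ : IsLight h G w Y q
  light₃ : IsLight h G w Y s
  ne₁₂ : p ≠ q
  ne₁₃ : p ≠ s
  ne₂₃ : q ≠ s
  mult₁ : G.mult a p = 1
  mult₂ : G.mult a q = 1
  mult₃ : G.mult a s = 1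

namespace LightStar

variable {h : ℕ} {G : MultGraph V} {w : V → ℕ} {Y : Finset V} {a p q s : V}

lemma swap (st : LightStar h G w Y a p q s) : LightStar h G w Y a q p s :=
  ⟨st.mem, st.deg, st.weight, st.light₂, st.light₁, st.light₃, st.ne₁₂.symm, st.ne₂₃, st.ne₁₃,
    st.mult₂, st.mult₁, st.mult₃⟩

lemma rotate (st : LightStar h G w Y a p q s) : LightStar h G w Y a q s p :=
  ⟨st.mem, st.deg, st.weight, st.light₂, st.light₃, st.light₁, st.ne₂₃, st.ne₁₂.symm,
    st.ne₁₃.symm, st.mult₂, st.mult₃, st.mult₁⟩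

lemma ne_left (st : LightStar h G w Y a p q s) : a ≠ p := by
  rintro rfl; have := st.mult₁; rw [G.irrefl] at this; omega

end LightStar

/-- The part of `Y` outside a star. -/
def starCompl (Y : Finset V) (a p q s : V) : Finset V := Y \ {a, p, q, s}

lemma starCompl_swap (Y : Finset V) (a p q s : V) : starCompl Y a q p s = starCompl Y a p q s := by
  ext x; simp only [starCompl, Finset.mem_sdiff, Finset.mem_insert, Finset.mem_singleton]; tauto

lemma starCompl_rotate (Y : Finset V) (a p q s : V) :
    starCompl Y a q s p = starCompl Y a p q s := by
  ext x; simp only [starCompl, Finset.mem_sdiff, Finset.mem_insert, Finset.mem_singleton]; tauto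

/-- The degree of a vertex splits into its edges to the star and its edges to the rest. -/
lemma degIn_add_starCompl {Y : Finset V} {a p q s : V} (G : MultGraph V)
    (hsub : {a, p, q, s} ⊆ Y) (v : V) (hap : a ≠ p) (haq : a ≠ q) (has : a ≠ s) (hpq : p ≠ q)
    (hps : p ≠ s) (hqs : q ≠ s) :
    G.degIn v (starCompl Y a p q s) + (G.mult v a + G.mult v p + G.mult v q + G.mult v s) =
      G.degIn v Y := by
  rw [← Finset.sdiff_union_of_subset hsub, G.degIn_union v Finset.sdiff_disjoint]
  unfold starCompl
  rw [Finset.sdiff_union_of_subset hsub, G.degIn_insert v (by simp [hap, haq, has]),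
    G.degIn_insert v (by simp [hpq, hps]), G.degIn_insert v (by simp [hqs]), G.degIn_singleton]
  ring

namespace Critical

variable {h : ℕ} {G : MultGraph V} {w : V → ℕ} {Y : Finset V} {a p q s : V}

lemma gap_odd (hY : Critical (2 * h + 1) G w Y) {S : Finset V} (hS : S ⊆ Y) (hSY : S ≠ Y)
    (h2 : 2 ≤ S.card) : 4 * (h : ℤ) + 4 ≤ pot (2 * h + 1) G w S := by
  have := hY.gap hS hSY h2
  rwa [edgeCost_two_mul_add_one] at this

lemma pot_insert_light (_hY : Critical (2 * h + 1) G w Y) (hp : IsLight h G w Y p) {A : Finset V}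
    (hpA : p ∉ A) : pot (2 * h + 1) G w (insert p A) =
      pot (2 * h + 1) G w A + (6 * h + 7) - (4 * h + 4) * G.degIn p A := by
  rw [pot_insert _ _ _ hpA, hp.weight, edgeCost_two_mul_add_one, weightCost_two_mul_add_one]
  have : min h (2 * h + 2) = h := by omega
  rw [this]; ring

/-- Two light vertices extend a coloring. -/
lemma false_of_isCol_two (hY : Critical (2 * h + 1) G w Y) (hq : IsLight h G w Y q)
    (hs : IsLight h G w Y s) (hqs : q ≠ s) {Z M F : Finset V} (hZ : Z = Y \ {q, s})
    (hc : G.IsCol (fun x => w x + (h + 1) * G.mult q x + (h + 1) * G.mult s x) (2 * h + 1) Z M F) :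
    False := by
  subst hZ
  obtain ⟨M', F', c1⟩ := hc.insert_light (s := fun x => (h + 1) * G.mult s x) (by simp) hq.weight
    (by simp [hY.light_nonadj hs hq])
    ((G.degIn_mono q Finset.sdiff_subset).trans (by rw [hq.deg]))
  have c1' : G.IsCol (fun x => w x + (h + 1) * G.mult s x + 0) (2 * h + 1) _ M' F' := c1
  obtain ⟨M2, F2, c2⟩ := c1'.insert_light (s := fun _ => 0) (by simp [hqs.symm]) hs.weight rfl
    ((G.degIn_mono (B := Y) s (by
      intro x hx
      simp only [Finset.mem_insert, Finset.mem_sdiff] at hx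
      rcases hx with rfl | hx
      · exact hq.mem
      · exact hx.1)).trans (by rw [hs.deg]))
  refine hY.not_isCol c2 ?_
  ext x
  simp only [Finset.mem_insert, Finset.mem_sdiff, Finset.mem_singleton]
  have := hq.mem; have := hs.mem
  grind

/-- Three light vertices extend a coloring. -/
lemma false_of_isCol_three (hY : Critical (2 * h + 1) G w Y) (st : LightStar h G w Y a p q s)
    {Z M F : Finset V} (hZ : Z = Y \ {p, q, s})
    (hc : G.IsCol (fun x => w x + (h + 1) * G.mult p x + (h + 1) * (G.mult q x + G.mult s x))
      (2 * h + 1) Z M F) : False := by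
  subst hZ
  obtain ⟨M', F', c1⟩ := hc.insert_light (s := fun x => (h + 1) * (G.mult q x + G.mult s x))
    (by simp) st.light₁.weight
    (by simp [hY.light_nonadj st.light₂ st.light₁, hY.light_nonadj st.light₃ st.light₁])
    ((G.degIn_mono p Finset.sdiff_subset).trans (by rw [st.light₁.deg]))
  refine hY.false_of_isCol_two st.light₂ st.light₃ st.ne₂₃ ?_
    (c1.mono fun x _ => by rw [mul_add]; omega)
  ext x
  simp only [Finset.mem_insert, Finset.mem_sdiff, Finset.mem_singleton]
  have := st.light₁.mem; have := st.ne₁₂; have := st.ne₁₃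
  grind

section star

variable (hY : Critical (2 * h + 1) G w Y) (st : LightStar h G w Y a p q s)
include hY st

lemma star_subset : {a, p, q, s} ⊆ Y := by
  intro x hx
  simp only [Finset.mem_insert, Finset.mem_singleton] at hx
  rcases hx with rfl | rfl | rfl | rfl
  exacts [st.mem, st.light₁.mem, st.light₂.mem, st.light₃.mem]

lemma degIn_starCompl_center : G.degIn a (starCompl Y a p q s) = 1 := by
  have := degIn_add_starCompl G (hY.star_subset st) a st.ne_left st.swap.ne_left
    st.rotate.rotate.ne_left st.ne₁₂ st.ne₁₃ st.ne₂₃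
  rw [st.deg, st.mult₁, st.mult₂, st.mult₃, G.irrefl] at this
  push_cast at this; omega

lemma degIn_starCompl_light : G.degIn p (starCompl Y a p q s) = 2 := by
  have := degIn_add_starCompl G (hY.star_subset st) p st.ne_left st.swap.ne_left
    st.rotate.rotate.ne_left st.ne₁₂ st.ne₁₃ st.ne₂₃
  rw [st.light₁.deg, G.symm p a, st.mult₁, hY.light_nonadj st.light₁ st.light₂,
    hY.light_nonadj st.light₁ st.light₃, G.irrefl] at this
  push_cast at this; omega

lemma notMem_of_subset_starCompl {A : Finset V} (hA : A ⊆ starCompl Y a p q s) :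
    A ⊆ Y ∧ a ∉ A ∧ p ∉ A ∧ q ∉ A ∧ s ∉ A := by
  refine ⟨fun x hx => (Finset.mem_sdiff.1 (hA hx)).1, ?_, ?_, ?_, ?_⟩ <;>
  · intro hx
    have := (Finset.mem_sdiff.1 (hA hx)).2
    simp at this

/-- The gap applied to `A` together with `p` gives more than the gap for `A`, since adding `p`
lowers the potential. The value is just enough for three raises. -/
lemma pot_ge_of_one_pair {A : Finset V} (hA : A ⊆ starCompl Y a p q s) (hA2 : 2 ≤ A.card)
    (hd : G.degIn p A = 2) : 6 * (h : ℤ) + 5 ≤ pot (2 * h + 1) G w A := by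
  obtain ⟨hAY, -, hpA, hqA, -⟩ := hY.notMem_of_subset_starCompl st hA
  have h1 := hY.pot_insert_light st.light₁ hpA
  have h2 := hY.gap_odd (Finset.insert_subset st.light₁.mem hAY)
    (fun e => by
      have : q ∈ insert p A := e ▸ st.light₂.mem
      simp [st.ne₁₂.symm, hqA] at this)
    (by rw [Finset.card_insert_of_notMem hpA]; omega)
  rw [hd] at h1
  linarith

/-- The same with `p`, `q` and the centre added, a set that is proper because it omits `s`. The
value is just enough for four raises. -/
lemma pot_ge_of_two_pairs {A : Finset V} (hA : A ⊆ starCompl Y a p q s) (hA2 : 2 ≤ A.card)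
    (hd : G.degIn p A = 2) (hd' : G.degIn q A = 2) :
    8 * (h : ℤ) + 7 ≤ pot (2 * h + 1) G w A := by
  obtain ⟨hAY, haA, hpA, hqA, hsA⟩ := hY.notMem_of_subset_starCompl st hA
  have hpqA : p ∉ insert q A := by simp [hpA, st.ne₁₂]
  have hapqA : a ∉ insert p (insert q A) := by simp [haA, st.ne_left, st.swap.ne_left]
  have h1 := hY.pot_insert_light st.light₂ hqA
  have h2 := hY.pot_insert_light st.light₁ hpqA
  have h3 := pot_insert (2 * h + 1) G w hapqA
  rw [G.degIn_insert _ hqA, hY.light_nonadj st.light₁ st.light₂, hd] at h2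
  rw [G.degIn_insert _ hpqA, G.degIn_insert _ hqA, st.mult₁, st.mult₂, st.weight,
    weightCost_zero, edgeCost_two_mul_add_one] at h3
  rw [hd'] at h1
  have h4 := hY.gap_odd (S := insert a (insert p (insert q A)))
    (Finset.insert_subset st.mem (Finset.insert_subset st.light₁.mem
      (Finset.insert_subset st.light₂.mem hAY)))
    (fun e => by
      have : s ∈ insert a (insert p (insert q A)) := e ▸ st.light₃.mem
      simp [st.ne₁₃.symm, st.ne₂₃.symm, hsA, st.rotate.rotate.ne_left.symm] at this)
    (hA2.trans (Finset.card_le_card (by intro x hx; simp [hx])))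
  have h5 := G.degIn_nonneg a A
  push_cast at h2 h3
  nlinarith

lemma pot_insert_star {A : Finset V} (hA : A ⊆ starCompl Y a p q s) :
    pot (2 * h + 1) G w (insert a (insert p (insert q (insert s A)))) =
      pot (2 * h + 1) G w A + (26 * h + 28) - (4 * h + 4) *
        (3 + (G.degIn p A + G.degIn q A + G.degIn s A) + G.degIn a A) := by
  obtain ⟨hAY, haA, hpA, hqA, hsA⟩ := hY.notMem_of_subset_starCompl st hA
  have hq : q ∉ insert s A := by simp [hqA, st.ne₂₃]
  have hp : p ∉ insert q (insert s A) := by simp [hpA, st.ne₁₂, st.ne₁₃]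
  have ha : a ∉ insert p (insert q (insert s A)) := by
    simp [haA, st.ne_left, st.swap.ne_left, st.rotate.rotate.ne_left]
  rw [pot_insert _ _ _ ha, hY.pot_insert_light st.light₁ hp, hY.pot_insert_light st.light₂ hq,
    hY.pot_insert_light st.light₃ hsA, G.degIn_insert _ hp, G.degIn_insert _ hq,
    G.degIn_insert _ hsA, G.degIn_insert _ hq, G.degIn_insert _ hsA, G.degIn_insert _ hsA,
    st.mult₁, st.mult₂, st.mult₃, hY.light_nonadj st.light₁ st.light₂,
    hY.light_nonadj st.light₁ st.light₃, hY.light_nonadj st.light₂ st.light₃, st.weight,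
    weightCost_zero, edgeCost_two_mul_add_one]
  push_cast; ring

lemma insert_star_starCompl :
    insert a (insert p (insert q (insert s (starCompl Y a p q s)))) = Y := by
  ext x
  simp only [starCompl, Finset.mem_insert, Finset.mem_sdiff, Finset.mem_singleton]
  have := st.mem; have := st.light₁.mem; have := st.light₂.mem; have := st.light₃.mem
  grind

lemma pot_star_ge {A : Finset V} (hA : A ⊆ starCompl Y a p q s) (hA2 : 2 ≤ A.card)
    (hne : A ≠ starCompl Y a p q s) :
    (4 * h + 4) * (4 + (G.degIn p A + G.degIn q A + G.degIn s A) + G.degIn a A) - (26 * h + 28)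
      ≤ pot (2 * h + 1) G w A := by
  obtain ⟨hAY, haA, hpA, hqA, hsA⟩ := hY.notMem_of_subset_starCompl st hA
  have h1 := hY.pot_insert_star st hA
  have h2 := hY.gap_odd (S := insert a (insert p (insert q (insert s A))))
    (Finset.insert_subset st.mem (Finset.insert_subset st.light₁.mem
      (Finset.insert_subset st.light₂.mem (Finset.insert_subset st.light₃.mem hAY))))
    (fun e => hne (subset_antisymm hA fun x hx => by
      have hx' := Finset.mem_sdiff.1 hx
      have : x ∈ insert a (insert p (insert q (insert s A))) := by rw [e]; exact hx'.1
      simp only [Finset.mem_insert, Finset.mem_singleton] at this hx'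
      tauto))
    (hA2.trans (Finset.card_le_card (by intro x hx; simp [hx])))
  linarith

/-- All seven edges from the star to the rest are counted, and only the bound -1 for `Y` is
available. The result still exceeds the cost 12h+12 of six raises, up to the tolerance of one. -/
lemma pot_starCompl_ge : 14 * (h : ℤ) + 11 ≤ pot (2 * h + 1) G w (starCompl Y a p q s) := by
  have h1 := hY.pot_insert_star st (subset_refl _)
  have h2 := hY.degIn_starCompl_center st
  have h3 := hY.degIn_starCompl_light st
  have h4 := hY.degIn_starCompl_light st.swap
  have h5 := hY.degIn_starCompl_light st.rotate.rotate
  rw [starCompl_swap] at h4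
  rw [starCompl_rotate, starCompl_rotate] at h5
  rw [hY.insert_star_starCompl st, h2, h3, h4, h5] at h1
  have := hY.sparse Y subset_rfl hY.nonempty
  linarith

end star

end Critical

end MultGraph

/-! ### Stars with three light vertices: contracting a tight set. -/

namespace MultGraph

variable {V : Type*} [DecidableEq V]

lemma weightCost_raise_le (h a m b : ℕ) :
    weightCost (2 * h + 1) (a + (h + 1) * m + b) - weightCost (2 * h + 1) a ≤
      (2 * h + 2) * m + weightCost (2 * h + 1) b := by
  have h1 := weightCost_add_le (2 * h + 1) (a + (h + 1) * m) b
  have h2 := weightCost_add_le (2 * h + 1) a ((h + 1) * m)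
  have h3 := weightCost_le_two_mul (2 * h + 1) ((h + 1) * m)
  push_cast at h3
  linarith

/-- The common form of contraction used for stars: `ex` counts additional edges from `R` to the
contracted vertex, `m` and `m'` count by how many units the weights of the vertices of `R` are
raised, at most as often as minimality of `S` allows. -/
lemma Critical.exists_isCol_union_of_minimal {h : ℕ} {G : MultGraph V} {w : V → ℕ} {Y : Finset V}
    (hY : Critical (2 * h + 1) G w Y) {S R MS FS : Finset V} (hSY : S ⊆ Y) (hRY : R ⊆ Y)
    (hSR : Disjoint S R) (hS2 : 2 ≤ S.card)
    {mS m : V → ℕ} (hS : G.IsCol (fun x => w x + (h + 1) * mS x) (2 * h + 1) S MS FS)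
    (ex : V → ℕ) (hex : ∑ x ∈ R, (ex x : ℤ) ≤ 1)
    (hmin : ∀ X ⊆ R, X.Nonempty → (2 * h + 2) * ∑ x ∈ X, (m x : ℤ) ≤
      pot (2 * h + 1) G w (X ∪ S) - pot (2 * h + 1) G w S) :
    ∃ M F, M ⊆ R ∧ F ⊆ R ∧
      G.IsCol (fun x => w x + (h + 1) * if x ∈ S then mS x else m x) (2 * h + 1) (S ∪ R)
        (MS ∪ M) (FS ∪ F) ∧
      ∀ A ⊆ FS, ∀ B ⊆ F, A.Nonempty → B.Nonempty →
        G.edges (A ∪ B) + ∑ x ∈ B, (ex x : ℤ) + 1 ≤ (A ∪ B).card := by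
  have hsum : ∀ X : Finset V, ∑ x ∈ X, ((2 * h + 2) * m x : ℤ) =
      (2 * h + 2) * ∑ x ∈ X, (m x : ℤ) := fun X => by rw [Finset.mul_sum]
  obtain ⟨u, hu⟩ : S.Nonempty := Finset.card_pos.1 (by omega)
  have hcard : S.card + R.card ≤ Y.card := by
    rw [← Finset.card_union_of_disjoint hSR]
    exact Finset.card_le_card (Finset.union_subset hSY hRY)
  have hk := Critical.edgeCost_two_mul_add_one h
  -- Every outside neighbour of `MS` is forced into F, so there is no exceptional edge and `u u 0`
  -- are dummies. The minimality of `S` pays for the raises outside, and the term k-1 pays for the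
  -- single extra edge.
  refine exists_isCol_union (w := w)
    (wR := fun x => w x + (h + 1) * m x + if 0 < G.degIn x MS then 2 * h + 2 else 0) hY.ih hS hSR
    ⟨u, hu⟩ (by omega) ex (fun x => (2 * h + 2) * m x)
    (fun x _ => ?_) (fun X hX hne => ?_) (fun X hX hne => ?_) (fun x hx => ?_) (fun x hx => ?_)
    u u 0 (by omega) (fun x _ hpos => Or.inl ?_)
  · refine (weightCost_raise_le h (w x) (m x) _).trans ?_
    rw [hk, add_comm]
    gcongr
    split_ifs with hp
    · rw [weightCost_of_le (by omega), hk]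
      nlinarith
    · rw [weightCost_zero]
      have := G.degIn_nonneg x MS
      positivity
  · have h1 := hmin X hX hne
    rw [hsum, hk]
    have := G.cross_nonneg X FS
    nlinarith
  · have h1 := hmin X hX hne
    have h2 : ∑ x ∈ X, (ex x : ℤ) ≤ 1 := (Finset.sum_le_sum_of_subset_of_nonneg hX
      fun _ _ _ => Int.natCast_nonneg _).trans hex
    rw [hsum, hk]
    nlinarith
  · simp [hx]
  · have : x ∉ S := Finset.disjoint_right.1 hSR hx
    simp [this]
  · simp only [hpos, if_true]
    omega

/-- A vertex with two neighbours in the forest part, in different components, can be added. -/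
lemma isAcyc_insert_of_split {G : MultGraph V} {A₀ B₀ : Finset V} {v : V} {ex : V → ℕ}
    (hac : G.IsAcyc (A₀ ∪ B₀)) (hv : v ∉ A₀ ∪ B₀)
    (hsep : ∀ A ⊆ A₀, ∀ B ⊆ B₀, A.Nonempty → B.Nonempty →
        G.edges (A ∪ B) + ∑ x ∈ B, (ex x : ℤ) + 1 ≤ (A ∪ B).card)
    (hA : G.degIn v A₀ ≤ 1) (hB : ∀ B ⊆ B₀, G.degIn v B ≤ ∑ x ∈ B, (ex x : ℤ))
    (hB1 : G.degIn v B₀ ≤ 1) (hdisj : Disjoint A₀ B₀) : G.IsAcyc (insert v (A₀ ∪ B₀)) := by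
  refine isAcyc_insert hac hv fun C hC hne => ?_
  obtain ⟨A, B, hA', hB', rfl⟩ : ∃ A B, A ⊆ A₀ ∧ B ⊆ B₀ ∧ C = A ∪ B :=
    ⟨C ∩ A₀, C ∩ B₀, Finset.inter_subset_right, Finset.inter_subset_right, by
      rw [← Finset.inter_union_distrib_left, Finset.inter_eq_left.2 hC]⟩
  rw [G.degIn_union v (hdisj.mono hA' hB')]
  have h1 := hac _ hC hne
  have h2 := G.degIn_mono v hA'
  have h3 := G.degIn_mono v hB'
  rcases A.eq_empty_or_nonempty with rfl | hAne
  · rw [degIn_empty]; omega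
  rcases B.eq_empty_or_nonempty with rfl | hBne
  · rw [degIn_empty]; omega
  have := hsep A hA' B hB' hAne hBne
  have := hB B hB'
  omega

namespace Critical

variable {h : ℕ} {G : MultGraph V} {w : V → ℕ} {Y : Finset V} {a p q s : V}

lemma sum_mult_add (G : MultGraph V) (p q : V) (A : Finset V) :
    ∑ x ∈ A, ((G.mult p x + G.mult q x : ℕ) : ℤ) = G.degIn p A + G.degIn q A := by
  unfold degIn; rw [← Finset.sum_add_distrib]; push_cast; rfl

lemma sum_mult_add_add (G : MultGraph V) (p q s : V) (A : Finset V) :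
    ∑ x ∈ A, ((G.mult p x + G.mult q x + G.mult s x : ℕ) : ℤ) =
      G.degIn p A + G.degIn q A + G.degIn s A := by
  unfold degIn; rw [← Finset.sum_add_distrib, ← Finset.sum_add_distrib]; push_cast; rfl

section star

variable (hY : Critical (2 * h + 1) G w Y) (st : LightStar h G w Y a p q s)
include hY st

lemma eq_sdiff_two : insert p (insert a (starCompl Y a p q s)) = Y \ {q, s} := by
  ext x
  simp only [starCompl, Finset.mem_insert, Finset.mem_sdiff, Finset.mem_singleton]
  have := st.mem; have := st.light₁.mem; have := st.ne₁₂; have := st.ne₁₃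
  have := st.swap.ne_left; have := st.rotate.rotate.ne_left
  grind

lemma eq_sdiff_three : insert a (starCompl Y a p q s) = Y \ {p, q, s} := by
  ext x
  simp only [starCompl, Finset.mem_insert, Finset.mem_sdiff, Finset.mem_singleton]
  have := st.mem; have := st.ne_left
  have := st.swap.ne_left; have := st.rotate.rotate.ne_left
  grind

/-- A tight set containing two neighbours of `p` and one of `s` can be contracted. -/
lemma false_of_tight_pair {S : Finset V} (hS : S ⊆ starCompl Y a p q s) (hS2 : 2 ≤ S.card)
    (hSP : S ≠ starCompl Y a p q s)
    (hσ : pot (2 * h + 1) G w S ≤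
      (2 * h + 2) * (G.degIn p S + G.degIn q S + G.degIn s S) - 2)
    (hmin : ∀ X ⊆ starCompl Y a p q s \ S, X.Nonempty →
      (2 * h + 2) * (G.degIn p X + G.degIn q X + G.degIn s X) ≤
        pot (2 * h + 1) G w (X ∪ S) - pot (2 * h + 1) G w S)
    (hp2 : G.degIn p S = 2) (hq1 : 1 ≤ G.degIn q S) (hs1 : G.degIn s S = 1) : False := by
  obtain ⟨hSY, haS, hpS, hqS, hsS⟩ := hY.notMem_of_subset_starCompl st hS
  obtain ⟨hPY, haP, hpP, hqP, hsP⟩ := hY.notMem_of_subset_starCompl st (subset_refl _)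
  set P := starCompl Y a p q s with hP
  have hdaP : G.degIn a P = 1 := hY.degIn_starCompl_center st
  have hdpP : G.degIn p P = 2 := hY.degIn_starCompl_light st
  have hdqP : G.degIn q P = 2 := by
    rw [hP, ← starCompl_swap]; exact hY.degIn_starCompl_light st.swap
  have hSR : Disjoint S (P \ S) := Finset.disjoint_sdiff
  have hdaS : G.degIn a S = 0 := by
    by_contra hne
    have h0 := G.degIn_nonneg a S
    have h1 := hY.pot_star_ge st hS hS2 hSP
    have h2 := G.degIn_mono q hS
    rw [hp2, hs1] at h1 hσ
    have h3 : 1 ≤ G.degIn a S := by omega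
    have h4 : (4 * (h : ℤ) + 4) * (4 + (2 + G.degIn q S + 1) + 1) ≤
      (4 * h + 4) * (4 + (2 + G.degIn q S + 1) + G.degIn a S) := by gcongr
    nlinarith
  have hunion : ∀ v, G.degIn v S + G.degIn v (P \ S) = G.degIn v P := fun v => by
    rw [← G.degIn_union v hSR, Finset.union_sdiff_of_subset hS]
  have hdaR : G.degIn a (P \ S) = 1 := by have := hunion a; omega
  have hdpR : G.degIn p (P \ S) = 0 := by have := hunion p; omega
  have hsp : Sparse (2 * h + 1) G (fun x => w x + (h + 1) * (G.mult q x + G.mult s x)) S := by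
    refine sparse_of_two_le fun A hA hA2 => ?_
    have h1 := hY.gap_odd (hA.trans hSY) (fun e => haS (hA (e ▸ st.mem))) hA2
    have h2 := pot_raise_half_ge (h := h) G w (fun x => G.mult q x + G.mult s x) A
    rw [sum_mult_add] at h2
    have d1 := G.degIn_mono q (hA.trans hS)
    have d2 := G.degIn_mono s hA
    by_cases t1 : G.degIn q A = 2
    · have := hY.pot_ge_of_one_pair st.swap (A := A)
        (by rw [starCompl_swap]; exact hA.trans hS) hA2 t1
      have : G.degIn q A + G.degIn s A ≤ 3 := by omega
      nlinarith
    · have : G.degIn q A + G.degIn s A ≤ 2 := by omega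
      nlinarith
  obtain ⟨MS, FS, hcol⟩ := hY.ih G _ S (Finset.card_lt_card
    ⟨hSY, fun hh => haS (hh st.mem)⟩) hsp
  -- The extra edge joins the outer neighbour of `a` to the contracted vertex. If that neighbour
  -- lies in F, it is then in a different component from every vertex of `FS`, so `a` may later be
  -- joined to both sides.
  obtain ⟨M, F, hMR, hFR, hMF, hsep⟩ := hY.exists_isCol_union_of_minimal hSY
    (Finset.sdiff_subset.trans hPY) hSR hS2 (m := fun x => G.mult q x + G.mult s x) hcol
    (fun x => G.mult a x) hdaR.le
    (fun X hX hne => by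
      rw [sum_mult_add]
      refine le_trans ?_ (hmin X hX hne)
      have := G.degIn_nonneg p X
      gcongr
      omega)
  rw [Finset.union_sdiff_of_subset hS] at hMF
  replace hMF : G.IsCol (fun x => w x + (h + 1) * G.mult q x + (h + 1) * G.mult s x) (2 * h + 1)
      P (MS ∪ M) (FS ∪ F) := hMF.mono fun x _ => by
    rw [ite_self, mul_add]; omega
  have hFF : Disjoint FS F := hSR.mono hcol.subset_right hFR
  have hpF : G.degIn p F = 0 := by
    have := G.degIn_mono p hFR; have := G.degIn_nonneg p F; omega
  have haFS : G.degIn a FS = 0 := by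
    have := G.degIn_mono a hcol.subset_right; have := G.degIn_nonneg a FS; omega
  have hda : G.degIn a (FS ∪ F) ≤ 1 := by
    have := G.degIn_mono a hMF.subset_right; omega
  have hadd := hMF.degIn_add p
  have hpM := G.degIn_nonneg p (MS ∪ M)
  have hp0 := G.degIn_nonneg p (FS ∪ F)
  have haF : a ∉ FS ∪ F := fun hh => haP (hMF.subset_right hh)
  have hpF' : p ∉ FS ∪ F := fun hh => hpP (hMF.subset_right hh)
  have hpaP : p ∉ insert a P := by simp [hpP, st.ne_left.symm]
  have hfin := @false_of_isCol_two _ _ _ _ _ _ _ _ hY st.light₂ st.light₃ st.ne₂₃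
  have hpa : G.mult p a = 1 := by rw [G.symm]; exact st.mult₁
  -- Both outer edges of `p` end in `S`. With no edge or two edges to F, `a` joins F and then `p`
  -- joins F or M respectively; with one edge both join F, and the separation ensures that no cycle
  -- arises through `a`.
  rcases (by omega : G.degIn p (FS ∪ F) = 0 ∨ G.degIn p (FS ∪ F) = 1 ∨ G.degIn p (FS ∪ F) = 2)
    with e | e | e
  · exact hfin (hY.eq_sdiff_two st) ((hMF.insert_right haP hda).insert_right hpaP (by
      rw [G.degIn_insert _ haF, hpa, e]; norm_num))
  · have c1 := hMF.insert_right hpP e.le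
    have hapP : a ∉ insert p P := by simp [haP, st.ne_left]
    have hins : insert p (FS ∪ F) = insert p FS ∪ F := by rw [Finset.insert_union]
    have hpFS : p ∉ FS := fun hh => hpF' (Finset.mem_union_left _ hh)
    have hpFS1 : G.degIn p FS = 1 := by rw [G.degIn_union _ hFF] at e; omega
    have c2 := c1.insert_right_of_acyc hapP (by
      have hacyc := c1.acyc
      rw [hins] at hacyc ⊢
      refine isAcyc_insert_of_split (ex := fun x => G.mult a x) hacyc
        (by rw [← hins]; simp [haF, st.ne_left]) ?_
        (by rw [G.degIn_insert _ hpFS, st.mult₁, haFS]; norm_num) (fun B _ => le_rfl)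
        ((G.degIn_mono a hFR).trans hdaR.le)
        (Finset.disjoint_insert_left.2 ⟨fun hh => hpF' (Finset.mem_union_right _ hh), hFF⟩)
      intro A hA B hB hAne hBne
      have hBF : G.degIn p B = 0 := by
        have := G.degIn_mono p hB; have := G.degIn_nonneg p B; omega
      have hpB : p ∉ B := fun hh => hpF' (Finset.mem_union_right _ (hB hh))
      by_cases hpA : p ∈ A
      · obtain ⟨A', hpA', rfl⟩ : ∃ A', p ∉ A' ∧ A = insert p A' :=
          ⟨A.erase p, by simp, (Finset.insert_erase hpA).symm⟩
        have hA'F : A' ⊆ FS := fun x hx => (Finset.mem_insert.1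
          (hA (Finset.mem_insert_of_mem hx))).resolve_left (by rintro rfl; exact hpA' hx)
        have hpAB : p ∉ A' ∪ B := by simp [hpA', hpB]
        rw [Finset.insert_union, G.edges_insert hpAB, Finset.card_insert_of_notMem hpAB,
          G.degIn_union _ (hFF.mono hA'F hB), hBF]
        push_cast
        rcases A'.eq_empty_or_nonempty with rfl | hA'ne
        · have h1 := hMF.acyc B (hB.trans Finset.subset_union_right) hBne
          have h2 : ∑ x ∈ B, (G.mult a x : ℤ) ≤ 1 := (G.degIn_mono a (hB.trans hFR)).trans hdaR.le
          rw [Finset.empty_union, degIn_empty]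
          omega
        · have h1 := hsep A' hA'F B hB hA'ne hBne
          have h2 := G.degIn_mono p hA'F
          omega
      · exact hsep A (fun x hx => (Finset.mem_insert.1 (hA hx)).resolve_left
          (by rintro rfl; exact hpA hx)) B hB hAne hBne)
    exact hfin (by rw [Finset.insert_comm]; exact hY.eq_sdiff_two st) c2
  · exact hfin (hY.eq_sdiff_two st) ((hMF.insert_right haP hda).insert_left_isolated hpaP (by
      have h1 := st.light₁.weight
      have h2 := hY.light_nonadj st.light₂ st.light₁
      have h3 := hY.light_nonadj st.light₃ st.light₁
      rw [h1, h2, h3]; omega) (by omega))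

/-- A tight set containing one neighbour of each of `p`, `q`, `s` can be contracted. -/
lemma false_of_tight_single {S : Finset V} (hS : S ⊆ starCompl Y a p q s) (hS2 : 2 ≤ S.card)
    (hmin : ∀ X ⊆ starCompl Y a p q s \ S, X.Nonempty →
      (2 * h + 2) * (G.degIn p X + G.degIn q X + G.degIn s X) ≤
        pot (2 * h + 1) G w (X ∪ S) - pot (2 * h + 1) G w S)
    (hp1 : G.degIn p S = 1) (hq1 : G.degIn q S = 1) (hs1 : G.degIn s S = 1) : False := by
  obtain ⟨hSY, haS, hpS, hqS, hsS⟩ := hY.notMem_of_subset_starCompl st hS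
  obtain ⟨hPY, haP, hpP, hqP, hsP⟩ := hY.notMem_of_subset_starCompl st (subset_refl _)
  have hfin3 := @false_of_isCol_three _ _ _ _ _ _ _ _ _ _ hY st
  have hZ3 := hY.eq_sdiff_three st
  have hZs : insert s (insert a (starCompl Y a p q s)) = Y \ {p, q} := by
    rw [← hY.eq_sdiff_two st.rotate.rotate, starCompl_rotate, starCompl_rotate]
  have hins := hY.insert_star_starCompl st
  set P := starCompl Y a p q s with hP
  have hdaP : G.degIn a P = 1 := hY.degIn_starCompl_center st
  have hdpP : G.degIn p P = 2 := hY.degIn_starCompl_light st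
  have hdqP : G.degIn q P = 2 := by
    rw [hP, ← starCompl_swap]; exact hY.degIn_starCompl_light st.swap
  have hdsP : G.degIn s P = 2 := by
    rw [hP, ← starCompl_rotate, ← starCompl_rotate]
    exact hY.degIn_starCompl_light st.rotate.rotate
  have hSR : Disjoint S (P \ S) := Finset.disjoint_sdiff
  have hunion : ∀ v, G.degIn v S + G.degIn v (P \ S) = G.degIn v P := fun v => by
    rw [← G.degIn_union v hSR, Finset.union_sdiff_of_subset hS]
  have hdqR : G.degIn q (P \ S) = 1 := by have := hunion q; omega
  have hdpR : G.degIn p (P \ S) = 1 := by have := hunion p; omega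
  have hdsR : G.degIn s (P \ S) = 1 := by have := hunion s; omega
  have hsp : Sparse (2 * h + 1) G (fun x => w x + (h + 1) * (G.mult p x + G.mult q x)) S := by
    refine sparse_of_two_le fun A hA hA2 => ?_
    have h1 := hY.gap_odd (hA.trans hSY) (fun e => haS (hA (e ▸ st.mem))) hA2
    have h2 := pot_raise_half_ge (h := h) G w (fun x => G.mult p x + G.mult q x) A
    rw [sum_mult_add] at h2
    have d1 := G.degIn_mono p hA
    have d2 := G.degIn_mono q hA
    have : G.degIn p A + G.degIn q A ≤ 2 := by omega
    nlinarith
  obtain ⟨MS, FS, hcol⟩ := hY.ih G _ S (Finset.card_lt_card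
    ⟨hSY, fun hh => haS (hh st.mem)⟩) hsp
  have hsadd := hcol.degIn_add s
  have hsMS := G.degIn_nonneg s MS
  have hsFS := G.degIn_nonneg s FS
  -- If the neighbour of `s` in `S` is not in the small part, it needs no reserve, and all three
  -- light vertices can be served outside `S`.
  by_cases hsM : G.degIn s MS = 0
  · obtain ⟨M, F, hMR, hFR, hMF, -⟩ := hY.exists_isCol_union_of_minimal hSY
      (Finset.sdiff_subset.trans hPY) hSR hS2
      (m := fun x => G.mult p x + G.mult q x + G.mult s x) hcol (fun _ => 0) (by simp)
      (fun X hX hne => by rw [sum_mult_add_add]; exact hmin X hX hne)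
    rw [Finset.union_sdiff_of_subset hS] at hMF
    replace hMF : G.IsCol (fun x => w x + (h + 1) * G.mult p x +
        (h + 1) * (G.mult q x + G.mult s x)) (2 * h + 1) P (MS ∪ M) (FS ∪ F) := by
      refine hMF.mono fun x hx => ?_
      by_cases hxS : x ∈ S
      · have hxM : x ∈ MS := (Finset.mem_union.1 hx).resolve_right
          fun hh => Finset.disjoint_left.1 hSR hxS (hMR hh)
        have := G.mult_le_degIn s hxM
        have h0 : G.mult s x = 0 := by omega
        simp only [hxS, if_true, h0, mul_add]; omega
      · simp only [hxS, if_false, mul_add]; omega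
    exact hfin3 hZ3 (hMF.insert_right haP (by have := G.degIn_mono a hMF.subset_right; omega))
  -- Now `s` has at most one edge to F. The extra edge at the outer neighbour of `q` separates the
  -- two possible F-neighbours of `q`.
  · obtain ⟨M, F, hMR, hFR, hMF, hsep⟩ := hY.exists_isCol_union_of_minimal hSY
      (Finset.sdiff_subset.trans hPY) hSR hS2
      (m := fun x => G.mult p x + G.mult q x) hcol (fun x => G.mult q x) hdqR.le
      (fun X hX hne => by
        rw [sum_mult_add]
        have := G.degIn_nonneg s X
        exact (mul_le_mul_of_nonneg_left (by omega) (by positivity)).trans (hmin X hX hne))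
    rw [Finset.union_sdiff_of_subset hS] at hMF
    replace hMF : G.IsCol (fun x => w x + (h + 1) * G.mult p x + (h + 1) * G.mult q x)
        (2 * h + 1) P (MS ∪ M) (FS ∪ F) := hMF.mono fun x _ => by
      rw [ite_self, mul_add]; omega
    have hFF : Disjoint FS F := hSR.mono hcol.subset_right hFR
    have haF : a ∉ FS ∪ F := fun hh => haP (hMF.subset_right hh)
    have hsF : s ∉ FS ∪ F := fun hh => hsP (hMF.subset_right hh)
    have hqF : q ∉ FS ∪ F := fun hh => hqP (hMF.subset_right hh)
    have hsa : G.mult s a = 1 := by rw [G.symm]; exact st.mult₃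
    have hds : G.degIn s (FS ∪ F) ≤ 1 := by
      rw [G.degIn_union _ hFF]
      have := G.degIn_mono s hFR; omega
    have haadd := hMF.degIn_add a
    have haM := G.degIn_nonneg a (MS ∪ M)
    have haF0 := G.degIn_nonneg a (FS ∪ F)
    have hsF0 := G.degIn_nonneg s (FS ∪ F)
    have has : a ≠ s := st.rotate.rotate.ne_left
    have hfin := @false_of_isCol_two _ _ _ _ _ _ _ _ hY st.light₁ st.light₂ st.ne₁₂
    by_cases hs0 : G.degIn s (FS ∪ F) = 0
    · exact hfin hZs ((hMF.insert_right haP (by omega)).insert_right (by simp [hsP, has.symm])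
        (by rw [G.degIn_insert _ haF, hsa, hs0]; norm_num))
    by_cases ha0 : G.degIn a (FS ∪ F) = 0
    · exact hfin (by rw [Finset.insert_comm]; exact hZs)
        ((hMF.insert_right hsP hds).insert_right (by simp [haP, has])
        (by rw [G.degIn_insert _ hsF, st.mult₃, ha0]; norm_num))
    -- Here the outer neighbour of `a` lies in F. The vertices `q` and `s` go to F, so `a` can go to
    -- M: its only possible neighbour there is `p`, and in that case both outer edges of `p` go to
    -- F, so the component is just {`a`, `p`} with total h+1.
    have hMF0 : G.IsCol w (2 * h + 1) P (MS ∪ M) (FS ∪ F) := hMF.mono fun x _ => by omega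
    have c1 := hMF0.insert_right_of_acyc hqP (isAcyc_insert_of_split hMF0.acyc hqF hsep
      ((G.degIn_mono q hcol.subset_right).trans hq1.le) (fun B _ => le_rfl)
      ((G.degIn_mono q hFR).trans hdqR.le) hFF)
    have hsqP : s ∉ insert q P := by simp [hsP, st.ne₂₃.symm]
    have hsqF : s ∉ insert q (FS ∪ F) := by simp [hsF, st.ne₂₃.symm]
    have c2 := c1.insert_right hsqP (by
      rw [G.degIn_insert _ hqF, hY.light_nonadj st.light₃ st.light₂]; push_cast; omega)
    have hpsq : p ∉ insert s (insert q P) := by simp [hpP, st.ne₁₂, st.ne₁₃]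
    have hdp : G.degIn p (insert s (insert q (FS ∪ F))) = G.degIn p (FS ∪ F) := by
      rw [G.degIn_insert _ hsqF, G.degIn_insert _ hqF, hY.light_nonadj st.light₁ st.light₂,
        hY.light_nonadj st.light₁ st.light₃]; simp
    have hapsq : a ∉ insert p (insert s (insert q P)) := by
      simp [haP, st.ne_left, st.swap.ne_left, has]
    have hZ : insert a (insert p (insert s (insert q P))) = Y := by
      rw [Finset.insert_comm s q]; exact hins
    have hpadd := hMF.degIn_add p
    have hpM := G.degIn_nonneg p (MS ∪ M)
    have hwp := st.light₁.weight
    have hwa := st.weight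
    by_cases hp : G.degIn p (FS ∪ F) ≤ 1
    · exact hY.not_isCol ((c2.insert_right hpsq (by omega)).insert_left_isolated hapsq
        (by omega) (by omega)) hZ
    · have c3 := c2.insert_left (w := fun x => w x + if x = p then 1 else 0) hpsq
        (fun x hx => by
          have : x ≠ p := by rintro rfl; exact hpsq hx
          simp [this]) (by simp; omega) (by omega)
        (fun x hx hx1 => by have := G.mult_le_degIn p hx; omega)
      have hpMM : p ∉ MS ∪ M := fun hh => hpP (hMF.subset_left hh)
      have c4 := c3.insert_left (w := w) hapsq (fun x _ => by simp) (by omega)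
        (by rw [G.degIn_insert _ hpMM, st.mult₁]; push_cast; omega)
        (fun x hx hx1 => by
          rcases Finset.mem_insert.1 hx with rfl | hx
          · simp; omega
          · have := G.mult_le_degIn a hx; omega)
      exact hY.not_isCol c4 hZ

end star

/-- A set of smallest potential, after raising all neighbours of the light vertices of a star. -/
structure TightSet (h : ℕ) (G : MultGraph V) (w : V → ℕ) (Y : Finset V) (a p q s : V)
    (S : Finset V) : Prop where
  star : LightStar h G w Y a p q s
  subset : S ⊆ starCompl Y a p q s
  card : 2 ≤ S.card
  ne : S ≠ starCompl Y a p q s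
  le : pot (2 * h + 1) G w S ≤ (2 * h + 2) * (G.degIn p S + G.degIn q S + G.degIn s S) - 2
  min : ∀ X ⊆ starCompl Y a p q s \ S, X.Nonempty →
    (2 * h + 2) * (G.degIn p X + G.degIn q X + G.degIn s X) ≤
      pot (2 * h + 1) G w (X ∪ S) - pot (2 * h + 1) G w S

lemma TightSet.swap {S : Finset V} (hS : TightSet h G w Y a p q s S) :
    TightSet h G w Y a q p s S := by
  refine ⟨hS.star.swap, ?_, hS.card, ?_, ?_, ?_⟩
  · rw [starCompl_swap]; exact hS.subset
  · rw [starCompl_swap]; exact hS.ne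
  · have := hS.le; linarith
  · rw [starCompl_swap]; intro X hX hne; have := hS.min X hX hne; linarith

lemma TightSet.rotate {S : Finset V} (hS : TightSet h G w Y a p q s S) :
    TightSet h G w Y a q s p S := by
  refine ⟨hS.star.rotate, ?_, hS.card, ?_, ?_, ?_⟩
  · rw [starCompl_rotate]; exact hS.subset
  · rw [starCompl_rotate]; exact hS.ne
  · have := hS.le; linarith
  · rw [starCompl_rotate]; intro X hX hne; have := hS.min X hX hne; linarith

lemma TightSet.degIn_le (hY : Critical (2 * h + 1) G w Y) {S : Finset V}
    (hS : TightSet h G w Y a p q s S) : G.degIn p S ≤ 2 := by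
  rw [← hY.degIn_starCompl_light hS.star]
  exact G.degIn_mono p hS.subset

/-- Without edges from `s`, at most four raises fall on `S`. The bounds 4h+4, 6h+5 and 8h+7 for at
most two, three and four raises contradict tightness. -/
lemma TightSet.one_le_degIn (hY : Critical (2 * h + 1) G w Y) {S : Finset V}
    (hS : TightSet h G w Y a p q s S) : 1 ≤ G.degIn s S := by
  by_contra! hlt
  obtain ⟨hSY, haS, -⟩ := hY.notMem_of_subset_starCompl hS.star hS.subset
  have hgap := hY.gap_odd hSY (fun e => haS (e ▸ hS.star.mem)) hS.card
  have h1 := hS.degIn_le hY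
  have h2 := hS.swap.degIn_le hY
  have h3 := G.degIn_nonneg s S
  have h4 := G.degIn_nonneg p S
  have h5 := G.degIn_nonneg q S
  have hs : G.degIn s S = 0 := by omega
  have hle := hS.le
  rw [hs] at hle
  by_cases e1 : G.degIn p S = 2
  · by_cases e2 : G.degIn q S = 2
    · have := hY.pot_ge_of_two_pairs hS.star hS.subset hS.card e1 e2
      rw [e1, e2] at hle
      linarith
    · have := hY.pot_ge_of_one_pair hS.star hS.subset hS.card e1
      have : G.degIn p S + G.degIn q S + 0 ≤ 3 := by omega
      nlinarith
  · by_cases e2 : G.degIn q S = 2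
    · have := hY.pot_ge_of_one_pair hS.swap.star hS.swap.subset hS.card e2
      have : G.degIn p S + G.degIn q S + 0 ≤ 3 := by omega
      nlinarith
    · have : G.degIn p S + G.degIn q S + 0 ≤ 2 := by omega
      nlinarith

lemma TightSet.false_of_pair (hY : Critical (2 * h + 1) G w Y) {S : Finset V}
    (hS : TightSet h G w Y a p q s S) (hp : G.degIn p S = 2) (hs : G.degIn s S = 1) : False :=
  hY.false_of_tight_pair hS.star hS.subset hS.card hS.ne hS.le hS.min hp
    (hS.rotate.rotate.one_le_degIn hY) hs

/-- Each light vertex sends one or two edges to `S`. The pattern (1,1,1) and, after rotation, the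
mixed patterns are contracted; (2,2,2) makes `S` with the star too dense. -/
lemma TightSet.false (hY : Critical (2 * h + 1) G w Y) {S : Finset V}
    (hS : TightSet h G w Y a p q s S) : False := by
  have r1 := hS.rotate
  have r2 := hS.rotate.rotate
  have s2 := hS.one_le_degIn hY
  have p2 := r1.one_le_degIn hY
  have q2 := r2.one_le_degIn hY
  have p3 := hS.degIn_le hY
  have q3 := r1.degIn_le hY
  have s3 := r2.degIn_le hY
  rcases (by omega : G.degIn p S = 1 ∨ G.degIn p S = 2) with ep | ep <;>
  rcases (by omega : G.degIn q S = 1 ∨ G.degIn q S = 2) with eq | eq <;>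
  rcases (by omega : G.degIn s S = 1 ∨ G.degIn s S = 2) with es | es
  · exact hY.false_of_tight_single hS.star hS.subset hS.card hS.min ep eq es
  · exact r2.false_of_pair hY es eq
  · exact r1.false_of_pair hY eq ep
  · exact r1.false_of_pair hY eq ep
  · exact hS.false_of_pair hY ep es
  · exact r2.false_of_pair hY es eq
  · exact hS.false_of_pair hY ep es
  · have h1 := hY.pot_star_ge hS.star hS.subset hS.card hS.ne
    have h2 := hS.le
    have h3 := G.degIn_nonneg a S
    rw [ep, eq, es] at h1 h2
    nlinarith

/-- A vertex of degree four and weight zero has at most two light neighbours. -/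
theorem not_lightStar (hY : Critical (2 * h + 1) G w Y) (st : LightStar h G w Y a p q s) :
    False := by
  obtain ⟨hPY, haP, hpP, hqP, hsP⟩ := hY.notMem_of_subset_starCompl st (subset_refl _)
  have hdpP := hY.degIn_starCompl_light st
  have hdqP := hY.degIn_starCompl_light st.swap
  have hdsP := hY.degIn_starCompl_light st.rotate.rotate
  rw [starCompl_swap] at hdqP
  rw [starCompl_rotate, starCompl_rotate] at hdsP
  -- If all outer neighbours of the light vertices can be raised, the centre has one outer edge and
  -- goes to F, and the light vertices follow. Otherwise a set minimising the reduced potential is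
  -- tight.
  by_cases hI : ∀ A ⊆ starCompl Y a p q s, 2 ≤ A.card → -1 ≤ pot (2 * h + 1) G w A -
      (2 * h + 2) * (G.degIn p A + G.degIn q A + G.degIn s A)
  · have hsp : Sparse (2 * h + 1) G (fun x => w x + (h + 1) *
        (G.mult p x + G.mult q x + G.mult s x)) (starCompl Y a p q s) := by
      refine sparse_of_two_le fun A hA hA2 => (hI A hA hA2).trans ?_
      rw [← sum_mult_add_add]
      exact pot_raise_half_ge (h := h) G w (fun x => G.mult p x + G.mult q x + G.mult s x) A
    obtain ⟨M, F, hc⟩ := hY.ih G _ (starCompl Y a p q s) (Finset.card_lt_card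
      ⟨hPY, fun hh => haP (hh st.mem)⟩) hsp
    have c1 := hc.insert_right haP (by
      have := G.degIn_mono a hc.subset_right
      have := hY.degIn_starCompl_center st
      omega)
    exact hY.false_of_isCol_three st (hY.eq_sdiff_three st) (c1.mono fun x _ => by
      simp only [mul_add]; omega)
  · push Not at hI
    obtain ⟨A₀, hA₀, hA₀2, hlt⟩ := hI
    obtain ⟨S, hS, hmin⟩ := Finset.exists_min_image
      ((starCompl Y a p q s).powerset.filter fun T => 2 ≤ T.card)
      (fun A => pot (2 * h + 1) G w A -
        (2 * h + 2) * (G.degIn p A + G.degIn q A + G.degIn s A)) ⟨A₀, by simp [hA₀, hA₀2]⟩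
    have hσ := hmin A₀ (by simp [hA₀, hA₀2])
    simp only [Finset.mem_filter, Finset.mem_powerset] at hS
    obtain ⟨hSP, hS2⟩ := hS
    replace hσ : pot (2 * h + 1) G w S ≤
        (2 * h + 2) * (G.degIn p S + G.degIn q S + G.degIn s S) - 2 := by linarith
    have hne : S ≠ starCompl Y a p q s := by
      rintro rfl
      rw [hdpP, hdqP, hdsP] at hσ
      have := hY.pot_starCompl_ge st
      have : (0 : ℤ) ≤ h := Int.natCast_nonneg _
      linarith
    refine TightSet.false hY (S := S) ⟨st, hSP, hS2, hne, hσ, fun X hX _ => ?_⟩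
    have h1 := hmin (X ∪ S) (by
      simp only [Finset.mem_filter, Finset.mem_powerset]
      exact ⟨Finset.union_subset (hX.trans Finset.sdiff_subset) hSP,
        hS2.trans (Finset.card_le_card Finset.subset_union_right)⟩)
    have hd : Disjoint X S := Finset.sdiff_disjoint.mono_left hX
    simp only [G.degIn_union _ hd] at h1
    linarith

end Critical

end MultGraph

/-! ### Odd D: discharging. -/

namespace MultGraph

variable {V : Type*} [DecidableEq V]

lemma degIn_le_card_filter (G : MultGraph V) {v : V} {A : Finset V}
    (h : ∀ x ∈ A, G.mult v x ≤ 1) :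
    G.degIn v A ≤ (A.filter fun x => 1 ≤ G.mult v x).card := by
  rw [Finset.card_filter]
  push_cast
  exact Finset.sum_le_sum fun x hx => by have := h x hx; split_ifs <;> simp <;> omega

namespace Critical

variable {h : ℕ} {G : MultGraph V} {w : V → ℕ} {Y T : Finset V}

/-- The charge of a vertex that is not light, after discharging. -/
lemma charge_of_not_light (hY : Critical (2 * h + 1) G w Y)
    (hT : ∀ v, v ∈ T ↔ IsLight h G w Y v) {u : V} (hu : u ∈ Y) (huT : u ∉ T) :
    (G.degIn u T + 3 * (8 * h + 7 - weightCost (2 * h + 1) (w u) - (2 * h + 2) * G.degIn u Y) ≤ -2)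
    ∨ (G.degIn u Y = 4 ∧ w u = 0 ∧ G.degIn u T = 2) := by
  have hTY : T ⊆ Y := fun v hv => ((hT v).1 hv).mem
  have h0 := G.degIn_nonneg u T
  have h1 := G.degIn_mono u hTY
  have hmult : ∀ x ∈ T, G.mult u x ≤ 1 := fun x hx => by
    rw [G.symm]; exact hY.light_mult_le_one ((hT x).1 hx) hu
  have hcard := G.degIn_le_card_filter hmult
  have hd := hY.two_le_degIn hu
  have hw : 1 ≤ G.degIn u T → w u ≤ h + 1 := fun hh => by
    obtain ⟨x, hx, hx1⟩ := G.exists_mult_pos_of_degIn_pos (v := u) (A := T) (by omega)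
    exact hY.weight_le_of_light ((hT x).1 hx) hu (by rw [G.symm]; exact hx1)
  rw [weightCost_two_mul_add_one]
  rcases (by omega : G.degIn u Y = 2 ∨ G.degIn u Y = 3 ∨ G.degIn u Y = 4 ∨ 5 ≤ G.degIn u Y)
    with e | e | e | e
  · left
    have := hd.2 e
    by_cases hh : 1 ≤ G.degIn u T
    · have := hw hh; omega
    · rw [e]; omega
  · left
    have h2 := hY.le_weight hu e
    have h3 : w u ≠ h := fun hh => huT ((hT u).2 ⟨hu, e, hh⟩)
    rw [e]
    by_cases h4 : w u = h + 1
    · suffices G.degIn u T ≤ 1 by omega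
      by_contra! hlt
      obtain ⟨p, hp, q, hq, hpq⟩ := Finset.one_lt_card.1
        (by omega : 1 < (T.filter fun x => 1 ≤ G.mult u x).card)
      rw [Finset.mem_filter] at hp hq
      exact hY.light_nbrs_of_degree_three hu e h4 ((hT p).1 hp.1) ((hT q).1 hq.1) hpq hp.2 hq.2
    · omega
  · by_cases h4 : w u = 0
    · rcases lt_trichotomy (G.degIn u T) 2 with h5 | h5 | h5
      · left; rw [e, h4]; omega
      · right; exact ⟨e, h4, h5⟩
      · obtain ⟨p, hp, q, hq, s, hs, hpq, hps, hqs⟩ := Finset.two_lt_card.1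
          (by omega : 2 < (T.filter fun x => 1 ≤ G.mult u x).card)
        rw [Finset.mem_filter] at hp hq hs
        have m1 := hmult p hp.1
        have m2 := hmult q hq.1
        have m3 := hmult s hs.1
        exact (hY.not_lightStar (a := u) (p := p) (q := q) (s := s) ⟨hu, e, h4, (hT p).1 hp.1,
          (hT q).1 hq.1, (hT s).1 hs.1, hpq, hps, hqs, by omega, by omega, by omega⟩).elim
    · left; rw [e]; omega
  · left
    have : 0 ≤ (6 * h + 5) * (G.degIn u Y - 5) := mul_nonneg (by omega) (by omega)
    have : (0 : ℤ) ≤ (min (w u) (2 * h + 2) : ℕ) := Int.natCast_nonneg _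
    linarith

/-- Two light vertices joined to all vertices of a triangle can be colored. -/
lemma false_of_card_eq_three (hY : Critical (2 * h + 1) G w Y)
    (hT : ∀ v, v ∈ T ↔ IsLight h G w Y v) (hc : (Y \ T).card = 3) (hne : T.Nonempty)
    (hU : ∀ u ∈ Y \ T, G.degIn u Y = 4 ∧ w u = 0 ∧ G.degIn u T = 2) : False := by
  have hTY : T ⊆ Y := fun v hv => ((hT v).1 hv).mem
  have hTU : ∀ v ∈ T, G.degIn v (Y \ T) = 3 := fun v hv => by
    have h1 := ((hT v).1 hv).deg
    rw [← Finset.sdiff_union_of_subset hTY, G.degIn_union v Finset.sdiff_disjoint] at h1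
    have h2 : G.degIn v T = 0 := Finset.sum_eq_zero fun x hx => by
      simp [hY.light_nonadj ((hT v).1 hv) ((hT x).1 hx)]
    omega
  have hcross := G.cross_comm T (Y \ T)
  unfold cross at hcross
  -- Double counting gives 3|T| = 2·3, so there are exactly two light vertices.
  rw [Finset.sum_congr rfl hTU, Finset.sum_congr rfl fun u hu => (hU u hu).2.2] at hcross
  simp only [Finset.sum_const, nsmul_eq_mul, hc] at hcross
  obtain ⟨p, q, hpq, rfl⟩ := Finset.card_eq_two.1 (by push_cast at hcross; omega : T.card = 2)
  obtain ⟨a, b, c, hab, hac, hbc, hU'⟩ := Finset.card_eq_three.1 hc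
  have hp := (hT p).1 (by simp)
  have hq := (hT q).1 (by simp)
  have hUY : ∀ u ∈ Y \ {p, q}, u ∈ Y ∧ u ≠ p ∧ u ≠ q := fun u hu => by
    simp at hu; tauto
  have hdU : ∀ u ∈ Y \ {p, q}, G.degIn u (Y \ {p, q}) = 2 := fun u hu => by
    have h1 := hU u hu
    have h2 := G.degIn_union u (Finset.sdiff_disjoint (s := {p, q}) (t := Y))
    rw [Finset.sdiff_union_of_subset hTY] at h2
    omega
  have hwU : ∀ u ∈ Y \ {p, q}, w u = 0 := fun u hu => (hU u hu).2.1
  have hYeq : Y = {a, b, c} ∪ {p, q} := by rw [← hU', Finset.sdiff_union_of_subset hTY]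
  rw [hU'] at hUY hdU hwU
  have da := hdU a (by simp)
  have db := hdU b (by simp)
  have dc := hdU c (by simp)
  have ea := hUY a (by simp)
  have eb := hUY b (by simp)
  have ec := hUY c (by simp)
  rw [G.degIn_insert _ (by simp [hab, hac]), G.degIn_insert _ (by simp [hbc]),
    G.degIn_singleton, G.irrefl] at da db dc
  have sba := G.symm b a
  have sca := G.symm c a
  have scb := G.symm c b
  have pa := hY.light_mult_le_one hp ea.1
  have qa := hY.light_mult_le_one hq ea.1
  have hqp := hY.light_nonadj hq hp
  -- The coloring is M = {b, c} and F = {a, p, q}. The temporary weight 1 at `b` reserves room for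
  -- the edge to `c`.
  have c1 := (isCol_empty G (fun x => w x + if x = b then 1 else 0) (2 * h + 1)).insert_left_isolated
    (v := b) (by simp) (by simp [hwU b]) (by simp)
  have c2 := c1.insert_left (v := c) (w := w) (by simp [hbc.symm]) (by simp) (by simp [hwU c])
    (by simp; omega) (by simp [hwU c])
  have c3 := c2.insert_right (v := a) (by simp [hab, hac]) (by simp)
  have c4 := c3.insert_right (v := p) (by simp; tauto) (by simp; omega)
  have c5 := c4.insert_right (v := q) (by simp [hpq.symm]; tauto)
    (by rw [G.degIn_insert _ (by simp; tauto)]; simp [hqp]; omega)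
  refine hY.not_isCol c5 ?_
  rw [hYeq]
  ext x
  simp only [Finset.mem_insert, Finset.mem_union, Finset.mem_singleton, Finset.notMem_empty]
  tauto

end Critical

/-- Light vertices have charge 1 and send 1/3 to each neighbour. Three times the potential then
becomes a sum over the other vertices with all terms at most -1, while it must be at least -3. A
light vertex has three distinct such neighbours, so there are exactly three non-light vertices, all
of the extremal type; without light vertices all terms are at most -2. -/
lemma not_critical_of_odd {h : ℕ} {G : MultGraph V} {w : V → ℕ} {Y : Finset V}
    (hY : Critical (2 * h + 1) G w Y) : False := by
  classical
  set T := Y.filter fun v => IsLight h G w Y v with hTdef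
  have hT : ∀ v, v ∈ T ↔ IsLight h G w Y v := fun v => by
    simp only [hTdef, Finset.mem_filter]
    exact ⟨fun hh => hh.2, fun hh => ⟨hh.mem, hh⟩⟩
  have hTY : T ⊆ Y := Finset.filter_subset _ _
  have hTU : ∀ v ∈ T, G.degIn v (Y \ T) = 3 := fun v hv => by
    have h1 := ((hT v).1 hv).deg
    rw [← Finset.sdiff_union_of_subset hTY, G.degIn_union v Finset.sdiff_disjoint] at h1
    have h2 : G.degIn v T = 0 := Finset.sum_eq_zero fun x hx => by
      simp [hY.light_nonadj ((hT v).1 hv) ((hT x).1 hx)]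
    omega
  have hpot := hY.sparse Y subset_rfl hY.nonempty
  have hcross := G.cross_comm T (Y \ T)
  unfold cross at hcross
  rw [Finset.sum_congr rfl hTU] at hcross
  set τ : V → ℤ := fun x =>
    8 * h + 7 - weightCost (2 * h + 1) (w x) - (2 * h + 2) * G.degIn x Y with hτ
  have e1 : pot (2 * h + 1) G w Y = ∑ x ∈ Y, τ x := by
    have e := two_mul_pot (2 * h + 1) G w Y
    rw [Critical.edgeCost_two_mul_add_one] at e
    have : 2 * ∑ x ∈ Y, τ x = 2 * pot (2 * h + 1) G w Y := by
      rw [e, Finset.mul_sum]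
      exact Finset.sum_congr rfl fun x _ => by simp only [hτ]; ring
    omega
  have e2 : ∑ x ∈ T, τ x = ∑ x ∈ T, (1 : ℤ) := Finset.sum_congr rfl fun x hx => by
    have hx' := (hT x).1 hx
    simp only [hτ]
    rw [hx'.deg, hx'.weight, Critical.weightCost_two_mul_add_one]
    omega
  have e3 : 3 * pot (2 * h + 1) G w Y = ∑ u ∈ Y \ T, (G.degIn u T + 3 * τ u) := by
    rw [e1, ← Finset.sum_sdiff hTY, Finset.sum_add_distrib, ← hcross, e2, ← Finset.mul_sum]
    simp; ring
  have hch : ∀ u ∈ Y \ T, G.degIn u T + 3 * τ u ≤ -2 ∨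
      (G.degIn u Y = 4 ∧ w u = 0 ∧ G.degIn u T = 2) := fun u hu => by
    rw [Finset.mem_sdiff] at hu
    exact hY.charge_of_not_light hT hu.1 hu.2
  have hle : ∀ u ∈ Y \ T, G.degIn u T + 3 * τ u ≤ -1 := fun u hu => by
    rcases hch u hu with h1 | ⟨h1, h2, h3⟩
    · omega
    · simp only [hτ]
      rw [h1, h2, h3, weightCost_zero]; omega
  rcases T.eq_empty_or_nonempty with h0 | ⟨v, hv⟩
  · have : ∑ u ∈ Y \ T, (G.degIn u T + 3 * τ u) ≤ ∑ u ∈ Y \ T, (-2) :=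
      Finset.sum_le_sum fun u hu => (hch u hu).resolve_right fun ⟨_, _, h3⟩ => by
        rw [h0] at h3; simp at h3
    have h2 := hY.two_le_card
    rw [h0] at this e3
    simp only [Finset.sdiff_empty, Finset.sum_const, nsmul_eq_mul] at this e3
    omega
  · have hc : 3 ≤ (Y \ T).card := by
      have h1 := G.degIn_le_card_filter (v := v) (A := Y \ T) fun x hx =>
        hY.light_mult_le_one ((hT v).1 hv) (Finset.mem_sdiff.1 hx).1
      have h2 := Finset.card_filter_le (Y \ T) fun x => 1 ≤ G.mult v x
      rw [hTU v hv] at h1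
      omega
    have hall : ∀ u ∈ Y \ T, ¬ G.degIn u T + 3 * τ u ≤ -2 := fun u hu hh => by
      have h1 : ∑ x ∈ (Y \ T).erase u, (G.degIn x T + 3 * τ x) ≤ ∑ x ∈ (Y \ T).erase u, (-1) :=
        Finset.sum_le_sum fun x hx => hle x (Finset.mem_of_mem_erase hx)
      rw [← Finset.add_sum_erase _ _ hu] at e3
      simp [Finset.card_erase_of_mem hu] at h1
      omega
    have hc3 : (Y \ T).card = 3 := by
      have := Finset.sum_le_sum hle
      simp only [Finset.sum_const, nsmul_eq_mul] at this
      omega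
    exact hY.false_of_card_eq_three hT hc3 ⟨v, hv⟩ fun u hu => (hch u hu).resolve_left (hall u hu)

theorem colorable_of_sparse (D : ℕ) (G : MultGraph V) (w : V → ℕ) (Y : Finset V)
    (hs : Sparse D G w Y) : G.Colorable w D Y := by
  induction hn : Y.card using Nat.strong_induction_on generalizing G w Y with
  | _ n ih =>
    by_contra hc
    have hY : Critical D G w Y := ⟨hs, hc, fun G' w' Y' hlt hs' => ih _ (hn ▸ hlt) G' w' Y' hs' rfl⟩
    rcases Nat.even_or_odd' D with ⟨h, rfl | rfl⟩
    · exact not_critical_of_even (by omega) hY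
    · exact not_critical_of_odd hY

end MultGraph

/-! ### Transfer of the coloring theorem to `Graph`. -/

namespace MultGraph

variable {V : Type*} [DecidableEq V]

/-- A set of vertices that can be built up by adding neighbours one by one. -/
inductive Conn (G : MultGraph V) : Finset V → Prop
  | single (x : V) : Conn G {x}
  | insert {A : Finset V} {u v : V} (hA : Conn G A) (hu : u ∈ A) (hv : v ∉ A)
      (h : 1 ≤ G.mult v u) : Conn G (insert v A)

lemma Conn.card_le {G : MultGraph V} {A : Finset V} (h : G.Conn A) :
    (A.card : ℤ) ≤ G.edges A + 1 := by
  induction h with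
  | single x => simp
  | @insert A u v hA hu hv hm ih =>
    rw [G.edges_insert hv, Finset.card_insert_of_notMem hv]
    have := G.mult_le_degIn v hu
    push_cast
    omega

end MultGraph

namespace Graph

variable {α β : Type*}

/-- The edge multiplicities of a finite loopless multigraph. -/
noncomputable def toMultGraph (G : Graph α β) (hG : G.Loopless) : MultGraph α where
  mult x y := {e | G.IsLink e x y}.ncard
  symm x y := by simp_rw [fun e => G.isLink_comm (e := e) (x := x) (y := y)]
  irrefl x := by simp

variable [DecidableEq α] {G : Graph α β} {hG : G.Loopless}

lemma degIn_toMultGraph (hE : G.edgeSet.Finite) (v : α) (A : Finset α) :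
    (G.toMultGraph hG).degIn v A = ({e | ∃ x ∈ A, G.IsLink e v x}.ncard : ℤ) := by
  induction A using Finset.induction_on with
  | empty => simp
  | insert y A hy ih =>
    have hu : {e | ∃ x ∈ insert y A, G.IsLink e v x} =
        {e | G.IsLink e v y} ∪ {e | ∃ x ∈ A, G.IsLink e v x} := by
      ext e; simp
    have hf : ∀ p : α → Prop, {e | ∃ x, p x ∧ G.IsLink e v x}.Finite := fun p =>
      hE.subset fun e ⟨x, _, he⟩ => he.edge_mem
    rw [MultGraph.degIn_insert _ _ hy, ih, hu, Set.ncard_union_eq ?_ ?_ (hf _)]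
    · push_cast; rfl
    · rw [Set.disjoint_left]
      rintro e h1 ⟨x, hx, h2⟩
      exact hy (h1.right_unique h2 ▸ hx)
    · exact hE.subset fun e he => IsLink.edge_mem he

lemma edges_toMultGraph (hE : G.edgeSet.Finite) (A : Finset α) :
    (G.toMultGraph hG).edges A = ((G.induce A).edgeSet.ncard : ℤ) := by
  induction A using Finset.induction_on with
  | empty => simp [edgeSet_induce]
  | insert v A hv ih =>
    have hu : (G.induce (insert v A : Finset α)).edgeSet =
        (G.induce A).edgeSet ∪ {e | ∃ x ∈ A, G.IsLink e v x} := by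
      ext e
      simp only [edgeSet_induce, Finset.coe_insert, Set.mem_ofPred_eq, Set.mem_union,
        Set.mem_insert_iff, Finset.mem_coe]
      constructor
      · rintro ⟨x, y, h, rfl | hx, rfl | hy⟩
        · exact absurd rfl h.ne
        · exact Or.inr ⟨y, hy, h⟩
        · exact Or.inr ⟨x, hx, h.symm⟩
        · exact Or.inl ⟨x, y, h, hx, hy⟩
      · rintro (⟨x, y, h, hx, hy⟩ | ⟨x, hx, h⟩)
        · exact ⟨x, y, h, Or.inr hx, Or.inr hy⟩
        · exact ⟨v, x, h, Or.inl rfl, Or.inr hx⟩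
    rw [MultGraph.edges_insert _ hv, ih, hu, degIn_toMultGraph hE, Set.ncard_union_eq ?_ ?_ ?_]
    · push_cast; rfl
    · rw [Set.disjoint_left]
      rintro e ⟨x, y, h1, hx, hy⟩ ⟨z, hz, h2⟩
      rcases h2.left_eq_or_eq h1 with rfl | rfl
      · exact hv hx
      · exact hv hy
    · exact hE.subset fun e ⟨x, y, he, _⟩ => he.edge_mem
    · exact hE.subset fun e ⟨x, _, he⟩ => he.edge_mem

lemma one_le_mult_toMultGraph (hE : G.edgeSet.Finite) {x y : α} :
    1 ≤ (G.toMultGraph hG).mult x y ↔ G.Adj x y := by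
  have hf : {e | G.IsLink e x y}.Finite := hE.subset fun e he => IsLink.edge_mem he
  change 1 ≤ {e | G.IsLink e x y}.ncard ↔ {e | G.IsLink e x y}.Nonempty
  rw [Nat.one_le_iff_ne_zero, Ne, Set.ncard_eq_zero hf, ← Ne, ← Set.nonempty_iff_ne_empty]

/-- A cycle spans a vertex set with at least as many edges as vertices, which the acyclicity bound
excludes. -/
lemma isForestGraph_induce (hE : G.edgeSet.Finite) {F : Finset α}
    (h : (G.toMultGraph hG).IsAcyc F) : (G.induce F).IsForestGraph := by
  rintro n ⟨v, e, hv, he, hl⟩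
  have hB : Finset.univ.image v ⊆ F := fun x hx => by
    obtain ⟨i, -, rfl⟩ := Finset.mem_image.1 hx
    exact (hl i).left_mem
  have h1 := h _ hB ⟨v 0, by simp⟩
  rw [edges_toMultGraph hE, Finset.card_image_of_injective _ hv, Finset.card_fin] at h1
  have h2 : (Set.range e).ncard ≤ (G.induce (Finset.univ.image v : Finset α)).edgeSet.ncard := by
    refine Set.ncard_le_ncard ?_ (hE.subset fun e ⟨x, y, he, _⟩ => he.edge_mem)
    rintro _ ⟨i, rfl⟩
    exact ⟨v i, v (i + 1), (hl i).1, by simp, by simp⟩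
  rw [← Set.image_univ, Set.ncard_image_of_injective _ he, Set.ncard_univ, Nat.card_fin] at h2
  omega

lemma componentSet_subset {M : Set α} {x : α} (hx : x ∈ M) :
    (G.induce M).componentSet x ⊆ M := fun y hy => by
  rcases Relation.ReflTransGen.cases_tail hy with rfl | ⟨z, -, hz⟩
  · exact hx
  · exact hz.right_mem

/-- A largest set containing `x` that is built up inside the component cannot be left by an edge. -/
lemma exists_conn_componentSet (hE : G.edgeSet.Finite) {M : Finset α} {x : α} (hx : x ∈ M) :
    ∃ C : Finset α, (C : Set α) = (G.induce M).componentSet x ∧ (G.toMultGraph hG).Conn C := by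
  classical
  obtain ⟨C, hC, hmax⟩ := Finset.exists_max_image
    (M.powerset.filter fun C : Finset α => (C : Set α) ⊆ (G.induce M).componentSet x ∧ x ∈ C ∧
      (G.toMultGraph hG).Conn C) Finset.card
    ⟨{x}, by simpa [hx] using ⟨Relation.ReflTransGen.refl, MultGraph.Conn.single x⟩⟩
  simp only [Finset.mem_filter, Finset.mem_powerset] at hC hmax
  refine ⟨C, subset_antisymm hC.2.1 fun y hy => ?_, hC.2.2.2⟩
  induction hy with
  | refl => exact hC.2.2.1
  | @tail u v hu huv ih =>
    by_contra hv
    obtain ⟨e, he⟩ := huv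
    have := hmax (insert v C) ⟨Finset.insert_subset he.2.2 hC.1, ?_, by simp [hC.2.2.1],
      hC.2.2.2.insert ih hv ((one_le_mult_toMultGraph hE).2 ⟨e, he.1.symm⟩)⟩
    · rw [Finset.card_insert_of_notMem hv] at this
      omega
    · rw [Finset.coe_insert]
      exact Set.insert_subset (hu.tail ⟨e, he⟩) hC.2.1

/-- A component is connected and acyclic, hence a subtree with |C| - 1 edges; with zero weights the
size condition is the bound D on its edges. -/
lemma hasEFFColoring_of_colorable (hG : G.Loopless) (hE : G.edgeSet.Finite) {D : ℕ}
    {Y : Finset α} (hY : (Y : Set α) = G.vertexSet)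
    (h : (G.toMultGraph hG).Colorable (fun _ => 0) D Y) : G.HasEFFColoring D := by
  obtain ⟨M, F, hc⟩ := h
  refine ⟨M, F, by rw [← hY, ← hc.union]; simp, by simpa using hc.disj,
    isForestGraph_induce hE fun B hB hne => (hc.small B hB hne).1, fun x hx => ?_,
    isForestGraph_induce hE hc.acyc⟩
  obtain ⟨C, hC, hconn⟩ := exists_conn_componentSet (hG := hG) hE (Finset.mem_coe.1 hx)
  have hCM : C ⊆ M := by
    rw [← Finset.coe_subset, hC]; exact componentSet_subset hx
  have hne : C.Nonempty := ⟨x, by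
    rw [← Finset.mem_coe, hC]; exact Relation.ReflTransGen.refl⟩
  have hs := hc.small C hCM hne
  have hcard := hconn.card_le
  have hD := hs.2 (by omega)
  rw [edges_toMultGraph hE] at hs
  have : ((G.induce M).induce C).edgeSet = (G.induce C).edgeSet := by
    ext e
    constructor
    · rintro ⟨y, z, h1, h2⟩; exact ⟨y, z, h1.1, h2⟩
    · rintro ⟨y, z, h1, h2⟩; exact ⟨y, z, ⟨h1, hCM h2.1, hCM h2.2⟩, h2⟩
  rw [← hC, this]
  simp at hD
  omega

end Graph

namespace MultGraph

theorem hasEFFColoring_of_isSparse {α β : Type*} (G : Graph α β) (hf : G.IsFiniteMultigraph)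
    {D : ℕ} {a b : ℝ} (ha : edgeCost D * a = 2 * edgeCost D - 1) (hb : edgeCost D * b = 1)
    (hs : G.IsSparse a b) : G.HasEFFColoring D := by
  classical
  obtain ⟨hV, hE⟩ := hf
  obtain ⟨hG, hs⟩ := hs
  refine Graph.hasEFFColoring_of_colorable hG hE hV.coe_toFinset
    (colorable_of_sparse _ _ _ _ (sparse_of_two_le fun A hA hA2 => ?_))
  have h1 := hs A (by simpa [← Finset.coe_subset] using hA) (by simpa using hA2)
  rw [Set.ncard_coe_finset] at h1
  have h2 : (G.toMultGraph hG).edges A = ((G.induce A).edgeSet.ncard : ℤ) :=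
    Graph.edges_toMultGraph hE A
  have hk : (0 : ℝ) ≤ edgeCost D := by exact_mod_cast (by have := edgeCost_pos D; omega)
  have h3 := mul_le_mul_of_nonneg_left h1 hk
  unfold pot
  simp only [weightCost_zero, Finset.sum_const, nsmul_eq_mul, h2]
  rify
  linear_combination h3 + A.card * ha + hb

end MultGraph

/-! ### Sharpness: gluing weighted gadgets. -/

namespace MultGraph

variable {V V' : Type*} [DecidableEq V] [DecidableEq V']

/-- Necessary conditions on the forest part of a coloring, which are preserved when passing to
subgraphs. -/
structure IsWeakCol (G : MultGraph V) (w : V → ℕ) (D : ℕ) (F : Set V) : Prop where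
  mult_le : ∀ x ∈ F, ∀ y ∈ F, G.mult x y ≤ 1
  triangle : ∀ x ∈ F, ∀ y ∈ F, ∀ z ∈ F, 1 ≤ G.mult x y → 1 ≤ G.mult y z → 1 ≤ G.mult z x → False
  small : ∀ A, G.Conn A → (∀ x ∈ A, x ∉ F) → ∑ x ∈ A, w x + A.card ≤ D + 1

lemma Conn.map {G : MultGraph V} {G' : MultGraph V'} (f : V ↪ V')
    (hf : ∀ x y, G'.mult (f x) (f y) = G.mult x y) {A : Finset V} (h : G.Conn A) :
    G'.Conn (A.map f) := by
  induction h with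
  | single x => rw [Finset.map_singleton]; exact .single _
  | insert hA hu hv hm ih =>
    rw [Finset.map_insert]
    exact ih.insert (Finset.mem_map_of_mem f hu) (by simpa using hv) (by rwa [hf])

/-- Restriction of a weak coloring, where the weight of one vertex may be increased by one if it is
attached to another vertex of the small part. -/
lemma IsWeakCol.comap {G : MultGraph V} {G' : MultGraph V'} {w : V → ℕ} {w' : V' → ℕ} {D : ℕ}
    {F : Set V'} (h : G'.IsWeakCol w' D F) (f : V ↪ V')
    (hf : ∀ x y, G'.mult (f x) (f y) = G.mult x y) (y : V)
    (hw : ∀ x, x ≠ y → w x ≤ w' (f x))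
    (hy : f y ∉ F → w y ≤ w' (f y) ∨
      (w y ≤ w' (f y) + 1 ∧ ∃ u, (∀ x, f x ≠ u) ∧ u ∉ F ∧ 1 ≤ G'.mult u (f y))) :
    G.IsWeakCol w D (f ⁻¹' F) where
  mult_le a ha b hb := by rw [← hf]; exact h.mult_le _ ha _ hb
  triangle a ha b hb c hc := by
    rw [← hf, ← hf, ← hf]; exact h.triangle _ ha _ hb _ hc
  small A hA hAF := by
    have hsum : ∀ B : Finset V, y ∉ B → ∑ x ∈ B, w x ≤ ∑ x ∈ B, w' (f x) := fun B hB =>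
      Finset.sum_le_sum fun x hx => hw x (by rintro rfl; exact hB hx)
    have h1 := h.small _ (hA.map f hf) (by simpa using hAF)
    rw [Finset.sum_map, Finset.card_map] at h1
    by_cases hyA : y ∈ A
    · rw [← Finset.add_sum_erase _ _ hyA] at h1 ⊢
      have h3 := hsum (A.erase y) (Finset.notMem_erase _ _)
      rcases hy (hAF y hyA) with h2 | ⟨h2, u, hu, huF, hum⟩
      · omega
      · have huA : u ∉ A.map f := by simpa using fun x _ => hu x
        have h4 := h.small _ ((hA.map f hf).insert (Finset.mem_map_of_mem f hyA) huA hum)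
          (by simpa [huF] using hAF)
        rw [Finset.sum_insert huA, Finset.card_insert_of_notMem huA, Finset.sum_map,
          Finset.card_map, ← Finset.add_sum_erase _ _ hyA] at h4
        omega
    · have := hsum A hyA
      omega

/-- The disjoint union of two multigraphs together with `t x y` edges from `x` to `y`. -/
def glue (G : MultGraph V) (G' : MultGraph V') (t : V → V' → ℕ) : MultGraph (V ⊕ V') where
  mult
    | .inl x, .inl y => G.mult x y
    | .inl x, .inr y => t x y
    | .inr x, .inl y => t y x
    | .inr x, .inr y => G'.mult x y
  symm := by rintro (x | x) (y | y) <;> simp [G.symm, G'.symm]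
  irrefl := by rintro (x | x) <;> simp [G.irrefl, G'.irrefl]

@[simp] lemma glue_inl_inl (G : MultGraph V) (G' : MultGraph V') (t : V → V' → ℕ) (x y : V) :
    (G.glue G' t).mult (.inl x) (.inl y) = G.mult x y := rfl

@[simp] lemma glue_inl_inr (G : MultGraph V) (G' : MultGraph V') (t : V → V' → ℕ) (x : V)
    (y : V') : (G.glue G' t).mult (.inl x) (.inr y) = t x y := rfl

@[simp] lemma glue_inr_inl (G : MultGraph V) (G' : MultGraph V') (t : V → V' → ℕ) (x : V')
    (y : V) : (G.glue G' t).mult (.inr x) (.inl y) = t y x := rfl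

@[simp] lemma glue_inr_inr (G : MultGraph V) (G' : MultGraph V') (t : V → V' → ℕ) (x y : V') :
    (G.glue G' t).mult (.inr x) (.inr y) = G'.mult x y := rfl

/-- The potential with linear vertex costs. -/
def linPot (k : ℤ) (G : MultGraph V) (w : V → ℕ) (A : Finset V) : ℤ :=
  ∑ x ∈ A, (2 * k - 1 - 2 * (w x : ℤ)) - k * G.edges A

lemma edges_glue (G : MultGraph V) (G' : MultGraph V') (t : V → V' → ℕ) (A : Finset V)
    (B : Finset V') : (G.glue G' t).edges (A.disjSum B) =
      G.edges A + G'.edges B + ∑ x ∈ A, ∑ y ∈ B, (t x y : ℤ) := by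
  have h1 := (G.glue G' t).two_mul_edges (A.disjSum B)
  have h2 := G.two_mul_edges A
  have h3 := G'.two_mul_edges B
  have h4 : ∑ y ∈ B, ∑ x ∈ A, (t x y : ℤ) = ∑ x ∈ A, ∑ y ∈ B, (t x y : ℤ) := Finset.sum_comm
  unfold cross degIn at h1 h2 h3
  simp only [Finset.sum_disjSum, glue_inl_inl, glue_inl_inr, glue_inr_inl, glue_inr_inr,
    Finset.sum_add_distrib] at h1
  rw [h4] at h1
  omega

lemma linPot_glue (k : ℤ) (G : MultGraph V) (G' : MultGraph V') (t : V → V' → ℕ) (w : V → ℕ)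
    (w' : V' → ℕ) (A : Finset V) (B : Finset V') :
    linPot k (G.glue G' t) (Sum.elim w w') (A.disjSum B) =
      linPot k G w A + linPot k G' w' B - k * ∑ x ∈ A, ∑ y ∈ B, (t x y : ℤ) := by
  unfold linPot
  rw [edges_glue, Finset.sum_disjSum]
  simp only [Sum.elim_inl, Sum.elim_inr]
  ring

lemma linPot_sub_single (k : ℤ) (G : MultGraph V) {w : V → ℕ} {y : V} (hy : 1 ≤ w y)
    (A : Finset V) :
    linPot k G (Function.update w y (w y - 1)) A = linPot k G w A + if y ∈ A then 2 else 0 := by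
  unfold linPot
  have : ∀ x ∈ A, 2 * k - 1 - 2 * (Function.update w y (w y - 1) x : ℤ) =
      2 * k - 1 - 2 * (w x : ℤ) + if x = y then 2 else 0 := fun x _ => by
    by_cases hx : x = y
    · subst hx; simp; omega
    · simp [hx]
  rw [Finset.sum_congr rfl this, Finset.sum_add_distrib, Finset.sum_ite_eq' A y]
  ring

variable [Fintype V] [Fintype V']

/-- A weighted multigraph that just fails to be sparse and has no coloring. -/
structure IsTight (k : ℤ) (D : ℕ) (G : MultGraph V) (w : V → ℕ) : Prop where
  not_weakCol : ∀ F, ¬ G.IsWeakCol w D F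
  pot_univ : linPot k G w Finset.univ = -2
  pot_ge : ∀ A, A ≠ Finset.univ → -1 ≤ linPot k G w A

/-- A weighted multigraph of small potential in which `z` belongs to the small part of every
coloring. -/
structure IsForcing (k : ℤ) (D : ℕ) (G : MultGraph V) (w : V → ℕ) (z : V) : Prop where
  notMem : ∀ F, G.IsWeakCol w D F → z ∉ F
  pot_univ : linPot k G w Finset.univ = k - 2
  pot_nonneg : ∀ A, 0 ≤ linPot k G w A
  pot_ge : ∀ A, z ∈ A → A ≠ Finset.univ → k - 1 ≤ linPot k G w A

section join

variable {k : ℤ} {D : ℕ} {G : MultGraph V} {G' : MultGraph V'} {w : V → ℕ} {w' : V' → ℕ}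

/-- The disjoint union of two multigraphs together with an edge joining `z` and `y`. -/
def join (G : MultGraph V) (G' : MultGraph V') (z : V) (y : V') : MultGraph (V ⊕ V') :=
  G.glue G' fun a b => if a = z ∧ b = y then 1 else 0

lemma linPot_join (z : V) {y : V'} (hy : 1 ≤ w' y) (A : Finset V) (B : Finset V') :
    linPot k (G.join G' z y) (Sum.elim w (Function.update w' y (w' y - 1))) (A.disjSum B) =
      linPot k G w A + linPot k G' w' B + (if y ∈ B then 2 else 0) -
        (if z ∈ A ∧ y ∈ B then k else 0) := by
  have : ∑ a ∈ A, ∑ b ∈ B, ((if a = z ∧ b = y then 1 else 0 : ℕ) : ℤ) =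
      if z ∈ A ∧ y ∈ B then 1 else 0 := by
    simp only [ite_and, apply_ite (Nat.cast : ℕ → ℤ), Nat.cast_one, Nat.cast_zero]
    simp only [← ite_and]
    simp only [ite_and]
    split_ifs <;> simp_all
  unfold join
  rw [linPot_glue, linPot_sub_single k G' hy, this]
  split_ifs <;> ring

/-- Since `z` always lies in the small part, its edge to `y` uses one unit of the budget of any
small component through `y`. This replaces the unit of weight removed from `y`. -/
lemma IsForcing.weakCol_right (hG : G.IsForcing k D w z) {y : V'} (hy : 1 ≤ w' y) {F : Set (V ⊕ V')}
    (hF : (G.join G' z y).IsWeakCol (Sum.elim w (Function.update w' y (w' y - 1))) D F) :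
    G'.IsWeakCol w' D (Function.Embedding.inr ⁻¹' F) := by
  have hz : Sum.inl z ∉ F := hG.notMem _
    (hF.comap (G := G) (w := w) Function.Embedding.inl (fun _ _ => rfl) z (by simp) (by simp))
  refine hF.comap Function.Embedding.inr (fun _ _ => rfl) y (fun x hx => by simp [hx])
    fun _ => Or.inr ⟨by simp; omega, Sum.inl z, by simp, hz, ?_⟩
  simp [join]

lemma disjSum_toLeft_toRight_ne {A : Finset (V ⊕ V')} (hA : A ≠ Finset.univ) :
    A.toLeft = Finset.univ → A.toRight = Finset.univ → False := fun h1 h2 => hA <| by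
  rw [← Finset.toLeft_disjSum_toRight (u := A), h1, h2]; exact Finset.univ_disjSum_univ

/-- The forcing gadget contributes k-2, the lost unit of weight 2, and the new edge -k, so the total
potential is unchanged. The bound k-1 for proper subsets through `z` prevents smaller sets from
profiting from the edge. -/
lemma IsForcing.join_isForcing {z : V} {y z' : V'} (hG : G.IsForcing k D w z)
    (hG' : G'.IsForcing k D w' z') (hy : 1 ≤ w' y) :
    (G.join G' z y).IsForcing k D (Sum.elim w (Function.update w' y (w' y - 1))) (Sum.inr z') where
  notMem F hF := hG'.notMem _ (hG.weakCol_right hy hF)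
  pot_univ := by
    rw [← Finset.univ_disjSum_univ, linPot_join z hy, hG.pot_univ, hG'.pot_univ]
    simp; ring
  pot_nonneg A := by
    rw [← Finset.toLeft_disjSum_toRight (u := A), linPot_join z hy]
    have h1 := hG.pot_nonneg A.toLeft
    have h2 := hG'.pot_nonneg A.toRight
    have h3 := hG.pot_ge A.toLeft
    have h4 := hG.pot_univ
    by_cases hl : A.toLeft = Finset.univ
    · have h6 := hG.pot_nonneg Finset.univ
      rw [hl, h4]
      simp only [Finset.mem_univ, true_and]
      split_ifs <;> omega
    · split_ifs with e1 e2 e2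
      · have := h3 e2.1 hl; omega
      · omega
      · exact absurd e2.2 e1
      · omega
  pot_ge A hz hA := by
    rw [← Finset.toLeft_disjSum_toRight (u := A), linPot_join z hy]
    have h1 := hG.pot_nonneg A.toLeft
    have h2 := hG'.pot_ge A.toRight (by simpa using hz)
    have h3 := hG.pot_ge A.toLeft
    have h4 := hG.pot_univ
    have h5 := hG'.pot_univ
    have hne := disjSum_toLeft_toRight_ne hA
    by_cases hl : A.toLeft = Finset.univ
    · have := h2 (hne hl)
      have h6 := hG.pot_nonneg Finset.univ
      rw [hl, h4]
      simp only [Finset.mem_univ, true_and]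
      split_ifs <;> omega
    · by_cases hr : A.toRight = Finset.univ
      · rw [hr, h5]
        simp only [Finset.mem_univ, if_true, and_true]
        split_ifs with e
        · have := h3 e hl; omega
        · omega
      · have := h2 hr
        split_ifs with e1 e2 e2
        · have := h3 e2.1 hl; omega
        · omega
        · exact absurd e2.2 e1
        · omega

lemma IsForcing.join_isTight {z : V} {y : V'} (hG : G.IsForcing k D w z)
    (hG' : G'.IsTight k D w') (hy : 1 ≤ w' y) :
    (G.join G' z y).IsTight k D (Sum.elim w (Function.update w' y (w' y - 1))) where
  not_weakCol F hF := hG'.not_weakCol _ (hG.weakCol_right hy hF)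
  pot_univ := by
    rw [← Finset.univ_disjSum_univ, linPot_join z hy, hG.pot_univ, hG'.pot_univ]
    simp
  pot_ge A hA := by
    rw [← Finset.toLeft_disjSum_toRight (u := A), linPot_join z hy]
    have h1 := hG.pot_nonneg A.toLeft
    have h2 := hG'.pot_ge A.toRight
    have h3 := hG.pot_ge A.toLeft
    have h4 := hG.pot_univ
    have h5 := hG'.pot_univ
    have hne := disjSum_toLeft_toRight_ne hA
    by_cases hl : A.toLeft = Finset.univ
    · have := h2 (hne hl)
      have h6 := hG.pot_nonneg Finset.univ
      rw [hl, h4]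
      simp only [Finset.mem_univ, true_and]
      split_ifs <;> omega
    · by_cases hr : A.toRight = Finset.univ
      · rw [hr, h5]
        simp only [Finset.mem_univ, if_true, and_true]
        split_ifs with e
        · have := h3 e hl; omega
        · omega
      · have := h2 hr
        split_ifs with e1 e2 e2
        · have := h3 e2.1 hl; omega
        · omega
        · exact absurd e2.2 e1
        · omega

end join

/-- Two vertices joined by two edges. -/
def doubleEdge : MultGraph Bool where
  mult x y := if x = y then 0 else 2
  symm x y := by simp [eq_comm]
  irrefl x := by simp

lemma finset_bool_cases (A : Finset Bool) :
    A = ∅ ∨ A = {true} ∨ A = {false} ∨ A = {true, false} := by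
  revert A; decide

lemma linPot_doubleEdge (k : ℤ) (w : Bool → ℕ) (A : Finset Bool) :
    linPot k doubleEdge w A = (if true ∈ A then 2 * k - 1 - 2 * (w true : ℤ) else 0) +
      (if false ∈ A then 2 * k - 1 - 2 * (w false : ℤ) else 0) -
      if true ∈ A ∧ false ∈ A then 2 * k else 0 := by
  rcases finset_bool_cases A with rfl | rfl | rfl | rfl
  · simp [linPot]
  · simp [linPot]
  · simp [linPot]
  · rw [linPot, edges_insert _ (by simp)]
    simp [doubleEdge]; ring

/-- Two new vertices, joined by two edges, and adjacent to `y`. -/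
def attach (G : MultGraph V) (y : V) : MultGraph (V ⊕ Bool) :=
  G.glue doubleEdge fun x _ => if x = y then 1 else 0

/-- The two new vertices cannot both lie in F, so one of them is in M and acts as a unit of weight
at `y`. The balance is 2(2k-1) - 2k - 2k + 2 = 0. -/
lemma IsTight.attach {k : ℤ} {D : ℕ} {G : MultGraph V} {w : V → ℕ} (hk : 2 ≤ k)
    (h : G.IsTight k D w) {y : V} (hy : 1 ≤ w y) :
    (G.attach y).IsTight k D (Sum.elim (Function.update w y (w y - 1)) fun _ => 0) := by
  have hpot : ∀ A B, linPot k (G.attach y) (Sum.elim (Function.update w y (w y - 1)) fun _ => 0)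
      (A.disjSum B) = linPot k G w A + (if y ∈ A then 2 - k * B.card else 0) +
        linPot k doubleEdge (fun _ => 0) B := fun A B => by
    unfold MultGraph.attach
    rw [linPot_glue, linPot_sub_single k G hy]
    have : ∑ a ∈ A, ∑ _b ∈ B, ((if a = y then 1 else 0 : ℕ) : ℤ) =
        if y ∈ A then (B.card : ℤ) else 0 := by
      simp
    rw [this]
    split_ifs <;> ring
  refine ⟨fun F hF => ?_, ?_, fun A hA => ?_⟩
  · refine h.not_weakCol _ (hF.comap (G := G) (w := w) Function.Embedding.inl (fun _ _ => rfl) y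
      (fun x hx => by simp [hx]) fun hyF => Or.inr ⟨by simp; omega, ?_⟩)
    by_contra! hc
    have h1 : ∀ b, Sum.inr b ∈ F := fun b => by
      by_contra hb
      have := hc (Sum.inr b) (by simp) hb
      simp [MultGraph.attach] at this
    have h2 := hF.mult_le _ (h1 true) _ (h1 false)
    simp [MultGraph.attach, doubleEdge] at h2
  · rw [← Finset.univ_disjSum_univ, hpot, h.pot_univ, linPot_doubleEdge]
    simp; ring
  · rw [← Finset.toLeft_disjSum_toRight (u := A), hpot, linPot_doubleEdge]
    have h1 := h.pot_ge A.toLeft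
    have h2 := h.pot_univ
    have hne := disjSum_toLeft_toRight_ne hA
    by_cases hl : A.toLeft = Finset.univ
    · rw [hl, h2]
      rcases finset_bool_cases A.toRight with e | e | e | e
      · simp [e]
      · simp [e]; omega
      · simp [e]; omega
      · exact (hne hl (by rw [e]; rfl)).elim
    · have h3 := h1 hl
      by_cases hyA : y ∈ A.toLeft <;>
        rcases finset_bool_cases A.toRight with e | e | e | e <;> simp [e, hyA] <;> omega

section existence

variable {k : ℤ} {D : ℕ}

/-- Forcing gadgets can be made arbitrarily large. -/
lemma exists_isForcing {U : Type} [DecidableEq U] [Fintype U] {H : MultGraph U} {u : U → ℕ}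
    {y z : U} (hH : H.IsForcing k D u z) (hy : 1 ≤ u y) (N : ℕ) :
    ∃ (V : Type) (_ : DecidableEq V) (_ : Fintype V) (G : MultGraph V) (w : V → ℕ) (x : V),
      G.IsForcing k D w x ∧ N ≤ Fintype.card V := by
  induction N with
  | zero => exact ⟨U, _, _, H, u, z, hH, Nat.zero_le _⟩
  | succ N ih =>
    obtain ⟨V, _, _, G, w, x, hG, hN⟩ := ih
    refine ⟨V ⊕ U, _, _, _, _, _, hG.join_isForcing hH hy, ?_⟩
    have : 0 < Fintype.card U := Fintype.card_pos_iff.2 ⟨y⟩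
    rw [Fintype.card_sum]; omega

/-- All vertex weights of a tight multigraph can be replaced by attached pairs of vertices. -/
lemma IsTight.exists_weight_zero (hk : 2 ≤ k) {V : Type} [DecidableEq V] [Fintype V]
    {G : MultGraph V} {w : V → ℕ} (h : G.IsTight k D w) :
    ∃ (V' : Type) (_ : DecidableEq V') (_ : Fintype V') (G' : MultGraph V'),
      G'.IsTight k D (fun _ => 0) ∧ Fintype.card V ≤ Fintype.card V' := by
  induction hn : ∑ x, w x generalizing V with
  | zero =>
    have : w = fun _ => 0 := funext fun x => by
      have := (Finset.sum_eq_zero_iff.1 hn) x (Finset.mem_univ x)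
      exact this
    exact ⟨V, _, _, G, this ▸ h, le_rfl⟩
  | succ n ih =>
    obtain ⟨y, -, hy⟩ := Finset.exists_ne_zero_of_sum_ne_zero (by omega : ∑ x, w x ≠ 0)
    have hy1 : 1 ≤ w y := by omega
    obtain ⟨V', i1, i2, G', h', hc⟩ := ih (h.attach hk hy1) (by
      rw [Fintype.sum_sum_type]
      simp only [Sum.elim_inl, Sum.elim_inr, Finset.sum_const_zero, add_zero]
      rw [Finset.sum_update_of_mem (Finset.mem_univ y)]
      rw [← Finset.add_sum_erase _ _ (Finset.mem_univ y)] at hn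
      rw [Finset.sdiff_singleton_eq_erase]
      omega)
    exact ⟨V', i1, i2, G', h', le_trans (by rw [Fintype.card_sum]; omega) hc⟩

/-- A long chain of forcing gadgets supplies the size, a tight gadget at its end destroys
colorability, and attached pairs then remove all weights. -/
lemma exists_isTight (hk : 2 ≤ k) {U K : Type} [DecidableEq U] [Fintype U] [DecidableEq K]
    [Fintype K] {H : MultGraph U} {u : U → ℕ} {y z : U} (hH : H.IsForcing k D u z) (hy : 1 ≤ u y)
    {H' : MultGraph K} {u' : K → ℕ} {y' : K} (hH' : H'.IsTight k D u') (hy' : 1 ≤ u' y') (N : ℕ) :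
    ∃ (V : Type) (_ : DecidableEq V) (_ : Fintype V) (G : MultGraph V),
      G.IsTight k D (fun _ => 0) ∧ N ≤ Fintype.card V := by
  obtain ⟨V, _, _, G, w, x, hG, hN⟩ := exists_isForcing hH hy N
  obtain ⟨V', i1, i2, G', h', hc⟩ := (hG.join_isTight hH' hy').exists_weight_zero hk
  refine ⟨V', i1, i2, G', h', hN.trans (le_trans ?_ hc)⟩
  rw [Fintype.card_sum]; omega

end existence

/-! ### Sharpness: initial gadgets for odd D. -/

section odd

variable {D : ℕ}

lemma conn_pair {G : MultGraph V} {x y : V} (hxy : x ≠ y) (h : 1 ≤ G.mult x y) :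
    G.Conn {x, y} :=
  (Conn.single y).insert (Finset.mem_singleton_self y) (by simpa using hxy) h

lemma isForcing_doubleEdge :
    doubleEdge.IsForcing (2 * D + 2) D (fun b => if b then D + 1 else 0) false where
  notMem F hF hz := by
    have h1 : true ∈ F := by
      by_contra h
      have := hF.small _ (.single true) (by simpa using h)
      simp at this
    have := hF.mult_le _ h1 _ hz
    simp [doubleEdge] at this
  pot_univ := by rw [linPot_doubleEdge]; simp; ring
  pot_nonneg A := by rw [linPot_doubleEdge]; split_ifs <;> simp_all <;> omega
  pot_ge A hA hne := by
    rcases finset_bool_cases A with rfl | rfl | rfl | rfl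
    · simp at hA
    · simp at hA
    · rw [linPot_doubleEdge]; simp; omega
    · exact (hne rfl).elim

lemma isTight_doubleEdge : doubleEdge.IsTight (2 * D + 2) D (fun _ => D + 1) where
  not_weakCol F hF := by
    have h1 : ∀ b, b ∈ F := fun b => by
      by_contra h
      have := hF.small _ (.single b) (by simpa using h)
      simp at this
    have := hF.mult_le _ (h1 true) _ (h1 false)
    simp [doubleEdge] at this
  pot_univ := by rw [linPot_doubleEdge]; simp; ring
  pot_ge A hne := by
    rcases finset_bool_cases A with rfl | rfl | rfl | rfl
    · simp [linPot]
    · rw [linPot_doubleEdge]; simp; omega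
    · rw [linPot_doubleEdge]; simp; omega
    · exact (hne rfl).elim

end odd

/-! ### Sharpness: initial gadgets for even D = 2h. -/

section even

variable {h : ℕ}

/-- The complete graph on four vertices. -/
def completeFour : MultGraph (Fin 4) where
  mult x y := if x = y then 0 else 1
  symm x y := by simp [eq_comm]
  irrefl x := by simp

/-- A complete graph on four vertices; a vertex `4` adjacent to one of them; and a vertex `5`
joined to `4` by two edges. -/
def kite : MultGraph (Fin 6) where
  mult := ![![0, 1, 1, 1, 0, 0], ![1, 0, 1, 1, 0, 0], ![1, 1, 0, 1, 0, 0], ![1, 1, 1, 0, 1, 0],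
    ![0, 0, 0, 1, 0, 2], ![0, 0, 0, 0, 2, 0]]
  symm := by decide
  irrefl := by decide

/-- With indicator functions, deciding membership of each vertex turns the finite checks below into
linear arithmetic in h. -/
lemma two_mul_linPot (k : ℤ) (G : MultGraph V) (w : V → ℕ) (A : Finset V) :
    2 * linPot k G w A = 2 * (∑ x, (if x ∈ A then 1 else 0) * (2 * k - 1 - 2 * (w x : ℤ))) -
      k * ∑ x, ∑ y, (if x ∈ A then 1 else 0) * ((if y ∈ A then 1 else 0) * (G.mult x y : ℤ)) := by
  have h1 := G.two_mul_edges A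
  have h2 : ∀ f : V → ℤ, ∑ x, (if x ∈ A then 1 else 0) * f x = ∑ x ∈ A, f x := fun f => by
    simp
  unfold cross degIn at h1
  simp only [← Finset.mul_sum, h2]
  rw [← h1, linPot]
  ring

lemma linPot_completeFour (h : ℕ) (A : Finset (Fin 4)) :
    (A = Finset.univ → linPot (4 * h + 1) completeFour (fun _ => h) A = -2) ∧
      (-1 ≤ linPot (4 * h + 1) completeFour (fun _ => h) A ∨ A = Finset.univ) := by
  have h1 := two_mul_linPot (4 * h + 1) completeFour (fun _ => h) A
  have h2 : A = Finset.univ ↔ 0 ∈ A ∧ 1 ∈ A ∧ 2 ∈ A ∧ 3 ∈ A := by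
    simp [Finset.ext_iff, Fin.forall_fin_succ]
  rw [h2]
  generalize linPot (4 * h + 1) completeFour (fun _ => h) A = P at h1 ⊢
  simp only [Fin.sum_univ_four] at h1
  simp [completeFour] at h1
  by_cases e0 : 0 ∈ A <;> by_cases e1 : 1 ∈ A <;> by_cases e2 : 2 ∈ A <;> by_cases e3 : 3 ∈ A <;>
    simp only [e0, e1, e2, e3, true_and, and_true, and_false, or_true, or_false, true_imp_iff, false_imp_iff,
      if_true, if_false] at h1 ⊢ <;> omega

/-- Two vertices in the small part would have total 2h+2 > D+1, so at most one lies there and the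
other three form a triangle in F. -/
lemma isTight_completeFour : completeFour.IsTight (4 * h + 1) (2 * h) (fun _ => h) where
  pot_univ := (linPot_completeFour h _).1 rfl
  pot_ge A hA := (linPot_completeFour h A).2.resolve_right hA
  not_weakCol F hF := by
    have h1 : ∀ x y : Fin 4, x ≠ y → x ∈ F ∨ y ∈ F := fun x y hxy => by
      by_contra! hc
      have := hF.small _ (conn_pair hxy (by simp [completeFour, hxy])) (by simpa using hc)
      rw [Finset.sum_pair hxy, Finset.card_pair hxy] at this
      omega
    have h2 : ∀ x y z : Fin 4, x ≠ y → y ≠ z → z ≠ x → x ∈ F → y ∈ F → z ∈ F → False :=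
      fun x y z hxy hyz hzx hx hy hz => hF.triangle x hx y hy z hz (by simp [completeFour, hxy])
        (by simp [completeFour, hyz]) (by simp [completeFour, hzx])
    have a1 := h1 0 1 (by decide)
    have a2 := h1 0 2 (by decide)
    have a3 := h1 0 3 (by decide)
    have a4 := h1 1 2 (by decide)
    have a5 := h1 1 3 (by decide)
    have a6 := h1 2 3 (by decide)
    have b1 := h2 0 1 2 (by decide) (by decide) (by decide)
    have b2 := h2 0 1 3 (by decide) (by decide) (by decide)
    have b3 := h2 0 2 3 (by decide) (by decide) (by decide)
    have b4 := h2 1 2 3 (by decide) (by decide) (by decide)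
    tauto

lemma one_le_mult_kite : ∀ x y : Fin 6, x < 4 → y < 4 → x ≠ y → 1 ≤ kite.mult x y := by decide

lemma linPot_kite (hh : 1 ≤ h) (A : Finset (Fin 6)) :
    (A = Finset.univ → linPot (4 * h + 1) kite ![h, h, h, 0, h - 1, 0] A = 4 * h - 1) ∧
      0 ≤ linPot (4 * h + 1) kite ![h, h, h, 0, h - 1, 0] A ∧
      (5 ∈ A → 4 * h ≤ linPot (4 * h + 1) kite ![h, h, h, 0, h - 1, 0] A ∨ A = Finset.univ) := by
  have h1 := two_mul_linPot (4 * h + 1) kite ![h, h, h, 0, h - 1, 0] A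
  have h2 : A = Finset.univ ↔ 0 ∈ A ∧ 1 ∈ A ∧ 2 ∈ A ∧ 3 ∈ A ∧ 4 ∈ A ∧ 5 ∈ A := by
    simp [Finset.ext_iff, Fin.forall_fin_succ]
  rw [h2]
  generalize linPot (4 * h + 1) kite ![h, h, h, 0, h - 1, 0] A = P at h1 ⊢
  simp only [Fin.sum_univ_six] at h1
  simp [kite] at h1
  by_cases e0 : 0 ∈ A <;> by_cases e1 : 1 ∈ A <;> by_cases e2 : 2 ∈ A <;> by_cases e3 : 3 ∈ A <;>
    by_cases e4 : 4 ∈ A <;> by_cases e5 : 5 ∈ A <;>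
    simp only [e0, e1, e2, e3, e4, e5, true_and, and_true, and_false, or_true, or_false, true_imp_iff, false_imp_iff,
      if_true, if_false] at h1 ⊢ <;> omega

/-- If 5 is in F, the double edge puts 4 in M. At most one of 0, 1, 2 is in M, and if one is, then 3
is in F, because with 3 and 4 it would have total h + 0 + (h-1) + 3 = 2h+2 > D+1. Either way F
contains a triangle. -/
lemma isForcing_kite (hh : 1 ≤ h) :
    kite.IsForcing (4 * h + 1) (2 * h) ![h, h, h, 0, h - 1, 0] 5 where
  pot_univ := by rw [(linPot_kite hh _).1 rfl]; ring
  pot_nonneg A := (linPot_kite hh A).2.1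
  pot_ge A hA hne := by have := ((linPot_kite hh A).2.2 hA).resolve_right hne; omega
  notMem F hF h5 := by
    have h4 : 4 ∉ F := fun h4 => by
      have := hF.mult_le 4 h4 5 h5
      simp [kite] at this
    have e : ∀ x : Fin 6, x < 3 → ![h, h, h, 0, h - 1, 0] x = h := fun x hx => by
      fin_cases x <;> simp_all
    have h1 : ∀ x y : Fin 6, x < 3 → y < 3 → x ≠ y → x ∈ F ∨ y ∈ F := fun x y hx hy hxy => by
      by_contra! hc
      have := hF.small _ (conn_pair hxy (one_le_mult_kite x y (by omega) (by omega) hxy))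
        (by simpa using hc)
      rw [Finset.sum_pair hxy, Finset.card_pair hxy, e x hx, e y hy] at this
      omega
    have h2 : ∀ x y z : Fin 6, x < y → y < z → z < 4 → x ∈ F → y ∈ F → z ∈ F → False :=
      fun x y z hxy hyz hz hx hy hz' => hF.triangle x hx y hy z hz'
        (one_le_mult_kite _ _ (by omega) (by omega) (by omega))
        (one_le_mult_kite _ _ (by omega) (by omega) (by omega))
        (one_le_mult_kite _ _ (by omega) (by omega) (by omega))
    have h3 : ∀ x : Fin 6, x < 3 → x ∉ F → 3 ∈ F := fun x hx hxF => by
      by_contra h3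
      have hx3 : x ∉ ({3, 4} : Finset (Fin 6)) := by simp; omega
      have := hF.small _ ((conn_pair (G := kite) (x := 3) (y := 4) (by decide) (by decide)).insert
        (u := 3) (v := x) (by simp) hx3 (one_le_mult_kite _ _ (by omega) (by decide) (by omega)))
        (by simp [hxF, h3, h4])
      rw [Finset.sum_insert hx3, Finset.card_insert_of_notMem hx3, Finset.sum_pair (by decide),
        Finset.card_pair (by decide), e x hx] at this
      simp at this
      omega
    have a1 := h1 0 1 (by decide) (by decide) (by decide)
    have a2 := h1 0 2 (by decide) (by decide) (by decide)
    have a3 := h1 1 2 (by decide) (by decide) (by decide)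
    have b1 := h2 0 1 2 (by decide) (by decide) (by decide)
    have b2 := h2 0 1 3 (by decide) (by decide) (by decide)
    have b3 := h2 0 2 3 (by decide) (by decide) (by decide)
    have b4 := h2 1 2 3 (by decide) (by decide) (by decide)
    have c1 := h3 0 (by decide)
    have c2 := h3 1 (by decide)
    have c3 := h3 2 (by decide)
    by_cases f0 : 0 ∈ F
    · by_cases f1 : 1 ∈ F
      · by_cases f2 : 2 ∈ F
        · exact b1 f0 f1 f2
        · exact b2 f0 f1 (c3 f2)
      · exact b3 f0 (a3.resolve_left f1) (c2 f1)
    · exact b4 (a1.resolve_left f0) (a2.resolve_left f0) (c1 f0)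

end even

end MultGraph

/-! ### Sharpness: transfer to `Graph` and conclusion. -/

namespace MultGraph

/-- The multigraph in Mathlib's sense with the given edge multiplicities. -/
def toGraph {V : Type*} (G : MultGraph V) : Graph V (Sym2 V × ℕ) where
  vertexSet := Set.univ
  IsLink e x y := e.1 = s(x, y) ∧ e.2 < G.mult x y
  isLink_symm e _ := ⟨fun x y h => ⟨by rw [h.1, Sym2.eq_swap], by rw [G.symm]; exact h.2⟩⟩
  eq_or_eq_of_isLink_of_isLink e x y v w h h' := by
    have := h.1.symm.trans h'.1
    rw [Sym2.eq_iff] at this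
    tauto
  left_mem_of_isLink := fun _ _ _ _ => Set.mem_univ _

variable {V : Type*} (G : MultGraph V)

lemma loopless_toGraph : G.toGraph.Loopless where
  not_isLoopAt e x h := by
    have := h.2
    rw [G.irrefl] at this
    omega

lemma ext_mult {V : Type*} {G H : MultGraph V} (h : G.mult = H.mult) : G = H := by
  cases G; cases H; cases h; rfl

lemma toMultGraph_toGraph : G.toGraph.toMultGraph G.loopless_toGraph = G := by
  have h : ∀ x y, {e : Sym2 V × ℕ | G.toGraph.IsLink e x y}.ncard = G.mult x y := fun x y => by
    have : {e : Sym2 V × ℕ | G.toGraph.IsLink e x y} = Prod.mk s(x, y) '' Set.Iio (G.mult x y) := by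
      ext ⟨s, i⟩
      simp only [Set.mem_ofPred_eq, Set.mem_image, Set.mem_Iio, Prod.mk.injEq]
      exact ⟨fun h => ⟨i, h.2, h.1.symm, rfl⟩, fun ⟨j, hj, h1, h2⟩ => ⟨h1.symm, h2 ▸ hj⟩⟩
    rw [this, Set.ncard_image_of_injective _ (Prod.mk_right_injective _), Set.ncard_Iio_nat]
  exact ext_mult (funext fun x => funext fun y => h x y)

lemma finite_toGraph [Fintype V] : G.toGraph.IsFiniteMultigraph := by
  refine ⟨Set.toFinite _, ((Set.finite_univ (α := Sym2 V)).prod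
    (Set.finite_Iio (∑ x, ∑ y, G.mult x y))).subset ?_⟩
  rintro ⟨s, i⟩ ⟨x, y, -, h⟩
  refine ⟨Set.mem_univ _, lt_of_lt_of_le h ?_⟩
  exact (Finset.single_le_sum (f := fun y => G.mult x y) (fun _ _ => Nat.zero_le _)
    (Finset.mem_univ y)).trans (Finset.single_le_sum (f := fun x => ∑ y, G.mult x y)
      (fun _ _ => Nat.zero_le _) (Finset.mem_univ x))

variable [DecidableEq V] [Fintype V]

lemma ncard_edgeSet_induce_toGraph (A : Finset V) :
    ((G.toGraph.induce A).edgeSet.ncard : ℤ) = G.edges A := by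
  rw [← Graph.edges_toMultGraph (hG := G.loopless_toGraph) G.finite_toGraph.2,
    toMultGraph_toGraph]

variable {G}

lemma Conn.exists_reflTransGen {A : Finset V} (h : G.Conn A) {M : Set V} (hM : ↑A ⊆ M) :
    ∃ x ∈ A, ↑A ⊆ (G.toGraph.induce M).componentSet x := by
  induction h with
  | single x =>
    refine ⟨x, by simp, ?_⟩
    rw [Finset.coe_singleton, Set.singleton_subset_iff]
    exact Relation.ReflTransGen.refl
  | @insert A u v hA hu hv hm ih =>
    rw [Finset.coe_insert, Set.insert_subset_iff] at hM
    obtain ⟨x, hx, hr⟩ := ih hM.2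
    refine ⟨x, Finset.mem_insert_of_mem hx, ?_⟩
    rw [Finset.coe_insert]
    refine Set.insert_subset (Relation.ReflTransGen.tail (hr hu) ⟨(s(u, v), 0), ?_⟩) hr
    exact ⟨⟨rfl, by rw [G.symm]; exact hm⟩, hM.2 hu, hM.1⟩

lemma isWeakCol_of_isEFFColoring {D : ℕ} {M F : Set V} (h : G.toGraph.IsEFFColoring D M F) :
    G.IsWeakCol (fun _ => 0) D F := by
  obtain ⟨hMF, -, -, hD, hF⟩ := h
  refine ⟨fun x hx y hy => ?_, fun x hx y hy z hz h1 h2 h3 => ?_, fun A hA hAF => ?_⟩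
  · by_contra! hlt
    have hxy : x ≠ y := by rintro rfl; rw [G.irrefl] at hlt; omega
    refine hF 1 ⟨![x, y], ![(s(x, y), 0), (s(x, y), 1)], ?_, ?_, ?_⟩
    · intro i j; fin_cases i <;> fin_cases j <;> simp [hxy, hxy.symm]
    · intro i j; fin_cases i <;> fin_cases j <;> simp
    · intro i
      fin_cases i
      · exact ⟨⟨rfl, by change 0 < G.mult x y; omega⟩, hx, hy⟩
      · exact ⟨⟨Sym2.eq_swap, by change 1 < G.mult y x; rw [G.symm]; omega⟩, hy, hx⟩
  · have hxy : x ≠ y := by rintro rfl; rw [G.irrefl] at h1; omega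
    have hyz : y ≠ z := by rintro rfl; rw [G.irrefl] at h2; omega
    have hzx : z ≠ x := by rintro rfl; rw [G.irrefl] at h3; omega
    refine hF 2 ⟨![x, y, z], ![(s(x, y), 0), (s(y, z), 0), (s(z, x), 0)], ?_, ?_, ?_⟩
    · intro i j; fin_cases i <;> fin_cases j <;>
        simp [hxy, hxy.symm, hyz, hyz.symm, hzx, hzx.symm]
    · intro i j; fin_cases i <;> fin_cases j <;>
        simp [hxy, hxy.symm, hyz, hyz.symm, hzx, hzx.symm]
    · intro i
      fin_cases i
      · exact ⟨⟨rfl, h1⟩, hx, hy⟩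
      · exact ⟨⟨rfl, h2⟩, hy, hz⟩
      · exact ⟨⟨rfl, h3⟩, hz, hx⟩
  · have hAM : ↑A ⊆ M := fun x hx =>
      ((hMF.symm ▸ Set.mem_univ x : x ∈ M ∪ F)).resolve_right (hAF x hx)
    obtain ⟨x, hx, hr⟩ := hA.exists_reflTransGen hAM
    have h1 := hD x (hAM hx)
    have h2 : (G.toGraph.induce A).edgeSet.ncard ≤
        ((G.toGraph.induce M).induce ((G.toGraph.induce M).componentSet x)).edgeSet.ncard := by
      refine Set.ncard_le_ncard ?_ (G.finite_toGraph.2.subset fun e ⟨x, y, he, _⟩ => he.1.edge_mem)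
      rintro e ⟨y, z, h3, hy, hz⟩
      exact ⟨y, z, ⟨h3, hAM hy, hAM hz⟩, hr hy, hr hz⟩
    have h3 := G.ncard_edgeSet_induce_toGraph A
    have h4 := hA.card_le
    simp
    omega

lemma IsTight.not_hasEFFColoring {k : ℤ} {D : ℕ} (h : G.IsTight k D fun _ => 0) :
    ¬ G.toGraph.HasEFFColoring D := fun ⟨_, _, hc⟩ =>
  h.not_weakCol _ (isWeakCol_of_isEFFColoring hc)

lemma linPot_zero (k : ℤ) (A : Finset V) :
    linPot k G (fun _ => 0) A = (2 * k - 1) * A.card - k * G.edges A := by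
  simp [linPot]; ring

lemma IsTight.ncard_edgeSet {k : ℤ} {D : ℕ} (h : G.IsTight k D fun _ => 0) (hk : 0 < k)
    {a b : ℝ} (ha : k * a = 2 * k - 1) (hb : k * b = 1) :
    (G.toGraph.edgeSet.ncard : ℝ) = a * G.toGraph.vertexSet.ncard + 2 * b := by
  have h1 := h.pot_univ
  have h2 := G.ncard_edgeSet_induce_toGraph Finset.univ
  have h3 : G.toGraph.induce (Finset.univ : Finset V) = G.toGraph := by
    rw [Finset.coe_univ]; exact Graph.induce_vertexSet G.toGraph
  rw [h3] at h2
  rw [linPot_zero, ← h2] at h1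
  have h4 : G.toGraph.vertexSet.ncard = (Finset.univ : Finset V).card := by
    rw [← Set.ncard_coe_finset, Finset.coe_univ]; rfl
  rw [h4]
  have hk' : (0 : ℝ) < k := by exact_mod_cast hk
  rify at h1
  refine mul_left_cancel₀ hk'.ne' ?_
  linear_combination -h1 - (Finset.univ : Finset V).card * ha - 2 * hb

lemma IsTight.ncard_edgeSet_induce_le {k : ℤ} {D : ℕ} (h : G.IsTight k D fun _ => 0) (hk : 0 < k)
    {a b : ℝ} (ha : k * a = 2 * k - 1) (hb : k * b = 1) {A : Set V}
    (hA : A ⊂ G.toGraph.vertexSet) :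
    ((G.toGraph.induce A).edgeSet.ncard : ℝ) ≤ a * A.ncard + b := by
  classical
  obtain ⟨B, rfl⟩ : ∃ B : Finset V, (B : Set V) = A := ⟨A.toFinset, by simp⟩
  have h1 := h.pot_ge B (by rintro rfl; rw [Finset.coe_univ] at hA; exact hA.2 le_rfl)
  have h2 := G.ncard_edgeSet_induce_toGraph B
  rw [linPot_zero, ← h2] at h1
  rw [Set.ncard_coe_finset]
  have hk' : (0 : ℝ) < k := by exact_mod_cast hk
  rify at h1
  refine le_of_mul_le_mul_left ?_ hk'
  linear_combination h1 - B.card * ha - hb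

theorem isSharpPair {k : ℤ} {D : ℕ} (hk : 2 ≤ k) {U K : Type} [DecidableEq U] [Fintype U]
    [DecidableEq K] [Fintype K] {H : MultGraph U} {u : U → ℕ} {y z : U}
    (hH : H.IsForcing k D u z) (hy : 1 ≤ u y) {H' : MultGraph K} {u' : K → ℕ} {y' : K}
    (hH' : H'.IsTight k D u') (hy' : 1 ≤ u' y') {a b b' : ℝ} (ha : k * a = 2 * k - 1)
    (hb : k * b = 1) (hb' : b' = 2 * b) : Graph.IsSharpPair D a b b' := by
  subst hb'
  have hk' : (0 : ℝ) < k := by exact_mod_cast (by omega : 0 < k)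
  have hb0 : 0 < b := by
    by_contra! h
    have := mul_nonpos_of_nonneg_of_nonpos hk'.le h
    linarith
  constructor
  · intro N
    obtain ⟨V, _, _, G, hG, hN⟩ := exists_isTight hk hH hy hH' hy' N
    have h1 := hG.ncard_edgeSet (by omega) ha hb
    have h2 := fun A => hG.ncard_edgeSet_induce_le (by omega) ha hb (A := A)
    refine ⟨V, _, G.toGraph, G.finite_toGraph, ?_, ⟨G.loopless_toGraph, fun A hA _ => ?_⟩, h1,
      fun A hA _ => h2 A hA, hG.not_hasEFFColoring⟩
    · change N ≤ (Set.univ : Set V).ncard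
      rwa [Set.ncard_univ, Nat.card_eq_fintype_card]
    · rcases hA.eq_or_ssubset with rfl | hA
      · rw [Graph.induce_vertexSet]; exact h1.le
      · have := h2 A hA; linarith
  · intro a' ha'
    -- For at least this many vertices, (a'-a)|V| absorbs the surplus b that the whole graph has
    -- over (a, b)-sparseness.
    obtain ⟨N, hN⟩ := exists_nat_ge (b / (a' - a))
    obtain ⟨V, _, _, G, hG, hN'⟩ := exists_isTight hk hH hy hH' hy' N
    have h1 := hG.ncard_edgeSet (by omega) ha hb
    have h2 := fun A => hG.ncard_edgeSet_induce_le (by omega) ha hb (A := A)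
    refine ⟨V, _, G.toGraph, G.finite_toGraph, ⟨G.loopless_toGraph, fun A hA _ => ?_⟩,
      hG.not_hasEFFColoring⟩
    rcases hA.eq_or_ssubset with rfl | hA
    · rw [Graph.induce_vertexSet, h1]
      have h3 : (N : ℝ) ≤ G.toGraph.vertexSet.ncard := by
        change (N : ℝ) ≤ (Set.univ : Set V).ncard
        rw [Set.ncard_univ, Nat.card_eq_fintype_card]; exact_mod_cast hN'
      rw [div_le_iff₀ (by linarith)] at hN
      have h4 := mul_le_mul_of_nonneg_right h3 (by linarith : 0 ≤ a' - a)
      linarith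
    · refine (h2 A hA).trans ?_
      gcongr

end MultGraph

theorem mainTheorem7 :
    (∀ D : ℕ, Odd D → 1 ≤ D →
      (∀ {α β : Type*} (G : Graph α β), G.IsFiniteMultigraph →
        G.IsSparse ((4 * (D : ℝ) + 3) / (2 * (D : ℝ) + 2)) (1 / (2 * ((D : ℝ) + 1))) →
        G.HasEFFColoring D) ∧
      Graph.IsSharpPair D ((4 * (D : ℝ) + 3) / (2 * (D : ℝ) + 2))
        (1 / (2 * ((D : ℝ) + 1))) (2 / (2 * ((D : ℝ) + 1)))) ∧
    (∀ D : ℕ, Even D → 2 ≤ D →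
      (∀ {α β : Type*} (G : Graph α β), G.IsFiniteMultigraph →
        G.IsSparse ((4 * (D : ℝ) + 1) / (2 * (D : ℝ) + 1)) (1 / (2 * (D : ℝ) + 1)) →
        G.HasEFFColoring D) ∧
      Graph.IsSharpPair D ((4 * (D : ℝ) + 1) / (2 * (D : ℝ) + 1))
        (1 / (2 * (D : ℝ) + 1)) (2 / (2 * (D : ℝ) + 1))) := by
  refine ⟨fun D hD _ => ?_, fun D hD h2 => ?_⟩
  · have hk := MultGraph.edgeCost_odd (Nat.odd_iff.1 hD)
    constructor
    · intro α β G hf hs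
      refine MultGraph.hasEFFColoring_of_isSparse G hf ?_ ?_ hs
      · rw [hk]; push_cast; field_simp; ring
      · rw [hk]; push_cast; field_simp
    · refine MultGraph.isSharpPair (k := 2 * D + 2) (by omega)
        MultGraph.isForcing_doubleEdge (y := true) (by simp)
        MultGraph.isTight_doubleEdge (y' := true) (by simp) ?_ ?_ ?_
      · push_cast; field_simp; ring
      · push_cast; field_simp
      · ring
  · have hk := MultGraph.edgeCost_even (Nat.even_iff.1 hD)
    constructor
    · intro α β G hf hs
      refine MultGraph.hasEFFColoring_of_isSparse G hf ?_ ?_ hs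
      · rw [hk]; push_cast; field_simp; ring
      · rw [hk]; push_cast; field_simp
    · obtain ⟨h, rfl⟩ := hD.two_dvd
      refine MultGraph.isSharpPair (k := 4 * h + 1) (by omega)
        (MultGraph.isForcing_kite (by omega)) (y := 0) (by simp; omega)
        MultGraph.isTight_completeFour (y' := 0) (by omega) ?_ ?_ ?_
      · push_cast; field_simp; ring
      · push_cast; field_simp; ring
      · ring
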